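/- **Conventions.** For nonzero integers $a_1,\dots,a_m$ let $K=\left(\frac{a_1,\dots,a_m}{\mathbb Q}\right)$ be the $\mathbb Q$-algebra generated by anticommuting elements $\gamma_1,\dots,\gamma_m$ with $\gamma_j^2=a_j$ (a Clifford algebra of dimension $2^m$), and let $\mathbb Z[\gamma_1,\dots,\gamma_m]=\left(\frac{a_1,\dots,a_m}{\mathbb Z}\right)\subset K$ be its *Clifford order*. When all $a_j=-1$ write $i_j$ for $\gamma_j$, and put $i_0=1$. Let $x\mapsto x^*$ be the anti-automorphism of $K$ fixing each $\gamma_j$, and $x\mapsto\bar x$ the one sending $\gamma_j$ to $-\gamma_j$. Put $\mathrm{Vec}(K)=\mathbb Q\oplus\mathbb Q\gamma_1\oplus\dots\oplus\mathbb Q\gamma_m$ (the Clifford vectors) and let $K^{\mathrm{mon}}$ be the set of all $x\in K$ with $x\bar x\in\mathbb Q$ and $x\,\mathrm{Vec}(K)\,x^*\subset\mathrm{Vec}(K)$. An *order* in $K$ is a subring $\mathcal O$ that is finitely generated as a $\mathbb Z$-module and generates $K$ over $\mathbb Q$. Put $\mathrm{Vec}(\mathcal O)=\mathcal O\cap\mathrm{Vec}(K)$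 and $\mathcal O^{\mathrm{mon}}=\mathcal O\cap K^{\mathrm{mon}}$; a *Clifford unit* of $\mathcal O$ is a unit of $\mathcal O$ lying in $K^{\mathrm{mon}}$. Orders $\mathcal O,\mathcal O'$ are *Clifford conjugate* if $x^{-1}\mathcal Ox=\mathcal O'$ for some invertible $x\in K^{\mathrm{mon}}$. A $*$-stable order $\mathcal O$ is *right Clifford-Euclidean* if there is $N:\mathcal O^{\mathrm{mon}}\to\mathbb N$ such that $N(x)=0$ if and only if $x$ is a zero-divisor in $\mathcal O$, and such that for all $x,y\in\mathcal O^{\mathrm{mon}}$ with $N(x)>0$ and $xy^*\in\mathrm{Vec}(\mathcal O)$ there are $q\in\mathrm{Vec}(\mathcal O)$ and $r\in\mathcal O^{\mathrm{mon}}$ with $y=xq+r$ and $N(r)<N(x)$. It is *left Clifford-Euclidean* if the same holds with $x^*y\in\mathrm{Vec}(\mathcal O)$ and $y=qx+r$. It is *cuspidally principal* if for every $v\in\mathrm{Vec}(K)$ there is a matrix $\begin{pmatrix}a&b\\c&d\end{pmatrix}$ with entries in $\mathcal O^{\mathrm{mon}}$ such that $ad^*-bc^*=1$, $ab^*\in\mathrm{Vec}(K)$,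 $dc^*\in\mathrm{Vec}(K)$, $c$ is invertible in $K$ and $c^{-1}d=v$. For a binary code $C\subset\mathbb F_2^{n}$ put $\tfrac12\Lambda_C=\{\tfrac12\sum_{j=0}^{n-1}c_ji_j : c\in\mathbb Z^{n},\ c\bmod 2\in C\}$. A code is *doubly even* if all its words have weight divisible by $4$; an $[n,k,d]$ code has length $n$, dimension $k$ and minimal distance $d$. **Theorem.** 1. In $\left(\frac{-1,-1,-1}{\mathbb Q}\right)$ there is a unique maximal order $\mathcal O_4$ containing the Clifford order $\mathbb Z[i_1,i_2,i_3]$. It is $*$-stable and both right and left Clifford-Euclidean. With the bilinear form $x\bar y+y\bar x$, the group $\mathrm{Vec}(\mathcal O_4)$ is a $D_4$ root lattice: it has a $\mathbb Z$-basis whose Gram matrix is the Cartan matrix of type $D_4$. Such a basis $(b_1,\dots,b_4)$ and a Clifford unit $\alpha$ of $\mathcal O_4$ can be chosen so that $b_k\mapsto\alpha b_k\alpha^*$ permutes the basis by an automorphism of order $3$ of the $D_4$ Dynkin diagram (triality). The order $\mathbb Z[i_1,i_2,i_3]$ is $*$-stable, but it is neither right nor left Clifford-Euclidean, nor is it cuspidally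 principal. 2. There are exactly five doubly even $[5,1,4]$ binary codes. The maximal orders in $\left(\frac{-1,-1,-1,-1}{\mathbb Q}\right)$ containing the Clifford order are six distinct orders: for each doubly even $[5,1,4]$ code $C$ one order $\mathcal O_C$ with $\mathrm{Vec}(\mathcal O_C)=\tfrac12\Lambda_C$, and one further order $\mathcal O_!$ (the "oddball") with $\mathrm{Vec}(\mathcal O_!)=\tfrac12\Lambda_0=\mathbb Z i_0\oplus\dots\oplus\mathbb Z i_4$, corresponding to the trivial code. They form exactly two Clifford conjugacy classes, namely the five orders $\mathcal O_C$, and $\{\mathcal O_!\}$. 3. In $\left(\frac{-1,-3}{\mathbb Q}\right)$ there are exactly two maximal orders containing the Clifford order. One contains $(1+\gamma_2)/2$ and the other contains $(1+\gamma_1\gamma_2)/2$. They are Clifford conjugate to each other, so that they form a single Clifford conjugacy class. Both are $*$-stable and both are right and left Clifford-Euclidean. 4. In $\left(\frac{-1,-1,-3}{\mathbb Q}\right)$ the maximal orders containing the Clifford order form exactly two Clifford conjugacy classes. -/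

import Mathlib

namespace RationalClifford

section Algebra

variable {m : ℕ} (a : Fin m → ℤ)

/-- The diagonal form `∑ j, a j * y j ^ 2` on `ℚ ^ m`. -/
abbrev form : QuadraticForm ℚ (Fin m → ℚ) :=
  QuadraticMap.weightedSumSquares ℚ (fun j => (a j : ℚ))

/-- The rational Clifford algebra `(a 0, …, a (m - 1) / ℚ)`: its generators anticommute and the
`j`-th one has square `a j`. -/
abbrev Alg : Type := CliffordAlgebra (form a)

/-- The standard generators of the Clifford algebra. -/
noncomputable def gen (j : Fin m) : Alg a :=
  CliffordAlgebra.ι (form a) (Pi.single j 1)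

/-- The standard basis of the Clifford vectors: `1` followed by the standard generators. -/
noncomputable def frame : Fin (m + 1) → Alg a :=
  Fin.cons 1 (gen a)

/-- The Clifford order `(a 0, …, a (m - 1) / ℤ)`, as a subring of `(a 0, …, a (m - 1) / ℚ)`. -/
noncomputable def cliffordOrder : Subring (Alg a) :=
  Subring.closure (Set.range (gen a))

/-- The Clifford vectors of the algebra: the span of `1` and of the quadratic space
(many authors call these paravectors). -/
noncomputable def vec : Submodule ℚ (Alg a) :=
  Submodule.span ℚ (insert 1 (Set.range (CliffordAlgebra.ι (form a))))

variable {a}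

/-- The transpose (reversal) involution `x ↦ x^*`. -/
noncomputable def rev (x : Alg a) : Alg a := CliffordAlgebra.reverse x

/-- Clifford conjugation, the composite of reversal and the parity involution. -/
noncomputable def bar (x : Alg a) : Alg a :=
  CliffordAlgebra.involute (CliffordAlgebra.reverse x)

variable (a)

/-- The Clifford monoid: all `x` such that `x * bar x` is a scalar and `x v x^*` is a Clifford
vector for every Clifford vector `v`. -/
def cliffordMonoid : Set (Alg a) :=
  {x | x * bar x ∈ Set.range (algebraMap ℚ (Alg a)) ∧ ∀ v ∈ vec a, x * v * rev x ∈ vec a}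

end Algebra

section Orders

variable {m : ℕ} {a : Fin m → ℤ}

/-- An order: a subring that is a finitely generated `ℤ`-module and generates the algebra
over `ℚ`. -/
def IsOrder (O : Subring (Alg a)) : Prop :=
  O.toAddSubgroup.FG ∧ Algebra.adjoin ℚ (O : Set (Alg a)) = ⊤

variable (a)

/-- The maximal orders that contain the Clifford order. -/
def maxOrders : Set (Subring (Alg a)) :=
  {O | Maximal IsOrder O ∧ cliffordOrder a ≤ O}

variable {a}

/-- The Clifford vectors of an order. -/
noncomputable def intVec (O : Subring (Alg a)) : AddSubgroup (Alg a) :=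
  O.toAddSubgroup ⊓ (vec a).toAddSubgroup

/-- The Clifford monoid of an order. -/
def orderMonoid (O : Subring (Alg a)) : Set (Alg a) :=
  (O : Set (Alg a)) ∩ cliffordMonoid a

/-- The Clifford units of an order: the units of the order in the Clifford monoid. -/
def IsCliffordUnit (O : Subring (Alg a)) (x : Alg a) : Prop :=
  x ∈ orderMonoid O ∧ ∃ y ∈ O, x * y = 1 ∧ y * x = 1

/-- The order is stable under reversal. -/
def IsStarStable (O : Subring (Alg a)) : Prop :=
  ∀ x ∈ O, rev x ∈ O

/-- `O'` is conjugate to `O` by an invertible element of the Clifford monoid. -/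
def CliffordConj (O O' : Subring (Alg a)) : Prop :=
  ∃ x : (Alg a)ˣ, (x : Alg a) ∈ cliffordMonoid a ∧
    (O' : Set (Alg a)) = (fun z : Alg a => (↑x⁻¹ : Alg a) * z * (x : Alg a)) '' (O : Set (Alg a))

/-- The Clifford conjugacy classes in a set of orders. -/
def conjClasses (S : Set (Subring (Alg a))) : Set (Set (Subring (Alg a))) :=
  (fun O => {O' | O' ∈ S ∧ CliffordConj O O'}) '' S

/-- `x` is a left or a right zero-divisor of `O` (so `0` is one). -/
def IsZeroDivisorIn (O : Subring (Alg a)) (x : Alg a) : Prop :=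
  ∃ y ∈ O, y ≠ 0 ∧ (x * y = 0 ∨ y * x = 0)

/-- Right Clifford-Euclidean orders. Only the values of `N` on the Clifford monoid of the order
matter. If `x` is invertible, then `x * y^*` is a Clifford vector if and only if `x⁻¹ * y` is. -/
def IsRightCliffordEuclidean (O : Subring (Alg a)) : Prop :=
  ∃ N : Alg a → ℕ,
    (∀ x ∈ orderMonoid O, N x = 0 ↔ IsZeroDivisorIn O x) ∧
    ∀ x ∈ orderMonoid O, ∀ y ∈ orderMonoid O, 0 < N x → x * rev y ∈ intVec O →
      ∃ q ∈ intVec O, ∃ r ∈ orderMonoid O, y = x * q + r ∧ N r < N x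

/-- Left Clifford-Euclidean orders, the mirror image of the right ones under reversal. -/
def IsLeftCliffordEuclidean (O : Subring (Alg a)) : Prop :=
  ∃ N : Alg a → ℕ,
    (∀ x ∈ orderMonoid O, N x = 0 ↔ IsZeroDivisorIn O x) ∧
    ∀ x ∈ orderMonoid O, ∀ y ∈ orderMonoid O, 0 < N x → rev x * y ∈ intVec O →
      ∃ q ∈ intVec O, ∃ r ∈ orderMonoid O, y = q * x + r ∧ N r < N x

/-- The Clifford special linear group `SL₂(O)`. -/
def SL2 (O : Subring (Alg a)) : Set (Matrix (Fin 2) (Fin 2) (Alg a)) :=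
  {M | (∀ i j, M i j ∈ orderMonoid O) ∧
    M 0 0 * rev (M 1 1) - M 0 1 * rev (M 1 0) = 1 ∧
    M 0 0 * rev (M 0 1) ∈ vec a ∧ M 1 1 * rev (M 1 0) ∈ vec a}

/-- Cuspidally principal orders: each Clifford vector `v` of the algebra is `c⁻¹ * d` for the
bottom row `(c, d)` of a matrix in `SL₂(O)`. -/
def IsCuspidallyPrincipal (O : Subring (Alg a)) : Prop :=
  ∀ v ∈ vec a, ∃ M ∈ SL2 O, IsUnit (M 1 0) ∧ M 1 1 = M 1 0 * v

/-- `b` is a `ℤ`-basis of the Clifford vectors of `O` that is a system of simple roots of type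
`D₄` for the bilinear form `x * bar y + y * bar x`, which is the polarization of
`x ↦ x * bar x`. -/
def IsD4Base (O : Subring (Alg a)) (b : Fin 4 → Alg a) : Prop :=
  LinearIndependent ℤ b ∧ AddSubgroup.closure (Set.range b) = intVec O ∧
    ∀ i j, b i * bar (b j) + b j * bar (b i) =
      algebraMap ℚ (Alg a) ((CartanMatrix.D 4 i j : ℤ) : ℚ)

end Orders

section Codes

/-- A binary code is doubly even if all its words have weight divisible by `4`. -/
def IsDoublyEven {n : ℕ} (C : Submodule (ZMod 2) (Fin n → ZMod 2)) : Prop :=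
  ∀ c ∈ C, 4 ∣ hammingNorm c

/-- `C` is an `[n, k, d]` code: it has length `n`, dimension `k` and minimal distance `d`. -/
def HasParameters {n : ℕ} (C : Submodule (ZMod 2) (Fin n → ZMod 2)) (k d : ℕ) : Prop :=
  Module.finrank (ZMod 2) C = k ∧
    IsLeast {e : ℕ | ∃ v ∈ C, ∃ w ∈ C, v ≠ w ∧ hammingDist v w = e} d

/-- The doubly even binary `[5, 1, 4]` codes. -/
def codes514 : Set (Submodule (ZMod 2) (Fin 5 → ZMod 2)) :=
  {C | IsDoublyEven C ∧ HasParameters C 1 4}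

variable {m : ℕ}

/-- The vectors `(c 0 + c 1 * i₁ + ⋯ + c m * i_m) / 2` for the integral `c` whose reduction
modulo `2` is in the code `C`. -/
def halfCodeLattice (a : Fin m → ℤ) (C : Submodule (ZMod 2) (Fin (m + 1) → ZMod 2)) :
    Set (Alg a) :=
  {x | ∃ c : Fin (m + 1) → ℤ, (fun j => (c j : ZMod 2)) ∈ C ∧
    x = ∑ j, ((c j : ℚ) / 2) • frame a j}

end Codes

end RationalClifford

namespace RationalClifford

/-! ### Involutions, Clifford vectors, the Clifford monoid and Clifford conjugacy in a general
rational Clifford algebra -/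

section Generic

variable {m : ℕ} {a : Fin m → ℤ}

/-! Each of the four algebras is identified with a concrete one by writing down a map on generators,
checking surjectivity and comparing dimensions: `φ` gives ℍ × ℍ for (-1,-1,-1), `ρ` gives M₂(ℍ) for
(-1,-1,-1,-1), `ψ` gives the quaternion algebra (-1,-3/ℚ), and `χ` gives the Hamilton quaternions
over ℚ(√3) for (-1,-1,-3). Maximal orders are found with `maxOrders_eq`: it suffices to exhibit
pairwise incomparable orders such that every order over the Clifford order lies in one of them.

For the quaternionic models the covering step rests on integrality. Powers of an element of an order
have a common denominator, so its norm is integral (`isInt_of_pow`, `isInt₃_of_pow`). Polarizing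
against the generators makes the coordinates half integral, and integrality of the norm becomes a
congruence on their numerators. For (-1,-1,-1) this leaves the Hurwitz quaternions in both factors.
For (-1,-3) it leaves two parity patterns that cannot coexist in one order. For (-1,-1,-3) an
element outside the Hurwitz type order `GH` determines one of three other orders, because the
congruences it imposes on the rest of the order form an invertible convolution over 𝔽₂
(`convolution_injective`).

For M₂(ℍ) an order O stabilizes a lattice of columns, a right module over the Hurwitz ring H. As H
is right principal, the lattice can be scaled to lie in H² and to contain some (1, b)
(`exists_lattice`). Stability under the Clifford order then leaves six lattices (`lattice_classes`):
H², the pairs congruent modulo (1+i)H, and the four lattices "second entry = u · first entry modulo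
2" with u = 1, i, j, k. All but the second are carried to a multiple of H² by Clifford vectors, so
their stabilizers lie in conjugates of M₂(H), the orders of the codes; the second lattice gives the
oddball.

Conjugacies are given by explicit Clifford vectors or products of them. In (-1,-1,-3) the classes
are separated by a twelfth root of unity of reduced trace √3. In (-1,-1,-1,-1) a Clifford
conjugation induces an isometry from one lattice of Clifford vectors into the other, whereas ℤ⁵ has
integral inner products and the code lattices do not.

The Euclidean property follows from a covering radius below 1
(`isRightCliffordEuclidean_of_covering`). For ℤ[i₁,i₂,i₃] it fails for every N: dividing 1+i₁+i₂+i₃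
by 2 starts an infinite descent. Cuspidal principality fails at v = (1+i₁+i₂+i₃)/2 since both bottom
entries of the matrix would have even coordinate sum. -/

theorem finrank_alg (a : Fin m → ℤ) : Module.finrank ℚ (Alg a) = 2 ^ m := by
  have : Invertible (2 : ℚ) := invertibleOfNonzero two_ne_zero
  rw [(CliffordAlgebra.equivExterior (form a)).finrank_eq,
    Module.finrank_eq_card_basis (Pi.basisFun ℚ (Fin m)).ExteriorAlgebra]
  simp

instance (a : Fin m → ℤ) : Module.Finite ℚ (Alg a) :=
  Module.finite_of_finrank_pos (by rw [finrank_alg]; positivity)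

/-- An algebra map from a rational Clifford algebra to an algebra of the same dimension is
injective if it is surjective. -/
theorem injective_of_surjective {B : Type*} [Ring B] [Algebra ℚ B] (hB : Module.finrank ℚ B = 2 ^ m)
    (f : Alg a →ₐ[ℚ] B) (hf : Function.Surjective f) : Function.Injective f := by
  have : Module.Finite ℚ B := Module.finite_of_finrank_pos (by rw [hB]; positivity)
  exact (LinearMap.injective_iff_surjective_of_finrank_eq_finrank (f := f.toLinearMap)
    (by rw [finrank_alg, hB])).2 hf

@[simp] theorem rev_mul (x y : Alg a) : rev (x * y) = rev y * rev x := by simp [rev]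
@[simp] theorem rev_add (x y : Alg a) : rev (x + y) = rev x + rev y := by simp [rev]
@[simp] theorem rev_neg (x : Alg a) : rev (-x) = -rev x := by simp [rev]
@[simp] theorem rev_smul (r : ℚ) (x : Alg a) : rev (r • x) = r • rev x := by simp [rev]
@[simp] theorem rev_zero : rev (0 : Alg a) = 0 := by simp [rev]
@[simp] theorem rev_one : rev (1 : Alg a) = 1 := by simp [rev]
@[simp] theorem rev_rev (x : Alg a) : rev (rev x) = x := by simp [rev]
@[simp] theorem rev_algebraMap (r : ℚ) : rev (algebraMap ℚ (Alg a) r) = algebraMap ℚ _ r := by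
  simp [rev]
@[simp] theorem rev_ι (u : Fin m → ℚ) :
    rev (CliffordAlgebra.ι (form a) u) = CliffordAlgebra.ι (form a) u := by simp [rev]
@[simp] theorem rev_gen (j : Fin m) : rev (gen a j) = gen a j := by simp [gen]

@[simp] theorem bar_mul (x y : Alg a) : bar (x * y) = bar y * bar x := by simp [bar]
@[simp] theorem bar_add (x y : Alg a) : bar (x + y) = bar x + bar y := by simp [bar]
@[simp] theorem bar_smul (r : ℚ) (x : Alg a) : bar (r • x) = r • bar x := by simp [bar]
@[simp] theorem bar_one : bar (1 : Alg a) = 1 := by simp [bar]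
@[simp] theorem bar_bar (x : Alg a) : bar (bar x) = x := by
  simp [bar, ← CliffordAlgebra.reverse_involute]
@[simp] theorem bar_algebraMap (r : ℚ) : bar (algebraMap ℚ (Alg a) r) = algebraMap ℚ _ r := by
  simp [bar]
@[simp] theorem bar_ι (u : Fin m → ℚ) :
    bar (CliffordAlgebra.ι (form a) u) = -CliffordAlgebra.ι (form a) u := by simp [bar]
theorem rev_bar (x : Alg a) : rev (bar x) = bar (rev x) := by
  simp [rev, bar, CliffordAlgebra.reverse_involute]

theorem mem_vec_iff {x : Alg a} :
    x ∈ vec a ↔ ∃ (r : ℚ) (u : Fin m → ℚ), x = algebraMap ℚ _ r + CliffordAlgebra.ι (form a) u := by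
  rw [vec, Submodule.mem_span_insert, ← LinearMap.coe_range, Submodule.span_eq]
  constructor
  · rintro ⟨r, _, ⟨u, rfl⟩, rfl⟩
    exact ⟨r, u, by rw [Algebra.algebraMap_eq_smul_one]⟩
  · rintro ⟨r, u, rfl⟩
    exact ⟨r, _, ⟨u, rfl⟩, by rw [Algebra.algebraMap_eq_smul_one]⟩

theorem ι_eq_sum (u : Fin m → ℚ) : CliffordAlgebra.ι (form a) u = ∑ j, u j • gen a j := by
  conv_lhs => rw [pi_eq_sum_univ' u]
  simp only [map_sum, map_smul, gen]

theorem mem_vec_iff_frame {x : Alg a} :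
    x ∈ vec a ↔ ∃ c : Fin (m + 1) → ℚ, x = ∑ j, c j • frame a j := by
  rw [mem_vec_iff]
  constructor
  · rintro ⟨r, u, rfl⟩
    refine ⟨Fin.cons r u, ?_⟩
    rw [Fin.sum_univ_succ, ι_eq_sum]
    simp [frame, Algebra.algebraMap_eq_smul_one]
  · rintro ⟨c, rfl⟩
    refine ⟨c 0, fun j => c j.succ, ?_⟩
    rw [Fin.sum_univ_succ, ι_eq_sum]
    simp [frame, Algebra.algebraMap_eq_smul_one]

theorem one_mem_vec : (1 : Alg a) ∈ vec a := Submodule.subset_span (Set.mem_insert _ _)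

theorem gen_mem_vec (j : Fin m) : gen a j ∈ vec a :=
  Submodule.subset_span (Set.mem_insert_of_mem _ ⟨_, rfl⟩)

theorem rev_of_mem_vec {v : Alg a} (hv : v ∈ vec a) : rev v = v := by
  obtain ⟨r, u, rfl⟩ := mem_vec_iff.1 hv
  simp

theorem bar_mem_vec {v : Alg a} (hv : v ∈ vec a) : bar v ∈ vec a := by
  obtain ⟨r, u, rfl⟩ := mem_vec_iff.1 hv
  exact mem_vec_iff.2 ⟨r, -u, by simp⟩

theorem vec_mul_bar {v : Alg a} (hv : v ∈ vec a) :
    ∃ q : ℚ, v * bar v = algebraMap ℚ _ q ∧ bar v * v = algebraMap ℚ _ q := by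
  obtain ⟨r, u, rfl⟩ := mem_vec_iff.1 hv
  refine ⟨r * r - form a u, ?_, ?_⟩ <;>
  · simp only [bar_add, bar_algebraMap, bar_ι, map_sub, map_mul, add_mul, mul_add,
      neg_mul, mul_neg, CliffordAlgebra.ι_sq_scalar]
    rw [Algebra.commutes r (CliffordAlgebra.ι (form a) u)]
    abel

/-- Polarizing v ↦ v v̄ shows that w v + v̄ w̄ is a scalar, and v w v = v (w v + v̄ w̄) - (v v̄) w̄
is then a combination of v and w̄. -/
theorem mul_mul_mem_vec {v w : Alg a} (hv : v ∈ vec a) (hw : w ∈ vec a) : v * w * v ∈ vec a := by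
  obtain ⟨p, hp, -⟩ := vec_mul_bar ((vec a).add_mem hw (bar_mem_vec hv))
  obtain ⟨q, hq, -⟩ := vec_mul_bar hw
  obtain ⟨s, hs, hs'⟩ := vec_mul_bar hv
  have key : w * v + bar v * bar w = algebraMap ℚ _ (p - q - s) := by
    have : (w + bar v) * bar (w + bar v) = w * bar w + bar v * v + (w * v + bar v * bar w) := by
      simp only [bar_add, bar_bar]; noncomm_ring
    rw [hp, hq, hs'] at this
    rw [map_sub, map_sub, this]; abel
  have : v * w * v = v * (w * v + bar v * bar w) - (v * bar v) * bar w := by noncomm_ring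
  rw [this, key, hs, ← Algebra.commutes, ← Algebra.smul_def, ← Algebra.smul_def]
  exact (vec a).sub_mem ((vec a).smul_mem _ hv) ((vec a).smul_mem _ (bar_mem_vec hw))

theorem mem_cliffordMonoid_of_mem_vec {v : Alg a} (hv : v ∈ vec a) : v ∈ cliffordMonoid a := by
  refine ⟨?_, fun w hw => ?_⟩
  · obtain ⟨q, hq, -⟩ := vec_mul_bar hv
    exact ⟨q, hq.symm⟩
  · rw [rev_of_mem_vec hv]
    exact mul_mul_mem_vec hv hw

theorem cliffordMonoid_mul {x y : Alg a} (hx : x ∈ cliffordMonoid a) (hy : y ∈ cliffordMonoid a) :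
    x * y ∈ cliffordMonoid a := by
  obtain ⟨⟨p, hp⟩, hx⟩ := hx
  obtain ⟨⟨q, hq⟩, hy⟩ := hy
  refine ⟨⟨q * p, ?_⟩, fun v hv => ?_⟩
  · rw [bar_mul, map_mul, hp, hq, show x * y * (bar y * bar x) = x * (y * bar y) * bar x by
      noncomm_ring, ← hq, ← Algebra.commutes]
    noncomm_ring
  · have := hx _ (hy v hv)
    rw [rev_mul]
    convert this using 1
    noncomm_ring

/-- For a unit of the Clifford monoid, `x * bar x` is a nonzero scalar that also equals
`bar x * x`. -/
theorem unit_mul_bar {x : (Alg a)ˣ} (hx : (x : Alg a) ∈ cliffordMonoid a) :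
    ∃ q : ℚ, q ≠ 0 ∧ (x : Alg a) * bar (x : Alg a) = algebraMap ℚ _ q ∧
      bar (x : Alg a) * x = algebraMap ℚ _ q ∧ bar (x : Alg a) = q • (↑x⁻¹ : Alg a) := by
  obtain ⟨q, hq⟩ := hx.1
  have h1 : bar (x : Alg a) = q • (↑x⁻¹ : Alg a) := by
    rw [Algebra.smul_def, Algebra.commutes, hq, x.inv_mul_cancel_left]
  refine ⟨q, ?_, hq.symm, ?_, h1⟩
  · rintro rfl
    have h2 := congrArg bar x.mul_inv
    rw [bar_mul, h1, zero_smul, mul_zero, bar_one] at h2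
    exact zero_ne_one h2
  · rw [h1, Algebra.smul_mul_assoc, x.inv_mul, Algebra.algebraMap_eq_smul_one]

/-- The map w ↦ x w x^* is an injective endomorphism of the finite-dimensional space of Clifford
vectors, hence bijective, so its inverse preserves that space too. This is what makes Clifford
conjugacy symmetric. -/
theorem cliffordMonoid_inv {x : (Alg a)ˣ} (hx : (x : Alg a) ∈ cliffordMonoid a) :
    (↑x⁻¹ : Alg a) ∈ cliffordMonoid a := by
  obtain ⟨q, hq0, h1, h2, h3⟩ := unit_mul_bar hx
  have h4 : (↑x⁻¹ : Alg a) = q⁻¹ • bar (x : Alg a) := by rw [h3, smul_smul, inv_mul_cancel₀ hq0, one_smul]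
  have r1 : rev (x : Alg a) * rev (↑x⁻¹ : Alg a) = 1 := by rw [← rev_mul, x.inv_mul, rev_one]
  have r2 : rev (↑x⁻¹ : Alg a) * rev (x : Alg a) = 1 := by rw [← rev_mul, x.mul_inv, rev_one]
  refine ⟨⟨q⁻¹, ?_⟩, fun v hv => ?_⟩
  · rw [h4, bar_smul, bar_bar, smul_mul_smul_comm, h2, Algebra.algebraMap_eq_smul_one,
      Algebra.algebraMap_eq_smul_one, smul_smul, mul_assoc, inv_mul_cancel₀ hq0, mul_one]
  · let f : vec a →ₗ[ℚ] vec a :=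
      { toFun := fun w => ⟨x * w * rev (x : Alg a), hx.2 _ w.2⟩
        map_add' := fun u w => by ext; simp [mul_add, add_mul]
        map_smul' := fun r w => by ext; simp }
    have hf : Function.Injective f := by
      intro u w huw
      have : (x : Alg a) * u * rev (x : Alg a) = x * w * rev (x : Alg a) := congrArg Subtype.val huw
      have h5 := congrArg (fun z => (↑x⁻¹ : Alg a) * z * rev (↑x⁻¹ : Alg a)) this
      simp only [mul_assoc, x.inv_mul_cancel_left] at h5
      rw [r1, mul_one, mul_one] at h5
      exact Subtype.ext h5
    obtain ⟨w, hw⟩ := LinearMap.injective_iff_surjective.1 hf ⟨v, hv⟩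
    have hw' : (x : Alg a) * w * rev (x : Alg a) = v := congrArg Subtype.val hw
    rw [← hw']
    have : (↑x⁻¹ : Alg a) * (x * w * rev (x : Alg a)) * rev (↑x⁻¹ : Alg a) = w := by
      simp only [mul_assoc, x.inv_mul_cancel_left]
      rw [r1, mul_one]
    rw [this]
    exact w.2

theorem cliffordConj_iff {O O' : Subring (Alg a)} :
    CliffordConj O O' ↔ ∃ x : (Alg a)ˣ, (x : Alg a) ∈ cliffordMonoid a ∧
      ∀ z, z ∈ O' ↔ (x : Alg a) * z * (↑x⁻¹ : Alg a) ∈ O := by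
  refine exists_congr fun x => and_congr_right fun _ => ?_
  rw [Set.ext_iff]
  refine forall_congr' fun z => ?_
  refine iff_congr Iff.rfl ⟨?_, fun h => ⟨_, h, ?_⟩⟩
  · rintro ⟨w, hw, rfl⟩
    simpa [mul_assoc] using hw
  · simp [mul_assoc]

theorem CliffordConj.refl (O : Subring (Alg a)) : CliffordConj O O :=
  cliffordConj_iff.2 ⟨1, mem_cliffordMonoid_of_mem_vec one_mem_vec, by simp⟩

theorem CliffordConj.symm {O O' : Subring (Alg a)} (h : CliffordConj O O') : CliffordConj O' O := by
  obtain ⟨x, hx, h⟩ := cliffordConj_iff.1 h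
  refine cliffordConj_iff.2 ⟨x⁻¹, cliffordMonoid_inv hx, fun z => ?_⟩
  rw [h]
  simp [mul_assoc]

theorem CliffordConj.trans {O O' O'' : Subring (Alg a)} (h : CliffordConj O O')
    (h' : CliffordConj O' O'') : CliffordConj O O'' := by
  obtain ⟨x, hx, h⟩ := cliffordConj_iff.1 h
  obtain ⟨y, hy, h'⟩ := cliffordConj_iff.1 h'
  refine cliffordConj_iff.2 ⟨x * y, cliffordMonoid_mul hx hy, fun z => ?_⟩
  rw [h', h]
  simp [mul_assoc]

theorem conjClasses_eq_pair {A B : Set (Subring (Alg a))} {O₁ O₂ : Subring (Alg a)}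
    (h₁ : O₁ ∈ A) (h₂ : O₂ ∈ B) (hA : ∀ O ∈ A, CliffordConj O₁ O)
    (hB : ∀ O ∈ B, CliffordConj O₂ O) (hAB : ¬ CliffordConj O₁ O₂) :
    conjClasses (A ∪ B) = {A, B} := by
  have cA : ∀ O ∈ A, {O' | O' ∈ A ∪ B ∧ CliffordConj O O'} = A := fun O hO => by
    ext O'
    refine ⟨?_, fun h => ⟨Or.inl h, (hA O hO).symm.trans (hA O' h)⟩⟩
    rintro ⟨h | h, hc⟩
    · exact h
    · exact absurd ((hA O hO).trans (hc.trans (hB O' h).symm)) hAB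
  have cB : ∀ O ∈ B, {O' | O' ∈ A ∪ B ∧ CliffordConj O O'} = B := fun O hO => by
    ext O'
    refine ⟨?_, fun h => ⟨Or.inr h, (hB O hO).symm.trans (hB O' h)⟩⟩
    rintro ⟨h | h, hc⟩
    · exact absurd ((hA O' h).trans (hc.symm.trans (hB O hO).symm)) hAB
    · exact h
  ext X
  constructor
  · rintro ⟨O, hO | hO, rfl⟩
    · exact Or.inl (cA O hO)
    · exact Or.inr (cB O hO)
  · rintro (rfl | rfl)
    · exact ⟨O₁, Or.inl h₁, cA O₁ h₁⟩
    · exact ⟨O₂, Or.inr h₂, cB O₂ h₂⟩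

theorem ncard_conjClasses_eq_two {A B : Set (Subring (Alg a))} {O₁ O₂ : Subring (Alg a)}
    (h₁ : O₁ ∈ A) (h₂ : O₂ ∈ B) (hA : ∀ O ∈ A, CliffordConj O₁ O)
    (hB : ∀ O ∈ B, CliffordConj O₂ O) (hAB : ¬ CliffordConj O₁ O₂) :
    (conjClasses (A ∪ B)).ncard = 2 := by
  rw [conjClasses_eq_pair h₁ h₂ hA hB hAB, Set.ncard_pair]
  rintro rfl
  exact hAB (hA O₂ h₂)

theorem conjClasses_eq_singleton {A : Set (Subring (Alg a))} {O₁ : Subring (Alg a)}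
    (h₁ : O₁ ∈ A) (hA : ∀ O ∈ A, CliffordConj O₁ O) : conjClasses A = {A} := by
  have cA : ∀ O ∈ A, {O' | O' ∈ A ∧ CliffordConj O O'} = A := fun O hO => by
    ext O'
    exact ⟨fun h => h.1, fun h => ⟨h, (hA O hO).symm.trans (hA O' h)⟩⟩
  ext X
  constructor
  · rintro ⟨O, hO, rfl⟩
    exact cA O hO
  · rintro rfl
    exact ⟨O₁, h₁, cA O₁ h₁⟩

end Generic

/-! ### Integrality from bounded denominators, and finite generation -/

section Integers

/-- A rational number that is an integer. -/
def IsInt (q : ℚ) : Prop := ∃ z : ℤ, q = z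

theorem isInt_intCast (z : ℤ) : IsInt z := ⟨z, rfl⟩
theorem isInt_zero : IsInt 0 := ⟨0, by simp⟩
theorem isInt_one : IsInt 1 := ⟨1, by simp⟩
theorem IsInt.add {p q : ℚ} : IsInt p → IsInt q → IsInt (p + q) := by
  rintro ⟨x, rfl⟩ ⟨y, rfl⟩; exact ⟨x + y, by push_cast; ring⟩
theorem IsInt.sub {p q : ℚ} : IsInt p → IsInt q → IsInt (p - q) := by
  rintro ⟨x, rfl⟩ ⟨y, rfl⟩; exact ⟨x - y, by push_cast; ring⟩
theorem IsInt.mul {p q : ℚ} : IsInt p → IsInt q → IsInt (p * q) := by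
  rintro ⟨x, rfl⟩ ⟨y, rfl⟩; exact ⟨x * y, by push_cast; ring⟩
theorem IsInt.neg {p : ℚ} : IsInt p → IsInt (-p) := by
  rintro ⟨x, rfl⟩; exact ⟨-x, by push_cast; ring⟩

/-- A rational number whose powers have a common denominator is an integer. -/
theorem isInt_of_pow {r : ℚ} {D : ℤ} (hD : D ≠ 0) (h : ∀ k : ℕ, IsInt (D * r ^ k)) : IsInt r := by
  suffices hr : r.den = 1 by exact ⟨r.num, (Rat.den_eq_one_iff r).1 hr ▸ rfl⟩
  by_contra hne
  have hlt : 1 < r.den := lt_of_le_of_ne r.den_pos (Ne.symm hne)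
  -- The denominator is prime to the numerator, so every one of its powers divides the fixed integer
  -- D, which forces it to be 1.
  have hdvd : ∀ k : ℕ, r.den ^ k ∣ D.natAbs := fun k => by
    obtain ⟨z, hz⟩ := h k
    have h1 : (D : ℚ) * (r.num : ℚ) ^ k = z * (r.den : ℚ) ^ k := by
      rw [← hz, mul_assoc, ← mul_pow, Rat.mul_den_eq_num]
    have h2 : D * r.num ^ k = z * (r.den : ℤ) ^ k := by exact_mod_cast h1
    have h3 : ((r.den : ℤ) ^ k) ∣ D * r.num ^ k := ⟨z, by rw [h2]; ring⟩
    have h4 : IsCoprime ((r.den : ℤ) ^ k) (r.num ^ k) :=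
      IsCoprime.pow (Int.isCoprime_iff_gcd_eq_one.2 (by
        rw [Int.gcd_comm]; exact r.reduced))
    have h5 := h4.dvd_of_dvd_mul_right h3
    rw [← Int.natAbs_dvd_natAbs, Int.natAbs_pow, Int.natAbs_natCast] at h5
    exact h5
  have h6 := Nat.le_of_dvd (Int.natAbs_pos.2 hD) (hdvd D.natAbs)
  exact absurd (Nat.lt_pow_self hlt) (not_lt.2 h6)

variable {K : Type*} [AddCommGroup K] [Module ℚ K]

theorem exists_den {G : AddSubgroup K} (hG : G.FG) (f : K →ₗ[ℚ] ℚ) :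
    ∃ D : ℤ, D ≠ 0 ∧ ∀ x ∈ G, IsInt (D * f x) := by
  obtain ⟨s, rfl⟩ := hG
  refine ⟨∏ y ∈ s, ((f y).den : ℤ), Finset.prod_ne_zero_iff.2 fun y _ => by simp, fun x hx => ?_⟩
  induction hx using AddSubgroup.closure_induction with
  | mem x hx =>
    obtain ⟨c, hc⟩ := Finset.dvd_prod_of_mem (fun y => ((f y).den : ℤ)) hx
    refine ⟨c * (f x).num, ?_⟩
    rw [hc]
    push_cast
    rw [← Rat.mul_den_eq_num (f x)]
    ring
  | zero => simpa using isInt_zero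
  | add x y _ _ hx hy => rw [map_add, mul_add]; exact hx.add hy
  | neg x _ hx => rw [map_neg, mul_neg]; exact hx.neg

theorem exists_den_family {ι : Type*} [Finite ι] {G : AddSubgroup K} (hG : G.FG)
    (f : ι → K →ₗ[ℚ] ℚ) : ∃ D : ℤ, D ≠ 0 ∧ ∀ x ∈ G, ∀ i, IsInt (D * f i x) := by
  have := Fintype.ofFinite ι
  choose D hD h using fun i => exists_den hG (f i)
  refine ⟨∏ i, D i, Finset.prod_ne_zero_iff.2 fun i _ => hD i, fun x hx i => ?_⟩
  obtain ⟨c, hc⟩ := Finset.dvd_prod_of_mem D (Finset.mem_univ i)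
  have := (isInt_intCast c).mul (h i x hx)
  rw [hc]
  push_cast
  convert this using 1
  ring

/-- A group on which a jointly injective family of rational linear forms has bounded
denominators is finitely generated. -/
theorem fg_of_den {ι : Type*} [Finite ι] (f : ι → K →ₗ[ℚ] ℚ) (hf : ∀ x, (∀ i, f i x = 0) → x = 0)
    {G : AddSubgroup K} {D : ℤ} (hD : D ≠ 0) (hG : ∀ x ∈ G, ∀ i, IsInt (D * f i x)) : G.FG := by
  let F : K →ₗ[ℤ] (ι → ℚ) := D • (LinearMap.pi f).restrictScalars ℤ
  have hF : Function.Injective F := by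
    refine (injective_iff_map_eq_zero F).2 fun x hx => hf x fun i => ?_
    have : D • f i x = 0 := congrFun hx i
    simpa [hD] using this
  let c : (ι → ℤ) →ₗ[ℤ] (ι → ℚ) :=
    { toFun := fun z i => z i
      map_add' := fun _ _ => by ext; simp
      map_smul' := fun _ _ => by ext; simp }
  -- After multiplication by D the forms embed the group into ℤ^ι, which is Noetherian.
  have h1 : (AddSubgroup.toIntSubmodule G).map F ≤ LinearMap.range c := by
    rintro _ ⟨x, hx, rfl⟩
    choose z hz using hG x hx
    refine ⟨z, ?_⟩
    ext i
    have := hz i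
    simp [F, c, ← this]
  have h2 : ((AddSubgroup.toIntSubmodule G).map F).FG := by
    rw [← Submodule.map_comap_eq_self h1]
    exact (IsNoetherian.noetherian _).map c
  have h3 := Submodule.fg_of_fg_map_injective F hF h2
  exact (Submodule.fg_iff_addSubgroup_fg _).1 h3

theorem fg_map {K L : Type*} [AddCommGroup K] [AddCommGroup L] {G : AddSubgroup K} (hG : G.FG) (f : K →+ L) :
    (G.map f).FG := by
  classical
  obtain ⟨s, rfl⟩ := hG
  exact ⟨s.image f, by rw [Finset.coe_image, AddMonoidHom.map_closure]⟩

end Integers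

/-! ### Orders over the Clifford order, and conjugate orders -/

section Orders

variable {m : ℕ} {a : Fin m → ℤ}

theorem gen_mem_cliffordOrder (j : Fin m) : gen a j ∈ cliffordOrder a :=
  Subring.subset_closure ⟨j, rfl⟩

theorem cliffordOrder_le_iff {O : Subring (Alg a)} : cliffordOrder a ≤ O ↔ ∀ j, gen a j ∈ O := by
  rw [cliffordOrder, Subring.closure_le]
  exact Set.range_subset_iff

theorem isOrder_of_fg {O : Subring (Alg a)} (hO : O.toAddSubgroup.FG) (h : cliffordOrder a ≤ O) :
    IsOrder O := by
  refine ⟨hO, ?_⟩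
  rw [eq_top_iff, ← CliffordAlgebra.adjoin_range_ι]
  refine Algebra.adjoin_le ?_
  rintro _ ⟨u, rfl⟩
  rw [ι_eq_sum]
  exact Subalgebra.sum_mem _ fun j _ => Subalgebra.smul_mem _
    (Algebra.subset_adjoin (cliffordOrder_le_iff.1 h j)) _

/-- A covering antichain is exactly the set of maximal elements. All four determinations of maximal
orders use this form; no separate maximality proof is then needed. -/
theorem maxOrders_eq {S : Set (Subring (Alg a))} (hS : ∀ O ∈ S, IsOrder O ∧ cliffordOrder a ≤ O)
    (hcov : ∀ O, IsOrder O → cliffordOrder a ≤ O → ∃ O' ∈ S, O ≤ O')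
    (hanti : ∀ O ∈ S, ∀ O' ∈ S, O ≤ O' → O = O') : maxOrders a = S := by
  ext O
  constructor
  · rintro ⟨hmax, hle⟩
    obtain ⟨O', hO', h⟩ := hcov O hmax.prop hle
    rwa [hmax.eq_of_le (hS O' hO').1 h]
  · intro hO
    refine ⟨⟨(hS O hO).1, fun P hP hOP => ?_⟩, (hS O hO).2⟩
    obtain ⟨O', hO', h⟩ := hcov P hP ((hS O hO).2.trans hOP)
    have := hanti O hO O' hO' (hOP.trans h)
    rwa [this]

/-- The ring `x⁻¹ O x`. -/
def conjOrder (x : (Alg a)ˣ) (O : Subring (Alg a)) : Subring (Alg a) :=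
  O.comap (MulSemiringAction.toRingHom (ConjAct (Alg a)ˣ) (Alg a) (ConjAct.toConjAct x))

theorem mem_conjOrder {x : (Alg a)ˣ} {O : Subring (Alg a)} {z : Alg a} :
    z ∈ conjOrder x O ↔ (x : Alg a) * z * (↑x⁻¹ : Alg a) ∈ O := Iff.rfl

theorem isOrder_conjOrder (x : (Alg a)ˣ) {O : Subring (Alg a)} (hO : IsOrder O) :
    IsOrder (conjOrder x O) := by
  have hset : (conjOrder x O : Set (Alg a)) =
      (MulSemiringAction.toAlgHom ℚ (Alg a) (ConjAct.toConjAct x⁻¹)) '' (O : Set (Alg a)) := by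
    ext z
    constructor
    · intro h
      refine ⟨_, mem_conjOrder.1 h, ?_⟩
      simp [ConjAct.units_smul_def, mul_assoc]
    · rintro ⟨w, hw, rfl⟩
      rw [SetLike.mem_coe, mem_conjOrder]
      simpa [ConjAct.units_smul_def, mul_assoc] using hw
  refine ⟨?_, ?_⟩
  · have h1 : (conjOrder x O).toAddSubgroup = O.toAddSubgroup.map
        (MulSemiringAction.toAlgHom ℚ (Alg a) (ConjAct.toConjAct x⁻¹) : Alg a →+ Alg a) :=
      SetLike.coe_injective hset
    rw [h1]
    exact fg_map hO.1 _
  · rw [hset, ← AlgHom.map_adjoin, hO.2, Algebra.map_top, AlgHom.range_eq_top]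
    intro z
    refine ⟨(x : Alg a) * z * (↑x⁻¹ : Alg a), ?_⟩
    simp [ConjAct.units_smul_def, mul_assoc]

theorem cliffordConj_conjOrder {x : (Alg a)ˣ} (hx : (x : Alg a) ∈ cliffordMonoid a)
    (O : Subring (Alg a)) : CliffordConj O (conjOrder x O) :=
  cliffordConj_iff.2 ⟨x, hx, fun _ => mem_conjOrder⟩

end Orders

/-! ### A covering criterion for Clifford-Euclidean orders -/

section Euclidean

variable {m : ℕ} {a : Fin m → ℤ}

theorem algebraMap_alg_injective : Function.Injective (algebraMap ℚ (Alg a)) :=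
  (algebraMap ℚ (Alg a)).injective

/-- In a finite-dimensional algebra the right inverse q⁻¹ x̄ is two-sided, because left
multiplication by x is surjective and hence injective. -/
theorem exists_unit_of_mul_bar {x : Alg a} {q : ℚ} (h : x * bar x = algebraMap ℚ _ q) (hq : q ≠ 0) :
    ∃ u : (Alg a)ˣ, (u : Alg a) = x := by
  have h1 : x * (q⁻¹ • bar x) = 1 := by
    rw [mul_smul_comm, h, Algebra.algebraMap_eq_smul_one, smul_smul, inv_mul_cancel₀ hq, one_smul]
  have hs : Function.Surjective (LinearMap.mulLeft ℚ x) := fun y =>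
    ⟨(q⁻¹ • bar x) * y, by rw [LinearMap.mulLeft_apply, ← mul_assoc, h1, one_mul]⟩
  have hi := LinearMap.injective_iff_surjective.2 hs
  refine ⟨⟨x, q⁻¹ • bar x, h1, hi ?_⟩, rfl⟩
  simp only [LinearMap.mulLeft_apply]
  rw [← mul_assoc, h1, one_mul, mul_one]

theorem not_isZeroDivisorIn_of_unit (O : Subring (Alg a)) (u : (Alg a)ˣ) :
    ¬ IsZeroDivisorIn O (u : Alg a) := by
  rintro ⟨y, -, hy, h | h⟩
  · exact hy ((Units.mul_right_eq_zero u).1 h)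
  · exact hy ((Units.mul_left_eq_zero u).1 h)

/-- An order is right Clifford-Euclidean if the norm form is positive definite on the Clifford
monoid, integral on the order, and every Clifford vector has distance less than `1` from the
Clifford vectors of the order. -/
theorem isRightCliffordEuclidean_of_covering {O : Subring (Alg a)}
    (hpos : ∀ x ∈ cliffordMonoid a, ∀ q : ℚ, x * bar x = algebraMap ℚ _ q → 0 ≤ q ∧ (q = 0 → x = 0))
    (hint : ∀ x ∈ orderMonoid O, ∀ q : ℚ, x * bar x = algebraMap ℚ _ q → IsInt q)
    (hcov : ∀ w ∈ vec a, ∃ v ∈ intVec O, ∃ q : ℚ, q < 1 ∧ (w - v) * bar (w - v) = algebraMap ℚ _ q) :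
    IsRightCliffordEuclidean O := by
  classical
  -- N is the norm x x̄. The floor and the default 0 only make it total: on the monoid of the order
  -- the norm is a nonnegative integer.
  let N : Alg a → ℕ := fun x =>
    if h : ∃ q : ℚ, x * bar x = algebraMap ℚ _ q then ⌊h.choose⌋₊ else 0
  have hN : ∀ x ∈ orderMonoid O, ∀ q : ℚ, x * bar x = algebraMap ℚ _ q → (N x : ℚ) = q := by
    intro x hx q hq
    have h : ∃ q : ℚ, x * bar x = algebraMap ℚ _ q := ⟨q, hq⟩
    have h1 : h.choose = q := algebraMap_alg_injective (h.choose_spec.symm.trans hq)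
    obtain ⟨z, hz⟩ := hint x hx q hq
    have h2 := (hpos x hx.2 q hq).1
    simp only [N, dif_pos h, h1]
    rw [hz] at h2 ⊢
    lift z to ℕ using (by exact_mod_cast h2)
    simp
  refine ⟨N, fun x hx => ?_, fun x hx y hy hNx hxy => ?_⟩
  · obtain ⟨q, hq⟩ := hx.2.1
    have h1 := hN x hx q hq.symm
    constructor
    · intro h0
      rw [h0, Nat.cast_zero] at h1
      have := (hpos x hx.2 q hq.symm).2 h1.symm
      exact ⟨1, O.one_mem, one_ne_zero, Or.inl (by rw [this, zero_mul])⟩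
    · intro hz
      by_contra h0
      have hq0 : q ≠ 0 := by rw [← h1]; exact_mod_cast h0
      obtain ⟨u, rfl⟩ := exists_unit_of_mul_bar hq.symm hq0
      exact not_isZeroDivisorIn_of_unit O u hz
  · obtain ⟨q, hq⟩ := hx.2.1
    have h1 := hN x hx q hq.symm
    have hq0 : 0 < q := by rw [← h1]; exact_mod_cast hNx
    obtain ⟨u, rfl⟩ := exists_unit_of_mul_bar hq.symm hq0.ne'
    -- Applying v ↦ u⁻¹ v (u⁻¹)^* to the Clifford vector u y^* gives (u⁻¹ y)^*, and reversal fixes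
    -- Clifford vectors.
    have hw : (↑u⁻¹ : Alg a) * y ∈ vec a := by
      have h2 := (cliffordMonoid_inv hx.2).2 _ hxy.2
      rw [u.inv_mul_cancel_left, ← rev_mul] at h2
      have h3 := rev_of_mem_vec h2
      rw [rev_rev] at h3
      rwa [h3]
    obtain ⟨v, hv, p, hp, hpe⟩ := hcov _ hw
    have hr : y - u * v = (u : Alg a) * (↑u⁻¹ * y - v) := by rw [mul_sub, u.mul_inv_cancel_left]
    have hrm : y - u * v ∈ orderMonoid O := by
      refine ⟨O.sub_mem hy.1 (O.mul_mem hx.1 hv.1), ?_⟩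
      rw [hr]
      exact cliffordMonoid_mul hx.2 (mem_cliffordMonoid_of_mem_vec ((vec a).sub_mem hw hv.2))
    have hrn : (y - (u : Alg a) * v) * bar (y - (u : Alg a) * v) = algebraMap ℚ _ (p * q) := by
      rw [hr, bar_mul, map_mul, mul_assoc, ← mul_assoc _ (bar _) (bar _), hpe, Algebra.left_comm, hq]
    refine ⟨v, hv, _, hrm, (add_sub_cancel _ _).symm, ?_⟩
    have h4 := hN _ hrm _ hrn
    have : (N (y - (u : Alg a) * v) : ℚ) < N u := by
      rw [h4, h1]
      nlinarith
    exact_mod_cast this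

theorem isZeroDivisorIn_rev {O : Subring (Alg a)} (hO : IsStarStable O) {x : Alg a}
    (h : IsZeroDivisorIn O x) : IsZeroDivisorIn O (rev x) := by
  obtain ⟨y, hy, hy0, h⟩ := h
  refine ⟨rev y, hO y hy, fun h0 => hy0 (by rw [← rev_rev y, h0, rev_zero]), ?_⟩
  rw [← rev_mul, ← rev_mul]
  rcases h with h | h
  · exact Or.inr (by rw [h, rev_zero])
  · exact Or.inl (by rw [h, rev_zero])

/-- Reversal exchanges the two conditions and fixes the quotient q, a Clifford vector; the norm
function is precomposed with reversal. -/
theorem isLeftCliffordEuclidean_iff {O : Subring (Alg a)} (hO : IsStarStable O)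
    (hm : ∀ x ∈ cliffordMonoid a, rev x ∈ cliffordMonoid a) :
    IsLeftCliffordEuclidean O ↔ IsRightCliffordEuclidean O := by
  have hom : ∀ x ∈ orderMonoid O, rev x ∈ orderMonoid O := fun x hx => ⟨hO x hx.1, hm x hx.2⟩
  have hzd : ∀ x, IsZeroDivisorIn O (rev x) ↔ IsZeroDivisorIn O x := fun x =>
    ⟨fun h => by simpa using isZeroDivisorIn_rev hO h, isZeroDivisorIn_rev hO⟩
  constructor
  · rintro ⟨N, h0, h⟩
    refine ⟨fun x => N (rev x), fun x hx => by rw [h0 _ (hom x hx), hzd], fun x hx y hy hN hxy => ?_⟩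
    obtain ⟨q, hq, r, hr, h1, h2⟩ := h _ (hom x hx) _ (hom y hy) hN (by rwa [rev_rev])
    refine ⟨q, hq, rev r, hom r hr, ?_, by simpa using h2⟩
    rw [← rev_rev y, h1, rev_add, rev_mul, rev_rev, rev_of_mem_vec hq.2]
  · rintro ⟨N, h0, h⟩
    refine ⟨fun x => N (rev x), fun x hx => by rw [h0 _ (hom x hx), hzd], fun x hx y hy hN hxy => ?_⟩
    obtain ⟨q, hq, r, hr, h1, h2⟩ := h _ (hom x hx) _ (hom y hy) hN (by rwa [rev_rev])
    refine ⟨q, hq, rev r, hom r hr, ?_, by simpa using h2⟩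
    rw [← rev_rev y, h1, rev_add, rev_mul, rev_rev, rev_of_mem_vec hq.2]

/-- If the Clifford vectors are all the elements that are fixed by reversal, then the Clifford
monoid consists of all elements of scalar norm. -/
theorem mem_cliffordMonoid_iff_of_vec (hv : ∀ x : Alg a, rev x = x → x ∈ vec a) {x : Alg a} :
    x ∈ cliffordMonoid a ↔ x * bar x ∈ Set.range (algebraMap ℚ (Alg a)) := by
  refine ⟨fun h => h.1, fun h => ⟨h, fun v hvv => hv _ ?_⟩⟩
  rw [rev_mul, rev_mul, rev_rev, rev_of_mem_vec hvv, mul_assoc]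

end Euclidean

/-! ### Lipschitz and Hurwitz quaternions -/

section Hurwitz

open Quaternion

/-- The rational quaternion with the given coordinates. -/
def quat (x y z w : ℚ) : ℍ[ℚ] := ⟨x, y, z, w⟩

@[simp] theorem re_quat (x y z w : ℚ) : (quat x y z w).re = x := rfl
@[simp] theorem imI_quat (x y z w : ℚ) : (quat x y z w).imI = y := rfl
@[simp] theorem imJ_quat (x y z w : ℚ) : (quat x y z w).imJ = z := rfl
@[simp] theorem imK_quat (x y z w : ℚ) : (quat x y z w).imK = w := rfl

theorem algebraMap_eq_quat (r : ℚ) : algebraMap ℚ ℍ[ℚ] r = quat r 0 0 0 := rfl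

/-- The Lipschitz quaternions. -/
def lipschitz : Subring ℍ[ℚ] where
  carrier := {q | IsInt q.re ∧ IsInt q.imI ∧ IsInt q.imJ ∧ IsInt q.imK}
  mul_mem' := by
    rintro p q ⟨h1, h2, h3, h4⟩ ⟨k1, k2, k3, k4⟩
    refine ⟨?_, ?_, ?_, ?_⟩
    · rw [re_mul]
      exact (((h1.mul k1).sub (h2.mul k2)).sub (h3.mul k3)).sub (h4.mul k4)
    · rw [imI_mul]
      exact (((h1.mul k2).add (h2.mul k1)).add (h3.mul k4)).sub (h4.mul k3)
    · rw [imJ_mul]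
      exact (((h1.mul k3).sub (h2.mul k4)).add (h3.mul k1)).add (h4.mul k2)
    · rw [imK_mul]
      exact (((h1.mul k4).add (h2.mul k3)).sub (h3.mul k2)).add (h4.mul k1)
  one_mem' := ⟨isInt_one, isInt_zero, isInt_zero, isInt_zero⟩
  add_mem' := fun h k => ⟨h.1.add k.1, h.2.1.add k.2.1, h.2.2.1.add k.2.2.1, h.2.2.2.add k.2.2.2⟩
  zero_mem' := ⟨isInt_zero, isInt_zero, isInt_zero, isInt_zero⟩
  neg_mem' := fun h => ⟨h.1.neg, h.2.1.neg, h.2.2.1.neg, h.2.2.2.neg⟩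

theorem mem_lipschitz {q : ℍ[ℚ]} :
    q ∈ lipschitz ↔ IsInt q.re ∧ IsInt q.imI ∧ IsInt q.imJ ∧ IsInt q.imK := Iff.rfl

/-- The Hurwitz quaternions. -/
def hurwitz : Subring ℍ[ℚ] where
  carrier := {q | ∃ t a b c : ℤ, q = quat (t / 2) (a + t / 2) (b + t / 2) (c + t / 2)}
  mul_mem' := by
    rintro _ _ ⟨t, a, b, c, rfl⟩ ⟨u, d, e, f, rfl⟩
    -- The first witness is twice the real part of the product; the others are its imaginary
    -- coordinates minus the real part.
    refine ⟨-t * u - 2 * (a * d + b * e + c * f) - (a + b + c) * u - (d + e + f) * t,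
      t * u + (a * d + b * e + c * f) + b * f - c * e + t * (d + f) + u * (a + b),
      t * u + (a * d + b * e + c * f) + c * d - a * f + t * (d + e) + u * (b + c),
      t * u + (a * d + b * e + c * f) + a * e - b * d + t * (e + f) + u * (a + c), ?_⟩
    ext <;> simp <;> ring
  one_mem' := ⟨2, -1, -1, -1, by ext <;> simp⟩
  add_mem' := by
    rintro _ _ ⟨t, a, b, c, rfl⟩ ⟨u, d, e, f, rfl⟩
    exact ⟨t + u, a + d, b + e, c + f, by ext <;> simp <;> ring⟩
  zero_mem' := ⟨0, 0, 0, 0, by ext <;> simp⟩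
  neg_mem' := by
    rintro _ ⟨t, a, b, c, rfl⟩
    exact ⟨-t, -a, -b, -c, by ext <;> simp <;> ring⟩

theorem mem_hurwitz {q : ℍ[ℚ]} :
    q ∈ hurwitz ↔ ∃ t a b c : ℤ, q = quat (t / 2) (a + t / 2) (b + t / 2) (c + t / 2) := Iff.rfl

theorem mem_hurwitz_iff {q : ℍ[ℚ]} : q ∈ hurwitz ↔
    IsInt (2 * q.re) ∧ IsInt (q.imI - q.re) ∧ IsInt (q.imJ - q.re) ∧ IsInt (q.imK - q.re) := by
  rw [mem_hurwitz]
  constructor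
  · rintro ⟨t, a, b, c, rfl⟩
    exact ⟨⟨t, by simp; ring⟩, ⟨a, by simp⟩, ⟨b, by simp⟩, ⟨c, by simp⟩⟩
  · rintro ⟨⟨t, ht⟩, ⟨a, ha⟩, ⟨b, hb⟩, ⟨c, hc⟩⟩
    have hre : q.re = t / 2 := by linarith
    refine ⟨t, a, b, c, ?_⟩
    refine Quaternion.ext _ _ hre ?_ ?_ ?_ <;> simp only [imI_quat, imJ_quat, imK_quat] <;> linarith

theorem lipschitz_le_hurwitz : lipschitz ≤ hurwitz := by
  rintro q ⟨h1, h2, h3, h4⟩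
  refine mem_hurwitz_iff.2 ⟨?_, h2.sub h1, h3.sub h1, h4.sub h1⟩
  rw [two_mul]
  exact h1.add h1

theorem star_mem_hurwitz {q : ℍ[ℚ]} (h : q ∈ hurwitz) : star q ∈ hurwitz := by
  obtain ⟨t, a, b, c, rfl⟩ := h
  exact ⟨t, -a - t, -b - t, -c - t, by ext <;> simp <;> ring⟩

theorem normSq_hurwitz {q : ℍ[ℚ]} (h : q ∈ hurwitz) : IsInt (normSq q) := by
  obtain ⟨t, a, b, c, rfl⟩ := h
  refine ⟨t * t + a * t + b * t + c * t + a * a + b * b + c * c, ?_⟩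
  rw [normSq_def']
  simp only [re_quat, imI_quat, imJ_quat, imK_quat]
  push_cast
  ring

/-- The Hurwitz quaternion `(1 + i + j + k) / 2`. -/
def hω : ℍ[ℚ] := quat (1 / 2) (1 / 2) (1 / 2) (1 / 2)

theorem hω_mem : hω ∈ hurwitz := ⟨1, 0, 0, 0, by simp [hω]⟩

theorem mem_lipschitz_or {q : ℍ[ℚ]} (h : q ∈ hurwitz) : q ∈ lipschitz ∨ q - hω ∈ lipschitz := by
  obtain ⟨t, a, b, c, rfl⟩ := h
  obtain ⟨s, rfl | rfl⟩ := Int.even_or_odd' t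
  · left
    exact ⟨⟨s, by simp⟩, ⟨a + s, by simp⟩, ⟨b + s, by simp⟩, ⟨c + s, by simp⟩⟩
  · right
    exact ⟨⟨s, by simp [hω]; ring⟩, ⟨a + s, by simp [hω]; ring⟩, ⟨b + s, by simp [hω]; ring⟩,
      ⟨c + s, by simp [hω]; ring⟩⟩

/-- Every rational quaternion has distance less than `1` from a Hurwitz quaternion. -/
theorem exists_hurwitz_near (w : ℍ[ℚ]) : ∃ v ∈ hurwitz, normSq (w - v) < 1 := by
  have key : ∀ x : ℚ, (x - round x) ^ 2 ≤ 1 / 4 := fun x => by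
    have := abs_sub_round x
    rw [abs_le] at this
    nlinarith
  let v : ℍ[ℚ] := quat (round w.re) (round w.imI) (round w.imJ) (round w.imK)
  have hv : v ∈ hurwitz := lipschitz_le_hurwitz ⟨⟨_, rfl⟩, ⟨_, rfl⟩, ⟨_, rfl⟩, ⟨_, rfl⟩⟩
  have hn : normSq (w - v) = (w.re - round w.re) ^ 2 + (w.imI - round w.imI) ^ 2 +
      (w.imJ - round w.imJ) ^ 2 + (w.imK - round w.imK) ^ 2 := by
    rw [normSq_def']; simp [v]
  by_cases hlt : normSq (w - v) < 1
  · exact ⟨v, hv, hlt⟩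
  -- Each coordinate contributes at most 1/4, so a norm of at least 1 forces all four fractional
  -- parts to be ±1/2, and then w itself is a Hurwitz quaternion.
  · refine ⟨w, ?_, by simp⟩
    rw [hn] at hlt
    have k1 := key w.re
    have k2 := key w.imI
    have k3 := key w.imJ
    have k4 := key w.imK
    have sq : ∀ y : ℚ, y ^ 2 = 1 / 4 → y = 1 / 2 ∨ y = -(1 / 2) := fun y hy => by
      have : (y - 1 / 2) * (y + 1 / 2) = 0 := by linarith
      rcases mul_eq_zero.1 this with h | h
      · left; linarith
      · right; linarith
    have s1 := sq _ (by linarith : (w.re - round w.re) ^ 2 = 1 / 4)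
    have s2 := sq _ (by linarith : (w.imI - round w.imI) ^ 2 = 1 / 4)
    have s3 := sq _ (by linarith : (w.imJ - round w.imJ) ^ 2 = 1 / 4)
    have s4 := sq _ (by linarith : (w.imK - round w.imK) ^ 2 = 1 / 4)
    have d : ∀ x y : ℚ, (x - round x = 1 / 2 ∨ x - round x = -(1 / 2)) →
        (y - round y = 1 / 2 ∨ y - round y = -(1 / 2)) → IsInt (y - x) := by
      rintro x y (h | h) (k | k)
      · exact ⟨round y - round x, by push_cast; linarith⟩
      · exact ⟨round y - round x - 1, by push_cast; linarith⟩
      · exact ⟨round y - round x + 1, by push_cast; linarith⟩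
      · exact ⟨round y - round x, by push_cast; linarith⟩
    refine mem_hurwitz_iff.2 ⟨?_, d _ _ s1 s2, d _ _ s1 s3, d _ _ s1 s4⟩
    rcases s1 with h | h
    · exact ⟨2 * round w.re + 1, by push_cast; linarith⟩
    · exact ⟨2 * round w.re - 1, by push_cast; linarith⟩

/-- The coordinates of a rational quaternion. -/
def hcoord : Fin 4 → ℍ[ℚ] →ₗ[ℚ] ℚ :=
  ![QuaternionAlgebra.reₗ _ _ _, QuaternionAlgebra.imIₗ _ _ _, QuaternionAlgebra.imJₗ _ _ _,
    QuaternionAlgebra.imKₗ _ _ _]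

@[simp] theorem hcoord_zero (q : ℍ[ℚ]) : hcoord 0 q = q.re := rfl
@[simp] theorem hcoord_one (q : ℍ[ℚ]) : hcoord 1 q = q.imI := rfl
@[simp] theorem hcoord_two (q : ℍ[ℚ]) : hcoord 2 q = q.imJ := rfl
@[simp] theorem hcoord_three (q : ℍ[ℚ]) : hcoord 3 q = q.imK := rfl

theorem hcoord_injective (q : ℍ[ℚ]) (h : ∀ i, hcoord i q = 0) : q = 0 := by
  ext
  · exact h 0
  · exact h 1
  · exact h 2
  · exact h 3

theorem mem_lipschitz_of_hcoord {q : ℍ[ℚ]} (h : ∀ i, IsInt (hcoord i q)) : q ∈ lipschitz :=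
  ⟨h 0, h 1, h 2, h 3⟩

theorem hcoord_of_mem_hurwitz {q : ℍ[ℚ]} (h : q ∈ hurwitz) (i : Fin 4) :
    IsInt ((2 : ℤ) * hcoord i q) := by
  obtain ⟨t, a, b, c, rfl⟩ := h
  revert i
  rw [Fin.forall_fin_succ, Fin.forall_fin_succ, Fin.forall_fin_two]
  refine ⟨⟨t, ?_⟩, ⟨2 * a + t, ?_⟩, ⟨2 * b + t, ?_⟩, ⟨2 * c + t, ?_⟩⟩
  · change (2 : ℤ) * ((t : ℚ) / 2) = t
    push_cast; ring
  · change (2 : ℤ) * ((a : ℚ) + t / 2) = _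
    push_cast; ring
  · change (2 : ℤ) * ((b : ℚ) + t / 2) = _
    push_cast; ring
  · change (2 : ℤ) * ((c : ℚ) + t / 2) = _
    push_cast; ring

/-- The norms of the elements of a finitely generated ring of quaternions are integral. -/
theorem normSq_of_fg {S : Subring ℍ[ℚ]} (hS : S.toAddSubgroup.FG) {q : ℍ[ℚ]} (hq : q ∈ S) :
    IsInt (normSq q) := by
  obtain ⟨D, hD, h⟩ := exists_den_family hS hcoord
  -- The norm is multiplicative and quadratic in the coordinates, so D² clears the denominators of
  -- all its powers.
  refine isInt_of_pow (D := D * D) (mul_ne_zero hD hD) fun k => ?_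
  have h' := h (q ^ k) (S.pow_mem hq k)
  have h0 := h' 0
  have h1 := h' 1
  have h2 := h' 2
  have h3 := h' 3
  have := (((h0.mul h0).add (h1.mul h1)).add (h2.mul h2)).add (h3.mul h3)
  rw [← map_pow, normSq_def']
  convert this using 1
  simp only [hcoord_zero, hcoord_one, hcoord_two, hcoord_three, Int.cast_mul]
  ring

/-- The Hurwitz quaternions are the only maximal order that contains the Lipschitz quaternions. -/
theorem le_hurwitz_of_fg {S : Subring ℍ[ℚ]} (hS : S.toAddSubgroup.FG) (hL : lipschitz ≤ S) :
    S ≤ hurwitz := by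
  intro q hq
  have hn := normSq_of_fg hS hq
  have key : ∀ e ∈ lipschitz, IsInt (normSq (q + e)) := fun e he =>
    normSq_of_fg hS (S.add_mem hq (hL he))
  have e0 := key 1 lipschitz.one_mem
  have e1 := key (quat 0 1 0 0) ⟨isInt_zero, isInt_one, isInt_zero, isInt_zero⟩
  have e2 := key (quat 0 0 1 0) ⟨isInt_zero, isInt_zero, isInt_one, isInt_zero⟩
  have e3 := key (quat 0 0 0 1) ⟨isInt_zero, isInt_zero, isInt_zero, isInt_one⟩
  simp only [normSq_def', re_add, imI_add, imJ_add, imK_add, re_one, imI_one, imJ_one,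
    imK_one, re_quat, imI_quat, imJ_quat, imK_quat] at hn e0 e1 e2 e3
  obtain ⟨n, hn⟩ := hn
  obtain ⟨n0, h0⟩ := e0
  obtain ⟨n1, h1⟩ := e1
  obtain ⟨n2, h2⟩ := e2
  obtain ⟨n3, h3⟩ := e3
  -- Polarizing the norm against 1, i, j, k gives twice each coordinate.
  have k0 : 2 * q.re = ((n0 - n - 1 : ℤ) : ℚ) := by push_cast; linarith
  have k1 : 2 * q.imI = ((n1 - n - 1 : ℤ) : ℚ) := by push_cast; linarith
  have k2 : 2 * q.imJ = ((n2 - n - 1 : ℤ) : ℚ) := by push_cast; linarith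
  have k3 : 2 * q.imK = ((n3 - n - 1 : ℤ) : ℚ) := by push_cast; linarith
  generalize n0 - n - 1 = x0 at k0
  generalize n1 - n - 1 = x1 at k1
  generalize n2 - n - 1 = x2 at k2
  generalize n3 - n - 1 = x3 at k3
  have hsum : x0 ^ 2 + x1 ^ 2 + x2 ^ 2 + x3 ^ 2 = 4 * n := by
    have : ((x0 : ℚ)) ^ 2 + x1 ^ 2 + x2 ^ 2 + x3 ^ 2 = 4 * n := by
      rw [← k0, ← k1, ← k2, ← k3, ← hn]; ring
    exact_mod_cast this
  -- Squares are 0 or 1 modulo 4, so four of them sum to a multiple of 4 only if the numbers are all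
  -- even or all odd.
  have par : 2 ∣ x1 - x0 ∧ 2 ∣ x2 - x0 ∧ 2 ∣ x3 - x0 := by
    have sqm : ∀ x : ℤ, x ^ 2 % 4 = x % 2 := fun x => by
      rcases Int.even_or_odd' x with ⟨y, rfl | rfl⟩ <;> ring_nf <;> omega
    have := sqm x0
    have := sqm x1
    have := sqm x2
    have := sqm x3
    omega
  obtain ⟨⟨a, ha⟩, ⟨b, hb⟩, ⟨c, hc⟩⟩ := par
  refine mem_hurwitz_iff.2 ⟨⟨x0, k0⟩, ⟨a, ?_⟩, ⟨b, ?_⟩, ⟨c, ?_⟩⟩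
  · have : (x1 : ℚ) - x0 = 2 * a := by exact_mod_cast ha
    linarith
  · have : (x2 : ℚ) - x0 = 2 * b := by exact_mod_cast hb
    linarith
  · have : (x3 : ℚ) - x0 = 2 * c := by exact_mod_cast hc
    linarith

theorem lipschitz_le_iff {S : Subring ℍ[ℚ]} :
    lipschitz ≤ S ↔ quat 0 1 0 0 ∈ S ∧ quat 0 0 1 0 ∈ S := by
  constructor
  · exact fun h => ⟨h ⟨isInt_zero, isInt_one, isInt_zero, isInt_zero⟩,
      h ⟨isInt_zero, isInt_zero, isInt_one, isInt_zero⟩⟩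
  · rintro ⟨hi, hj⟩ q ⟨⟨a, ha⟩, ⟨b, hb⟩, ⟨c, hc⟩, ⟨d, hd⟩⟩
    have : q = (a : ℍ[ℚ]) + (b : ℍ[ℚ]) * quat 0 1 0 0 + (c : ℍ[ℚ]) * quat 0 0 1 0 +
        (d : ℍ[ℚ]) * (quat 0 1 0 0 * quat 0 0 1 0) := by
      ext <;> simp [ha, hb, hc, hd]
    rw [this]
    exact S.add_mem (S.add_mem (S.add_mem (intCast_mem S a) (S.mul_mem (intCast_mem S b) hi))
      (S.mul_mem (intCast_mem S c) hj)) (S.mul_mem (intCast_mem S d) (S.mul_mem hi hj))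

end Hurwitz

theorem isStarStable_cliffordOrder {m : ℕ} (a : Fin m → ℤ) : IsStarStable (cliffordOrder a) := by
  intro x hx
  rw [cliffordOrder] at hx
  induction hx using Subring.closure_induction with
  | mem x hx =>
    obtain ⟨j, rfl⟩ := hx
    rw [rev_gen]
    exact gen_mem_cliffordOrder j
  | zero => rw [rev_zero]; exact Subring.zero_mem _
  | one => rw [rev_one]; exact Subring.one_mem _
  | add x y _ _ hx hy => rw [rev_add]; exact Subring.add_mem _ hx hy
  | neg x _ hx => rw [rev_neg]; exact Subring.neg_mem _ hx
  | mul x y _ _ hx hy => rw [rev_mul]; exact Subring.mul_mem _ hy hx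

/-! ### The algebra (-1,-1,-1/ℚ): the order O₄, triality, and failures of the Clifford order -/

section ThreeUnits

open Quaternion

/-- The Clifford algebra `(-1, -1, -1 / ℚ)`. -/
abbrev A₃ : Type := Alg ![-1, -1, -1]

/-- The two projections of `(-1, -1, -1 / ℚ)` to the rational quaternions. They send the third
generator to `k` and to `-k`. -/
noncomputable def φ (s : ℤˣ) : A₃ →ₐ[ℚ] ℍ[ℚ] :=
  CliffordAlgebra.lift _ ⟨
    { toFun := fun u => quat 0 (u 0) (u 1) (((s : ℤ) : ℚ) * u 2)
      map_add' := fun u v => by ext <;> simp [mul_add]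
      map_smul' := fun r u => by ext <;> simp [mul_left_comm] }, fun u => by
    have hs : (((s : ℤ) : ℚ)) * ((s : ℤ) : ℚ) = 1 := by
      rcases Int.units_eq_one_or s with rfl | rfl <;> norm_num
    rw [algebraMap_eq_quat]
    ext
    · simp [QuadraticMap.weightedSumSquares_apply, Fin.sum_univ_three]
      linear_combination -(u 2 * u 2) * hs
    all_goals simp [mul_comm]⟩

theorem φ_ι (s : ℤˣ) (u : Fin 3 → ℚ) : φ s (CliffordAlgebra.ι (form ![-1, -1, -1]) u) =
    quat 0 (u 0) (u 1) (((s : ℤ) : ℚ) * u 2) := by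
  rw [φ, CliffordAlgebra.lift_ι_apply]
  rfl

theorem φ_gen_zero (s : ℤˣ) : φ s (gen _ 0) = quat 0 1 0 0 := by
  rw [gen, φ_ι]; simp

theorem φ_gen_one (s : ℤˣ) : φ s (gen _ 1) = quat 0 0 1 0 := by
  rw [gen, φ_ι]; simp

theorem φ_gen_two (s : ℤˣ) : φ s (gen _ 2) = quat 0 0 0 ((s : ℤ) : ℚ) := by
  rw [gen, φ_ι]; simp

theorem φ_surjective : Function.Surjective ((φ 1).prod (φ (-1))) := by
  rintro ⟨p, q⟩
  let g : Fin 3 → A₃ := gen _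
  refine ⟨((p.re + q.re) / 2) • 1 + ((p.imI + q.imI) / 2) • g 0 + ((p.imJ + q.imJ) / 2) • g 1 +
    ((p.imK + q.imK) / 2) • (g 0 * g 1) - ((p.re - q.re) / 2) • (g 0 * g 1 * g 2) +
    ((p.imI - q.imI) / 2) • (g 1 * g 2) + ((p.imJ - q.imJ) / 2) • (g 2 * g 0) +
    ((p.imK - q.imK) / 2) • g 2, ?_⟩
  refine Prod.ext ?_ ?_ <;>
  · simp only [AlgHom.prod_apply, map_add, map_sub, map_smul, map_mul, map_one, g, φ_gen_zero,
      φ_gen_one, φ_gen_two]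
    ext <;> simp <;> ring

/-- Both the Clifford algebra and ℍ × ℍ have dimension 8, so the surjection `φ_surjective` is an
isomorphism. -/
theorem φ_ext {x y : A₃} (h : ∀ s, φ s x = φ s y) : x = y := by
  have := Module.finrank_pos (R := ℚ) (M := ℍ[ℚ])
  have hi := injective_of_surjective (a := ![-1, -1, -1]) (m := 3) (B := ℍ[ℚ] × ℍ[ℚ])
    (by rw [Module.finrank_prod, Quaternion.finrank_eq_four]; norm_num) _ φ_surjective
  exact hi (Prod.ext (h 1) (h (-1)))

theorem φ_bar (s : ℤˣ) (x : A₃) : φ s (bar x) = star (φ s x) := by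
  induction x using CliffordAlgebra.induction with
  | algebraMap r => rw [bar_algebraMap, AlgHom.commutes]; ext <;> simp
  | ι u => rw [bar_ι, map_neg, φ_ι]; ext <;> simp
  | mul x y hx hy => rw [bar_mul, map_mul, map_mul, hx, hy, star_mul]
  | add x y hx hy => rw [bar_add, map_add, map_add, hx, hy, star_add]

/-- The anti-automorphism of the quaternions that fixes `i` and `j`. -/
def flip (q : ℍ[ℚ]) : ℍ[ℚ] := quat q.re q.imI q.imJ (-q.imK)

theorem flip_mul (p q : ℍ[ℚ]) : flip (p * q) = flip q * flip p := by
  ext <;> simp [flip] <;> ring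

theorem normSq_flip (q : ℍ[ℚ]) : normSq (flip q) = normSq q := by
  simp [normSq_def', flip]

theorem flip_mem_hurwitz {q : ℍ[ℚ]} (h : q ∈ hurwitz) : flip q ∈ hurwitz := by
  obtain ⟨t, a, b, c, rfl⟩ := h
  exact ⟨t, a, b, -c - t, by ext <;> simp [flip]; ring⟩

theorem flip_mem_lipschitz {q : ℍ[ℚ]} (h : q ∈ lipschitz) : flip q ∈ lipschitz :=
  ⟨h.1, h.2.1, h.2.2.1, h.2.2.2.neg⟩

/-- Reversal negates the central element γ₁γ₂γ₃, which acts by opposite signs in the two factors;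
hence reversal exchanges the factors. -/
theorem φ_rev (s : ℤˣ) (x : A₃) : φ s (rev x) = flip (φ (-s) x) := by
  induction x using CliffordAlgebra.induction with
  | algebraMap r => rw [rev_algebraMap, AlgHom.commutes, AlgHom.commutes]; ext <;> simp [flip]
  | ι u => rw [rev_ι, φ_ι, φ_ι]; ext <;> simp [flip]
  | mul x y hx hy => rw [rev_mul, map_mul, map_mul, hx, hy, flip_mul]
  | add x y hx hy => rw [rev_add, map_add, map_add, hx, hy]; ext <;> simp [flip]; ring

/-- The Clifford vector of `(-1, -1, -1 / ℚ)` whose coordinates are those of a quaternion. -/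
noncomputable def vecOf (q : ℍ[ℚ]) : A₃ :=
  algebraMap ℚ _ q.re + CliffordAlgebra.ι (form ![-1, -1, -1]) ![q.imI, q.imJ, q.imK]

theorem vecOf_mem (q : ℍ[ℚ]) : vecOf q ∈ vec ![-1, -1, -1] := mem_vec_iff.2 ⟨_, _, rfl⟩

theorem φ_one_vecOf (q : ℍ[ℚ]) : φ 1 (vecOf q) = q := by
  rw [vecOf, map_add, φ_ι, AlgHom.commutes]; ext <;> simp

theorem φ_neg_one_vecOf (q : ℍ[ℚ]) : φ (-1) (vecOf q) = flip q := by
  rw [vecOf, map_add, φ_ι, AlgHom.commutes]; ext <;> simp [flip]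

theorem forall_units {P : ℤˣ → Prop} (h : P 1) (h' : P (-1)) (s : ℤˣ) : P s := by
  rcases Int.units_eq_one_or s with rfl | rfl
  exacts [h, h']

/-- An element fixed by reversal is a pair (q, flip q), which is the Clifford vector with the
coordinates of q. So the Clifford vectors are a copy of ℍ, and the Clifford monoid is cut out by the
norm condition alone. -/
theorem mem_vec_of_rev {x : A₃} (h : rev x = x) : x = vecOf (φ 1 x) := by
  have h1 : φ (-1) x = flip (φ 1 x) := by
    conv_lhs => rw [← h, φ_rev, neg_neg]
  exact φ_ext (forall_units (φ_one_vecOf _).symm (by rw [φ_neg_one_vecOf, h1]))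

theorem eq_vecOf {x : A₃} (h : x ∈ vec ![-1, -1, -1]) : x = vecOf (φ 1 x) :=
  mem_vec_of_rev (rev_of_mem_vec h)

theorem mem_cliffordMonoid_three {x : A₃} : x ∈ cliffordMonoid ![-1, -1, -1] ↔
    x * bar x ∈ Set.range (algebraMap ℚ A₃) :=
  mem_cliffordMonoid_iff_of_vec fun x h => by rw [mem_vec_of_rev h]; exact vecOf_mem _

theorem mul_bar_eq_iff {x : A₃} {q : ℚ} :
    x * bar x = algebraMap ℚ _ q ↔ ∀ s, normSq (φ s x) = q := by
  have key : ∀ s, φ s (x * bar x) = algebraMap ℚ _ (normSq (φ s x)) := fun s => by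
    rw [map_mul, φ_bar, self_mul_star]
    rfl
  constructor
  · intro h s
    have := key s
    rw [h, AlgHom.commutes] at this
    exact ((algebraMap ℚ ℍ[ℚ]).injective this).symm
  · intro h
    refine φ_ext fun s => ?_
    rw [key, AlgHom.commutes, h]

theorem bar_mul_self (x : A₃) : bar x * x = x * bar x :=
  φ_ext fun s => by rw [map_mul, map_mul, φ_bar, self_mul_star, star_mul_self]

theorem rev_mem_cliffordMonoid_three {x : A₃} (h : x ∈ cliffordMonoid ![-1, -1, -1]) :
    rev x ∈ cliffordMonoid ![-1, -1, -1] := by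
  obtain ⟨⟨q, hq⟩, -⟩ := h
  refine mem_cliffordMonoid_three.2 ⟨q, ?_⟩
  rw [← rev_bar, ← rev_mul, bar_mul_self, ← hq, rev_algebraMap]

theorem norm_nonneg_three {x : A₃} {q : ℚ} (h : x * bar x = algebraMap ℚ _ q) :
    0 ≤ q ∧ (q = 0 → x = 0) := by
  rw [mul_bar_eq_iff] at h
  refine ⟨by rw [← h 1]; exact normSq_nonneg, fun hq => φ_ext fun s => ?_⟩
  rw [map_zero, ← normSq_eq_zero, h, hq]

/-- The elements of `(-1, -1, -1 / ℚ)` whose two projections are Hurwitz quaternions. -/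
noncomputable def O₄ : Subring A₃ :=
  hurwitz.comap (φ 1 : A₃ →+* ℍ[ℚ]) ⊓ hurwitz.comap (φ (-1) : A₃ →+* ℍ[ℚ])

theorem mem_O₄ {x : A₃} : x ∈ O₄ ↔ ∀ s, φ s x ∈ hurwitz :=
  ⟨fun h => forall_units h.1 h.2, fun h => ⟨h 1, h (-1)⟩⟩

theorem fg_of_φ {G : AddSubgroup A₃} (h : ∀ x ∈ G, ∀ s, φ s x ∈ hurwitz) : G.FG := by
  refine fg_of_den (fun i : ℤˣ × Fin 4 => (hcoord i.2).comp (φ i.1).toLinearMap)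
    (fun x hx => φ_ext fun s => ?_) two_ne_zero (fun x hx i => hcoord_of_mem_hurwitz (h x hx i.1) i.2)
  rw [map_zero]
  exact hcoord_injective _ fun i => hx (s, i)

theorem φ_gen_mem (s : ℤˣ) (j : Fin 3) : φ s (gen _ j) ∈ lipschitz := by
  fin_cases j
  · simp only [Fin.zero_eta, φ_gen_zero]
    exact ⟨isInt_zero, isInt_one, isInt_zero, isInt_zero⟩
  · simp only [Fin.mk_one, φ_gen_one]
    exact ⟨isInt_zero, isInt_zero, isInt_one, isInt_zero⟩
  · simp only [Fin.reduceFinMk, φ_gen_two]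
    exact ⟨isInt_zero, isInt_zero, isInt_zero, isInt_intCast _⟩

theorem φ_mem_lipschitz {x : A₃} (h : x ∈ cliffordOrder ![-1, -1, -1]) (s : ℤˣ) :
    φ s x ∈ lipschitz := by
  have : cliffordOrder ![-1, -1, -1] ≤ lipschitz.comap (φ s : A₃ →+* ℍ[ℚ]) :=
    cliffordOrder_le_iff.2 fun j => φ_gen_mem s j
  exact this h

theorem cliffordOrder_le_O₄ : cliffordOrder ![-1, -1, -1] ≤ O₄ := fun _ hx =>
  mem_O₄.2 fun s => lipschitz_le_hurwitz (φ_mem_lipschitz hx s)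

/-- Each projection of an order over the Clifford order is a finitely generated ring containing i
and j, hence consists of Hurwitz quaternions. -/
theorem maxOrders_three : maxOrders ![-1, -1, -1] = {O₄} := by
  refine maxOrders_eq ?_ ?_ ?_
  · rintro O rfl
    exact ⟨isOrder_of_fg (fg_of_φ fun x hx => mem_O₄.1 hx) cliffordOrder_le_O₄, cliffordOrder_le_O₄⟩
  · intro O hO hΓ
    refine ⟨O₄, rfl, fun x hx => mem_O₄.2 fun s => ?_⟩
    have hS : (O.map (φ s : A₃ →+* ℍ[ℚ])).toAddSubgroup.FG := fg_map hO.1 (φ s : A₃ →+ ℍ[ℚ])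
    refine le_hurwitz_of_fg hS (lipschitz_le_iff.2 ⟨?_, ?_⟩) ⟨x, hx, rfl⟩
    · exact ⟨gen _ 0, cliffordOrder_le_iff.1 hΓ 0, φ_gen_zero s⟩
    · exact ⟨gen _ 1, cliffordOrder_le_iff.1 hΓ 1, φ_gen_one s⟩
  · rintro O rfl O' rfl -
    rfl

theorem isStarStable_O₄ : IsStarStable O₄ := fun x hx => mem_O₄.2 fun s => by
  rw [φ_rev]
  exact flip_mem_hurwitz (mem_O₄.1 hx _)

theorem vecOf_sub (p q : ℍ[ℚ]) : vecOf (p - q) = vecOf p - vecOf q :=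
  φ_ext (forall_units (by simp only [map_sub, φ_one_vecOf]) (by
    simp only [map_sub, φ_neg_one_vecOf]; ext <;> simp [flip]; ring))

theorem vecOf_mul_bar (p : ℍ[ℚ]) : vecOf p * bar (vecOf p) = algebraMap ℚ _ (normSq p) :=
  mul_bar_eq_iff.2 (forall_units (by rw [φ_one_vecOf]) (by rw [φ_neg_one_vecOf, normSq_flip]))

theorem vecOf_mem_O₄ {p : ℍ[ℚ]} : vecOf p ∈ O₄ ↔ p ∈ hurwitz := by
  rw [mem_O₄]
  refine ⟨fun h => by simpa only [φ_one_vecOf] using h 1, fun h => forall_units ?_ ?_⟩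
  · rwa [φ_one_vecOf]
  · rw [φ_neg_one_vecOf]; exact flip_mem_hurwitz h

theorem isRightCliffordEuclidean_O₄ : IsRightCliffordEuclidean O₄ := by
  refine isRightCliffordEuclidean_of_covering (fun x _ q hq => norm_nonneg_three hq) ?_ ?_
  · intro x hx q hq
    rw [← mul_bar_eq_iff.1 hq 1]
    exact normSq_hurwitz (mem_O₄.1 hx.1 1)
  · intro w hw
    obtain ⟨v, hv, hlt⟩ := exists_hurwitz_near (φ 1 w)
    refine ⟨vecOf v, ⟨vecOf_mem_O₄.2 hv, vecOf_mem v⟩, _, hlt, ?_⟩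
    rw [eq_vecOf hw, ← vecOf_sub, vecOf_mul_bar, φ_one_vecOf]

theorem vecOf_mul_bar_add (p q : ℍ[ℚ]) : vecOf p * bar (vecOf q) + vecOf q * bar (vecOf p) =
    algebraMap ℚ _ (2 * (p.re * q.re + p.imI * q.imI + p.imJ * q.imJ + p.imK * q.imK)) := by
  refine φ_ext (forall_units ?_ ?_)
  · simp only [map_add, map_mul, φ_bar, φ_one_vecOf, AlgHom.commutes, algebraMap_eq_quat]
    ext <;> simp <;> ring
  · simp only [map_add, map_mul, φ_bar, φ_neg_one_vecOf, AlgHom.commutes, algebraMap_eq_quat]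
    ext <;> simp [flip] <;> ring

/-- The simple roots of `D₄` among the Hurwitz quaternions; the second one is the center. -/
def d4Root : Fin 4 → ℍ[ℚ] :=
  ![quat 0 1 0 0, quat (1 / 2) (-1 / 2) (-1 / 2) (-1 / 2), quat 0 0 1 0, quat 0 0 0 1]

theorem sum_d4Root (t a b c : ℤ) : quat (t / 2) (a + t / 2) (b + t / 2) (c + t / 2) =
    ((a + t : ℤ) : ℚ) • d4Root 0 + (t : ℚ) • d4Root 1 + ((b + t : ℤ) : ℚ) • d4Root 2 +
      ((c + t : ℤ) : ℚ) • d4Root 3 := by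
  ext <;> simp [d4Root] <;> ring

/-- `vecOf` as a linear map. -/
noncomputable def vecOfₗ : ℍ[ℚ] →ₗ[ℚ] A₃ where
  toFun := vecOf
  map_add' p q := φ_ext (forall_units (by simp only [map_add, φ_one_vecOf]) (by
    simp only [map_add, φ_neg_one_vecOf]; ext <;> simp [flip]; ring))
  map_smul' r q := φ_ext (forall_units (by simp [φ_one_vecOf]) (by
    simp only [map_smul, φ_neg_one_vecOf]; ext <;> simp [flip]))

theorem d4Root_mem (i : Fin 4) : d4Root i ∈ hurwitz := by
  fin_cases i
  · exact ⟨0, 1, 0, 0, by simp [d4Root]⟩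
  · exact ⟨1, -1, -1, -1, by simp [d4Root]; norm_num⟩
  · exact ⟨0, 0, 1, 0, by simp [d4Root]⟩
  · exact ⟨0, 0, 0, 1, by simp [d4Root]⟩

theorem isD4Base_vecOf : IsD4Base O₄ (fun i => vecOf (d4Root i)) := by
  refine ⟨?_, ?_, fun i j => ?_⟩
  · rw [Fintype.linearIndependent_iff]
    intro g hg
    have h1 := congrArg (φ 1) hg
    rw [map_zero, map_sum, Fin.sum_univ_four] at h1
    simp only [map_zsmul, φ_one_vecOf] at h1
    have e0 := congrArg (hcoord 0) h1
    have e1 := congrArg (hcoord 1) h1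
    have e2 := congrArg (hcoord 2) h1
    have e3 := congrArg (hcoord 3) h1
    simp [d4Root] at e0 e1 e2 e3
    rw [Fin.forall_fin_succ, Fin.forall_fin_succ, Fin.forall_fin_two]
    simp only [e0, Int.cast_zero, add_zero, Int.cast_eq_zero, zero_mul, zero_add] at e1 e2 e3
    exact ⟨e1, e0, e2, e3⟩
  · apply le_antisymm
    · rw [AddSubgroup.closure_le]
      rintro _ ⟨i, rfl⟩
      exact ⟨vecOf_mem_O₄.2 (d4Root_mem i), vecOf_mem _⟩
    · rintro x ⟨hx, hxv⟩
      rw [eq_vecOf hxv]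
      obtain ⟨t, a, b, c, h⟩ := mem_O₄.1 hx 1
      rw [h, sum_d4Root]
      change vecOfₗ _ ∈ _
      simp only [map_add, Int.cast_smul_eq_zsmul, map_zsmul]
      have hm : ∀ i, vecOfₗ (d4Root i) ∈
          AddSubgroup.closure (Set.range fun i => vecOf (d4Root i)) := fun i =>
        AddSubgroup.subset_closure ⟨i, rfl⟩
      exact AddSubgroup.add_mem _ (AddSubgroup.add_mem _ (AddSubgroup.add_mem _
        (AddSubgroup.zsmul_mem _ (hm 0) _) (AddSubgroup.zsmul_mem _ (hm 1) _))
        (AddSubgroup.zsmul_mem _ (hm 2) _)) (AddSubgroup.zsmul_mem _ (hm 3) _)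
  · rw [vecOf_mul_bar_add]
    congr 1
    fin_cases i <;> fin_cases j <;> simp [d4Root, CartanMatrix.D] <;> norm_num

/-- A Clifford unit that induces triality. -/
noncomputable def trialityUnit : A₃ :=
  (1 / 2 : ℚ) • (1 + gen _ 0 * gen _ 1 + gen _ 1 * gen _ 2 + gen _ 2 * gen _ 0)

theorem φ_one_trialityUnit : φ 1 trialityUnit = quat (1 / 2) (1 / 2) (1 / 2) (1 / 2) := by
  simp only [trialityUnit, map_smul, map_add, map_mul, map_one, φ_gen_zero, φ_gen_one, φ_gen_two]
  ext <;> simp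

theorem φ_neg_one_trialityUnit :
    φ (-1) trialityUnit = quat (1 / 2) (-1 / 2) (-1 / 2) (1 / 2) := by
  simp only [trialityUnit, map_smul, map_add, map_mul, map_one, φ_gen_zero, φ_gen_one, φ_gen_two]
  ext <;> simp <;> norm_num

theorem isCliffordUnit_trialityUnit : IsCliffordUnit O₄ trialityUnit := by
  have h1 : trialityUnit * bar trialityUnit = 1 := by
    rw [← map_one (algebraMap ℚ A₃), mul_bar_eq_iff]
    refine forall_units ?_ ?_
    · rw [φ_one_trialityUnit, normSq_def']; norm_num
    · rw [φ_neg_one_trialityUnit, normSq_def']; norm_num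
  have hO : trialityUnit ∈ O₄ := mem_O₄.2 (forall_units
    (by rw [φ_one_trialityUnit]; exact ⟨1, 0, 0, 0, by norm_num⟩)
    (by rw [φ_neg_one_trialityUnit]; exact ⟨1, -1, -1, 0, by norm_num⟩))
  refine ⟨⟨hO, mem_cliffordMonoid_three.2 ⟨1, by rw [h1, map_one]⟩⟩, bar trialityUnit, ?_, h1,
    by rw [bar_mul_self, h1]⟩
  exact mem_O₄.2 fun s => by rw [φ_bar]; exact star_mem_hurwitz (mem_O₄.1 hO s)

/-- In the first factor v ↦ αvα^* is conjugation by ω = (1+i+j+k)/2. It permutes i, j, k cyclically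
and fixes the central root (1-i-j-k)/2, which commutes with ω. -/
theorem trialityUnit_conj (i : Fin 4) :
    trialityUnit * vecOf (d4Root i) * rev trialityUnit =
      vecOf (d4Root ((Equiv.swap 0 3 * Equiv.swap 0 2 : Equiv.Perm (Fin 4)) i)) := by
  refine φ_ext (forall_units ?_ ?_)
  · simp only [map_mul, φ_rev, φ_one_vecOf, φ_one_trialityUnit, φ_neg_one_trialityUnit]
    fin_cases i <;> simp [d4Root, flip, Equiv.swap_apply_def] <;> ext <;> simp <;> norm_num
  · simp only [map_mul, φ_rev, φ_neg_one_vecOf, neg_neg, φ_one_trialityUnit,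
      φ_neg_one_trialityUnit]
    fin_cases i <;> simp [d4Root, flip, Equiv.swap_apply_def] <;> ext <;> simp <;> norm_num

/-- The quaternions with integral coordinates that are all odd. -/
def IsOddQuat (p : ℍ[ℚ]) : Prop :=
  ∃ a b c d : ℤ, p = quat (2 * a + 1) (2 * b + 1) (2 * c + 1) (2 * d + 1)

theorem normSq_isOddQuat {p : ℍ[ℚ]} (h : IsOddQuat p) :
    ∃ l : ℤ, normSq p = 4 * (2 * l + 1) := by
  obtain ⟨a, b, c, d, rfl⟩ := h
  have key : ∀ a : ℤ, ∃ x : ℤ, (2 * (a : ℚ) + 1) ^ 2 = 8 * x + 1 := fun a => by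
    obtain ⟨x, hx⟩ := Int.even_mul_succ_self a
    refine ⟨x, ?_⟩
    have : (a : ℚ) * (a + 1) = x + x := by exact_mod_cast hx
    linear_combination 4 * this
  obtain ⟨x, hx⟩ := key a
  obtain ⟨y, hy⟩ := key b
  obtain ⟨z, hz⟩ := key c
  obtain ⟨w, hw⟩ := key d
  refine ⟨x + y + z + w, ?_⟩
  rw [normSq_def']
  simp only [re_quat, imI_quat, imJ_quat, imK_quat, hx, hy, hz, hw]
  push_cast
  ring

theorem vecOf_smul (r : ℚ) (p : ℍ[ℚ]) : vecOf (r • p) = r • vecOf p := vecOfₗ.map_smul r p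

theorem vecOf_star (p : ℍ[ℚ]) : bar (vecOf p) = vecOf (star p) :=
  φ_ext (forall_units (by rw [φ_bar, φ_one_vecOf, φ_one_vecOf]) (by
    rw [φ_bar, φ_neg_one_vecOf, φ_neg_one_vecOf]; ext <;> simp [flip]))

/-- An infinite descent that works for any N. The invariant is x⁻¹y = p / (2(2k+1)) with p integral
and all its coordinates odd. Subtracting an integral q changes p by an even vector, so the remainder
r has the same shape with some p'. Since p' has norm 4(2l+1), r is invertible and r⁻¹x = (2k+1) p̄'
/ (2(2l+1)) again satisfies the invariant. Division thus never terminates. -/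
theorem not_isRightCliffordEuclidean_cliffordOrder :
    ¬ IsRightCliffordEuclidean (cliffordOrder ![-1, -1, -1]) := by
  rintro ⟨N, hN0, hN⟩
  have descent : ∀ n : ℕ, ∀ x ∈ orderMonoid (cliffordOrder ![-1, -1, -1]),
      ∀ y ∈ orderMonoid (cliffordOrder ![-1, -1, -1]), ∀ (k : ℤ) (p : ℍ[ℚ]), IsOddQuat p →
      (2 * (2 * k + 1) : ℚ) • y = x * vecOf p → 0 < N x → N x = n → False := by
    intro n
    induction n using Nat.strong_induction_on with
    | _ n ih =>
    intro x hx y hy k p hp hxy hNx hn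
    have hk : (2 * (2 * k + 1) : ℚ) ≠ 0 := by
      have : (2 * (2 * k + 1) : ℤ) ≠ 0 := by omega
      exact_mod_cast this
    have hvec : x * rev y ∈ vec ![-1, -1, -1] := by
      have h1 : (2 * (2 * k + 1) : ℚ) • (x * rev y) = x * vecOf p * rev x := by
        rw [← mul_smul_comm, ← rev_smul, hxy, rev_mul, rev_of_mem_vec (vecOf_mem p), mul_assoc]
      have h2 := (vec ![-1, -1, -1]).smul_mem (2 * (2 * k + 1) : ℚ)⁻¹ (hx.2.2 _ (vecOf_mem p))
      rwa [← h1, smul_smul, inv_mul_cancel₀ hk, one_smul] at h2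
    obtain ⟨q, hq, r, hr, hyq, hlt⟩ := hN x hx y hy hNx
      ⟨Subring.mul_mem _ hx.1 (isStarStable_cliffordOrder _ _ hy.1), hvec⟩
    set p' : ℍ[ℚ] := p - (2 * (2 * k + 1) : ℚ) • φ 1 q with hp'
    have hodd : IsOddQuat p' := by
      obtain ⟨a, b, c, d, rfl⟩ := hp
      obtain ⟨⟨e, he⟩, ⟨f, hf⟩, ⟨g, hg⟩, ⟨h, hh⟩⟩ := φ_mem_lipschitz hq.1 1
      refine ⟨a - (2 * k + 1) * e, b - (2 * k + 1) * f, c - (2 * k + 1) * g,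
        d - (2 * k + 1) * h, ?_⟩
      ext <;> simp [hp', he, hf, hg, hh] <;> ring
    have hr' : (2 * (2 * k + 1) : ℚ) • r = x * vecOf p' := by
      rw [hp', vecOf_sub, vecOf_smul, ← eq_vecOf hq.2, mul_sub, ← hxy, mul_smul_comm, ← smul_sub,
        hyq, add_sub_cancel_left]
    obtain ⟨l, hl⟩ := normSq_isOddQuat hodd
    -- Multiply 2(2k+1) r = x p' on the right by p̄', use p' p̄' = 4(2l+1), and halve.
    have hback : (2 * (2 * l + 1) : ℚ) • x = r * vecOf ((2 * k + 1 : ℚ) • star p') := by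
      have h1 : x * vecOf p' * bar (vecOf p') = (normSq p') • x := by
        rw [mul_assoc, vecOf_mul_bar, ← Algebra.commutes, Algebra.smul_def]
      rw [← hr', hl, vecOf_star] at h1
      rw [vecOf_smul, mul_smul_comm, ← smul_mul_assoc]
      have h2 := congrArg (fun z => (1 / 2 : ℚ) • z) h1
      simp only [smul_mul_assoc, smul_smul] at h2
      rw [smul_mul_assoc]
      convert h2.symm using 2 <;> ring
    have hodd' : IsOddQuat ((2 * k + 1 : ℚ) • star p') := by
      obtain ⟨a, b, c, d, h⟩ := hodd
      refine ⟨2 * k * a + k + a, -(2 * k * b + k + b) - 1, -(2 * k * c + k + c) - 1,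
        -(2 * k * d + k + d) - 1, ?_⟩
      rw [h]
      ext <;> simp <;> ring
    have hNr : 0 < N r := by
      rw [Nat.pos_iff_ne_zero, Ne, hN0 r hr]
      obtain ⟨ρ, hρ⟩ := hr.2.1
      have hρ0 : ρ ≠ 0 := by
        intro h0
        have hr0 := (norm_nonneg_three hρ.symm).2 h0
        rw [hr0, zero_mul] at hback
        have hl0 : (2 * (2 * l + 1) : ℚ) ≠ 0 := by
          have : (2 * (2 * l + 1) : ℤ) ≠ 0 := by omega
          exact_mod_cast this
        have hx0 : x = 0 := (smul_eq_zero.1 hback).resolve_left hl0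
        have : N x = 0 := (hN0 x hx).2 ⟨1, Subring.one_mem _, one_ne_zero, Or.inl (by
          rw [hx0, zero_mul])⟩
        omega
      obtain ⟨u, rfl⟩ := exists_unit_of_mul_bar hρ.symm hρ0
      exact not_isZeroDivisorIn_of_unit _ u
    exact ih (N r) (hn ▸ hlt) r hr x hx l _ hodd' hback hNr rfl
  have hint : ∀ z : ℤ, algebraMap ℚ A₃ z ∈ cliffordOrder ![-1, -1, -1] := fun z => by
    rw [map_intCast]; exact intCast_mem _ z
  have h2 : algebraMap ℚ A₃ 2 ∈ orderMonoid (cliffordOrder ![-1, -1, -1]) :=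
    ⟨by exact_mod_cast hint 2, mem_cliffordMonoid_of_mem_vec (mem_vec_iff.2 ⟨2, 0, by simp⟩)⟩
  have hy : vecOf (quat 1 1 1 1) ∈ orderMonoid (cliffordOrder ![-1, -1, -1]) := by
    refine ⟨?_, mem_cliffordMonoid_of_mem_vec (vecOf_mem _)⟩
    rw [vecOf, ι_eq_sum, Fin.sum_univ_three]
    simp only [re_quat, imI_quat, imJ_quat, imK_quat, map_one, Matrix.cons_val_zero,
      Matrix.cons_val_one, Matrix.cons_val, one_smul]
    exact Subring.add_mem _ (Subring.one_mem _) (Subring.add_mem _ (Subring.add_mem _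
      (gen_mem_cliffordOrder 0) (gen_mem_cliffordOrder 1)) (gen_mem_cliffordOrder 2))
  -- The descent starts at x = 2 and y = 1+γ₁+γ₂+γ₃, the deep hole of ℤ⁴.
  refine descent _ _ h2 _ hy 0 (quat 1 1 1 1) ⟨0, 0, 0, 0, by simp⟩ ?_ ?_ rfl
  · rw [← Algebra.smul_def]; norm_num
  · rw [Nat.pos_iff_ne_zero, Ne, hN0 _ h2]
    obtain ⟨u, hu⟩ : IsUnit (algebraMap ℚ A₃ 2) := (IsUnit.mk0 (2 : ℚ) two_ne_zero).map _
    rw [← hu]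
    exact not_isZeroDivisorIn_of_unit _ u

/-- The quaternions of even coordinate sum. -/
def IsEvenQuat (p : ℍ[ℚ]) : Prop := ∃ z : ℤ, p.re + p.imI + p.imJ + p.imK = 2 * z

/-- The coordinate sum modulo 2 is a ring homomorphism from the Lipschitz quaternions to 𝔽₂; the
witness is the explicit carry. -/
theorem IsEvenQuat.mul {p q : ℍ[ℚ]} (hq : q ∈ lipschitz) (hp : p ∈ lipschitz) (h : IsEvenQuat p) :
    IsEvenQuat (q * p) := by
  obtain ⟨⟨a, ha⟩, ⟨b, hb⟩, ⟨c, hc⟩, ⟨d, hd⟩⟩ := hq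
  obtain ⟨⟨e, he⟩, ⟨f, hf⟩, ⟨g, hg⟩, ⟨h', hh⟩⟩ := hp
  obtain ⟨z, hz⟩ := h
  refine ⟨(a + b + c + d) * z - (b * f + c * g + d * h' + d * g + b * h' + c * f), ?_⟩
  rw [he, hf, hg, hh] at hz
  simp only [re_mul, imI_mul, imJ_mul, imK_mul, ha, hb, hc, hd, he, hf, hg, hh]
  push_cast
  linear_combination (a + b + c + d : ℚ) * hz

theorem isEvenQuat_flip {p : ℍ[ℚ]} (hp : p ∈ lipschitz) (h : IsEvenQuat p) :
    IsEvenQuat (flip p) := by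
  obtain ⟨k, hk⟩ := hp.2.2.2
  obtain ⟨z, hz⟩ := h
  refine ⟨z - k, ?_⟩
  simp only [flip, re_quat, imI_quat, imJ_quat, imK_quat]
  push_cast
  linarith

/-- Take v = (1+γ₁+γ₂+γ₃)/2. If c and cv are both integral, then both have even coordinate sum, so
ad^* - bc^* has even coordinate sum and cannot be 1. -/
theorem not_isCuspidallyPrincipal_cliffordOrder :
    ¬ IsCuspidallyPrincipal (cliffordOrder ![-1, -1, -1]) := by
  intro h
  obtain ⟨M, ⟨hM, h1, -, -⟩, -, hcd⟩ := h (vecOf hω) (vecOf_mem _)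
  have hL : ∀ i j s, φ s (M i j) ∈ lipschitz := fun i j s => φ_mem_lipschitz (hM i j).1 s
  have key : ∀ (p : ℍ[ℚ]) (s : ℤ), (s = 1 ∨ s = -1) → p ∈ lipschitz →
      p * quat (1 / 2) (1 / 2) (1 / 2) (s / 2) ∈ lipschitz →
      IsEvenQuat p ∧ IsEvenQuat (p * quat (1 / 2) (1 / 2) (1 / 2) (s / 2)) := by
    rintro p s hs ⟨⟨a, ha⟩, ⟨b, hb⟩, ⟨c, hc⟩, ⟨d, hd⟩⟩ ⟨⟨e, he⟩, -, -, -⟩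
    have h3 : a - b - c - d * s = 2 * e := by
      have : (a : ℚ) - b - c - d * s = 2 * e := by
        rw [← he, re_mul, ha, hb, hc, hd]
        simp only [re_quat, imI_quat, imJ_quat, imK_quat]
        ring
      exact_mod_cast this
    obtain ⟨z, hz⟩ : ∃ z, a + b + c + d = 2 * z := by
      rcases hs with rfl | rfl
      · exact ⟨e + b + c + d, by linarith⟩
      · exact ⟨e + b + c, by linarith⟩
    have hz' : (a : ℚ) + b + c + d = 2 * z := by exact_mod_cast hz
    refine ⟨⟨z, by rw [ha, hb, hc, hd, hz']⟩, ?_⟩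
    rcases hs with rfl | rfl
    · refine ⟨a, ?_⟩
      simp only [re_mul, imI_mul, imJ_mul, imK_mul, ha, hb, hc, hd, re_quat, imI_quat, imJ_quat,
        imK_quat]
      push_cast
      ring
    · refine ⟨z - c, ?_⟩
      simp only [re_mul, imI_mul, imJ_mul, imK_mul, ha, hb, hc, hd, re_quat, imI_quat, imJ_quat,
        imK_quat]
      push_cast
      linear_combination hz'
  -- The projection of index -1 is the relevant one: the determinant is read through `φ 1`, and
  -- reversal of c and d exchanges the factors.
  have hc : IsEvenQuat (φ (-1) (M 1 0)) ∧ IsEvenQuat (φ (-1) (M 1 1)) := by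
    have hw : φ (-1) (vecOf hω) = quat (1 / 2) (1 / 2) (1 / 2) ((-1 : ℤ) / 2) := by
      rw [φ_neg_one_vecOf]; ext <;> simp [flip, hω]; norm_num
    have h3 := hL 1 1 (-1)
    rw [hcd, map_mul, hw] at h3 ⊢
    exact key _ _ (Or.inr rfl) (hL 1 0 (-1)) h3
  have h2 := congrArg (φ 1) h1
  rw [map_sub, map_mul, map_mul, φ_rev, φ_rev, map_one] at h2
  obtain ⟨y, hy⟩ := (isEvenQuat_flip (hL 1 1 (-1)) hc.2).mul (hL 0 0 1)
    (flip_mem_lipschitz (hL 1 1 (-1)))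
  obtain ⟨z, hz⟩ := (isEvenQuat_flip (hL 1 0 (-1)) hc.1).mul (hL 0 1 1)
    (flip_mem_lipschitz (hL 1 0 (-1)))
  have e0 := congrArg (hcoord 0) h2
  have e1 := congrArg (hcoord 1) h2
  have e2 := congrArg (hcoord 2) h2
  have e3 := congrArg (hcoord 3) h2
  simp only [map_sub, hcoord_zero, hcoord_one, hcoord_two, hcoord_three, re_one, imI_one, imJ_one,
    imK_one] at e0 e1 e2 e3
  have h5 : (2 * (y - z) : ℚ) = 1 := by linear_combination -hy + hz + e0 + e1 + e2 + e3
  have h6 : 2 * (y - z) = 1 := by exact_mod_cast h5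
  omega

/-- The part of the theorem on `(-1, -1, -1 / ℚ)`. -/
theorem three_units : (∃ O₄ : Subring (Alg ![-1, -1, -1]),
      maxOrders ![-1, -1, -1] = {O₄} ∧
      IsStarStable O₄ ∧ IsRightCliffordEuclidean O₄ ∧ IsLeftCliffordEuclidean O₄ ∧
      ∃ (b : Fin 4 → Alg ![-1, -1, -1]) (α : Alg ![-1, -1, -1]) (τ : Equiv.Perm (Fin 4)),
        IsD4Base O₄ b ∧ IsCliffordUnit O₄ α ∧
        (∀ i j, CartanMatrix.D 4 (τ i) (τ j) = CartanMatrix.D 4 i j) ∧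
        orderOf τ = 3 ∧ ∀ i, α * b i * rev α = b (τ i)) ∧
    (IsOrder (cliffordOrder ![-1, -1, -1]) ∧ IsStarStable (cliffordOrder ![-1, -1, -1]) ∧
      ¬ IsRightCliffordEuclidean (cliffordOrder ![-1, -1, -1]) ∧
      ¬ IsLeftCliffordEuclidean (cliffordOrder ![-1, -1, -1]) ∧
      ¬ IsCuspidallyPrincipal (cliffordOrder ![-1, -1, -1])) := by
  refine ⟨⟨O₄, maxOrders_three, isStarStable_O₄, isRightCliffordEuclidean_O₄,
    (isLeftCliffordEuclidean_iff isStarStable_O₄ fun _ => rev_mem_cliffordMonoid_three).2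
      isRightCliffordEuclidean_O₄, fun i => vecOf (d4Root i), trialityUnit,
    Equiv.swap 0 3 * Equiv.swap 0 2, isD4Base_vecOf, isCliffordUnit_trialityUnit,
    by intro i j; fin_cases i <;> fin_cases j <;> decide,
    orderOf_eq_prime (by decide) (by decide), trialityUnit_conj⟩,
    isOrder_of_fg (fg_of_φ fun x hx s => lipschitz_le_hurwitz (φ_mem_lipschitz hx s)) le_rfl,
    isStarStable_cliffordOrder _, not_isRightCliffordEuclidean_cliffordOrder, fun h => ?_,
    not_isCuspidallyPrincipal_cliffordOrder⟩
  exact not_isRightCliffordEuclidean_cliffordOrder ((isLeftCliffordEuclidean_iff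
    (isStarStable_cliffordOrder _) fun _ => rev_mem_cliffordMonoid_three).1 h)

end ThreeUnits

/-! ### The algebra (-1,-3/ℚ) -/

section Ternary

open Quaternion

/-- The Clifford algebra `(-1, -3 / ℚ)`. -/
abbrev A₂ : Type := Alg ![-1, -3]

/-- The Clifford algebra `(-1, -3 / ℚ)` as a quaternion algebra. -/
noncomputable def ψ : A₂ →ₐ[ℚ] ℍ[ℚ,-1,-3] :=
  CliffordAlgebra.lift _ ⟨
    { toFun := fun u => ⟨0, u 0, u 1, 0⟩
      map_add' := fun u v => by ext <;> simp
      map_smul' := fun r u => by ext <;> simp }, fun u => by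
    rw [QuaternionAlgebra.algebraMap_eq]
    ext
    · simp [QuadraticMap.weightedSumSquares_apply]
      ring
    all_goals simp [mul_comm]⟩

theorem ψ_ι (u : Fin 2 → ℚ) :
    ψ (CliffordAlgebra.ι (form ![-1, -3]) u) = ⟨0, u 0, u 1, 0⟩ := by
  rw [ψ, CliffordAlgebra.lift_ι_apply]
  rfl

theorem ψ_gen_zero : ψ (gen _ 0) = ⟨0, 1, 0, 0⟩ := by
  rw [gen, ψ_ι]; simp

theorem ψ_gen_one : ψ (gen _ 1) = ⟨0, 0, 1, 0⟩ := by
  rw [gen, ψ_ι]; simp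

theorem ψ_injective : Function.Injective ψ := by
  refine injective_of_surjective (m := 2) ?_ ψ fun q =>
    ⟨q.re • 1 + q.imI • gen _ 0 + q.imJ • gen _ 1 + q.imK • (gen _ 0 * gen _ 1), ?_⟩
  · rw [QuaternionAlgebra.finrank_eq_four]; norm_num
  · simp only [map_add, map_smul, map_mul, map_one, ψ_gen_zero, ψ_gen_one]
    ext <;> simp

theorem ψ_bar (x : A₂) : ψ (bar x) = star (ψ x) := by
  induction x using CliffordAlgebra.induction with
  | algebraMap r =>
    rw [bar_algebraMap, AlgHom.commutes, QuaternionAlgebra.algebraMap_eq]; ext <;> simp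
  | ι u => rw [bar_ι, map_neg, ψ_ι]; ext <;> simp
  | mul x y hx hy => rw [bar_mul, map_mul, map_mul, hx, hy, star_mul]
  | add x y hx hy => rw [bar_add, map_add, map_add, hx, hy, star_add]

theorem ψ_rev (x : A₂) : ψ (rev x) = ⟨(ψ x).re, (ψ x).imI, (ψ x).imJ, -(ψ x).imK⟩ := by
  induction x using CliffordAlgebra.induction with
  | algebraMap r =>
    rw [rev_algebraMap, AlgHom.commutes, QuaternionAlgebra.algebraMap_eq]; ext <;> simp
  | ι u => rw [rev_ι, ψ_ι]; ext <;> simp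
  | mul x y hx hy => rw [rev_mul, map_mul, map_mul, hx, hy]; ext <;> simp <;> ring
  | add x y hx hy => rw [rev_add, map_add, map_add, hx, hy]; ext <;> simp; ring

/-- The Clifford vector of `(-1, -3 / ℚ)` with the given coordinates. -/
noncomputable def vec₂ (x y z : ℚ) : A₂ :=
  algebraMap ℚ _ x + CliffordAlgebra.ι (form ![-1, -3]) ![y, z]

theorem vec₂_mem (x y z : ℚ) : vec₂ x y z ∈ vec ![-1, -3] := mem_vec_iff.2 ⟨_, _, rfl⟩

theorem ψ_vec₂ (x y z : ℚ) : ψ (vec₂ x y z) = ⟨x, y, z, 0⟩ := by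
  rw [vec₂, map_add, ψ_ι, AlgHom.commutes, QuaternionAlgebra.algebraMap_eq]; ext <;> simp

theorem eq_vec₂_of_rev {x : A₂} (h : rev x = x) : x = vec₂ (ψ x).re (ψ x).imI (ψ x).imJ := by
  have h1 := congrArg QuaternionAlgebra.imK (congrArg ψ h)
  rw [ψ_rev] at h1
  refine ψ_injective ?_
  rw [ψ_vec₂]
  ext
  · rfl
  · rfl
  · rfl
  · simp only at h1 ⊢; linarith

/-- The norm form of the quaternion algebra `(-1, -3 / ℚ)`. -/
def nrm₂ (q : ℍ[ℚ,-1,-3]) : ℚ := q.re ^ 2 + q.imI ^ 2 + 3 * q.imJ ^ 2 + 3 * q.imK ^ 2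

theorem nrm₂_mul (p q : ℍ[ℚ,-1,-3]) : nrm₂ (p * q) = nrm₂ p * nrm₂ q := by
  simp [nrm₂]; ring

theorem nrm₂_pow (q : ℍ[ℚ,-1,-3]) (k : ℕ) : nrm₂ (q ^ k) = nrm₂ q ^ k := by
  induction k with
  | zero => simp [nrm₂]
  | succ k ih => rw [pow_succ, nrm₂_mul, ih, pow_succ]

theorem ψ_mul_bar (x : A₂) : x * bar x = algebraMap ℚ _ (nrm₂ (ψ x)) := by
  refine ψ_injective ?_
  rw [map_mul, ψ_bar, AlgHom.commutes, QuaternionAlgebra.algebraMap_eq]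
  ext <;> simp [nrm₂] <;> ring

/-- In a quaternion algebra every x x̄ is scalar, and the elements fixed by reversal are those
without ij-component, that is, the Clifford vectors. Hence every unit may be used for a Clifford
conjugation, in particular 1 + i. -/
theorem mem_cliffordMonoid_two (x : A₂) : x ∈ cliffordMonoid ![-1, -3] :=
  (mem_cliffordMonoid_iff_of_vec fun x h => by rw [eq_vec₂_of_rev h]; exact vec₂_mem _ _ _).2
    ⟨_, (ψ_mul_bar x).symm⟩

/-- The order of `(-1, -3 / ℚ)` generated by `i` and `(1 + j) / 2`. -/
def eisensteinOrder : Subring ℍ[ℚ,-1,-3] where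
  carrier := {q | ∃ a b c d : ℤ, q = ⟨c / 2 + a, d / 2 + b, c / 2, d / 2⟩}
  mul_mem' := by
    rintro _ _ ⟨a, b, c, d, rfl⟩ ⟨e, f, g, h, rfl⟩
    refine ⟨a * e - b * f - c * g - d * h - d * f, c * h - d * g + c * f + a * f + b * e,
      c * g + a * g + c * e - b * h + d * f, a * h + d * e + d * g + b * g - c * f, ?_⟩
    ext <;> simp <;> ring
  one_mem' := ⟨1, 0, 0, 0, by ext <;> simp⟩
  add_mem' := by
    rintro _ _ ⟨a, b, c, d, rfl⟩ ⟨e, f, g, h, rfl⟩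
    exact ⟨a + e, b + f, c + g, d + h, by ext <;> simp <;> ring⟩
  zero_mem' := ⟨0, 0, 0, 0, by ext <;> simp⟩
  neg_mem' := by
    rintro _ ⟨a, b, c, d, rfl⟩
    exact ⟨-a, -b, -c, -d, by ext <;> simp <;> ring⟩

/-- The maximal order of `(-1, -3 / ℚ)` that contains `(1 + j) / 2`. -/
noncomputable def E₁ : Subring A₂ := eisensteinOrder.comap (ψ : A₂ →+* ℍ[ℚ,-1,-3])

theorem mem_E₁ {x : A₂} :
    x ∈ E₁ ↔ ∃ a b c d : ℤ, ψ x = ⟨c / 2 + a, d / 2 + b, c / 2, d / 2⟩ := Iff.rfl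

theorem vec₂_mul_bar (x y z : ℚ) :
    vec₂ x y z * bar (vec₂ x y z) = algebraMap ℚ _ (x ^ 2 + y ^ 2 + 3 * z ^ 2) := by
  rw [ψ_mul_bar, ψ_vec₂]; simp [nrm₂]

theorem exists_unit_one_add_gen : ∃ u : A₂ˣ, (u : A₂) = vec₂ 1 1 0 :=
  exists_unit_of_mul_bar (vec₂_mul_bar 1 1 0) (by norm_num)

/-- The unit `1 + i` of `(-1, -3 / ℚ)`. -/
noncomputable def u₂ : A₂ˣ := exists_unit_one_add_gen.choose

theorem val_u₂ : (u₂ : A₂) = vec₂ 1 1 0 := exists_unit_one_add_gen.choose_spec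

theorem ψ_conj_u₂ (x : A₂) : ψ (u₂ * x * (↑u₂⁻¹ : A₂)) =
    ⟨(ψ x).re, (ψ x).imI, -(ψ x).imK, (ψ x).imJ⟩ := by
  have h1 : (↑u₂⁻¹ : A₂) = (1 / 2 : ℚ) • vec₂ 1 (-1) 0 := by
    refine Units.inv_eq_of_mul_eq_one_right (ψ_injective ?_)
    rw [val_u₂, map_mul, map_smul, ψ_vec₂, ψ_vec₂, map_one]
    ext <;> simp
    norm_num
  rw [h1, val_u₂, map_mul, map_mul, map_smul, ψ_vec₂, ψ_vec₂]
  ext <;> simp <;> ring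

/-- The maximal order of `(-1, -3 / ℚ)` that contains `(1 + i * j) / 2`. -/
noncomputable def E₂ : Subring A₂ := conjOrder u₂ E₁

theorem mem_E₂ {x : A₂} :
    x ∈ E₂ ↔ ∃ a b c d : ℤ, ψ x = ⟨d / 2 + a, c / 2 + b, c / 2, d / 2⟩ := by
  rw [E₂, mem_conjOrder, mem_E₁, ψ_conj_u₂]
  constructor
  · rintro ⟨a, b, c, d, h⟩
    rw [QuaternionAlgebra.ext_iff] at h
    obtain ⟨h1, h2, h3, h4⟩ := h
    simp only at h1 h2 h3 h4
    refine ⟨a + c, b, d, -c, ?_⟩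
    ext <;> push_cast <;> linarith
  · rintro ⟨a, b, c, d, h⟩
    refine ⟨a + d, b, -d, c, ?_⟩
    rw [h]
    ext <;> simp <;> ring

theorem cliffordOrder_le_E₁ : cliffordOrder ![-1, -3] ≤ E₁ := by
  rw [cliffordOrder_le_iff, Fin.forall_fin_two]
  exact ⟨mem_E₁.2 ⟨0, 1, 0, 0, by rw [ψ_gen_zero]; simp⟩,
    mem_E₁.2 ⟨-1, 0, 2, 0, by rw [ψ_gen_one]; simp⟩⟩

theorem cliffordOrder_le_E₂ : cliffordOrder ![-1, -3] ≤ E₂ := by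
  rw [cliffordOrder_le_iff, Fin.forall_fin_two]
  exact ⟨mem_E₂.2 ⟨0, 1, 0, 0, by rw [ψ_gen_zero]; simp⟩,
    mem_E₂.2 ⟨0, -1, 2, 0, by rw [ψ_gen_one]; simp⟩⟩

/-- The coordinates of an element of the quaternion algebra `(-1, -3 / ℚ)`. -/
def coord₂ : Fin 4 → ℍ[ℚ,-1,-3] →ₗ[ℚ] ℚ :=
  ![QuaternionAlgebra.reₗ _ _ _, QuaternionAlgebra.imIₗ _ _ _, QuaternionAlgebra.imJₗ _ _ _,
    QuaternionAlgebra.imKₗ _ _ _]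

theorem isOrder_E₁ : IsOrder E₁ := by
  refine isOrder_of_fg (fg_of_den (fun i => (coord₂ i).comp ψ.toLinearMap) (fun x hx => ?_)
    two_ne_zero (fun x hx => ?_)) cliffordOrder_le_E₁
  · refine ψ_injective ?_
    rw [map_zero]
    ext
    exacts [hx 0, hx 1, hx 2, hx 3]
  · obtain ⟨a, b, c, d, h⟩ := mem_E₁.1 hx
    rw [Fin.forall_fin_succ, Fin.forall_fin_succ, Fin.forall_fin_two]
    refine ⟨⟨c + 2 * a, ?_⟩, ⟨d + 2 * b, ?_⟩, ⟨c, ?_⟩, ⟨d, ?_⟩⟩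
    · change (2 : ℤ) * (ψ x).re = _
      rw [h]; push_cast; ring
    · change (2 : ℤ) * (ψ x).imI = _
      rw [h]; push_cast; ring
    · change (2 : ℤ) * (ψ x).imJ = _
      rw [h]; push_cast; ring
    · change (2 : ℤ) * (ψ x).imK = _
      rw [h]; push_cast; ring

theorem nrm₂_of_isOrder {O : Subring A₂} (hO : IsOrder O) {x : A₂} (hx : x ∈ O) :
    IsInt (nrm₂ (ψ x)) := by
  obtain ⟨D, hD, h⟩ := exists_den_family hO.1 (fun i => (coord₂ i).comp ψ.toLinearMap)
  refine isInt_of_pow (D := D * D) (mul_ne_zero hD hD) fun k => ?_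
  have h' := h (x ^ k) (O.pow_mem hx k)
  obtain ⟨a, h0⟩ : IsInt (D * (ψ (x ^ k)).re) := h' 0
  obtain ⟨b, h1⟩ : IsInt (D * (ψ (x ^ k)).imI) := h' 1
  obtain ⟨c, h2⟩ : IsInt (D * (ψ (x ^ k)).imJ) := h' 2
  obtain ⟨d, h3⟩ : IsInt (D * (ψ (x ^ k)).imK) := h' 3
  refine ⟨a ^ 2 + b ^ 2 + 3 * c ^ 2 + 3 * d ^ 2, ?_⟩
  push_cast
  rw [← nrm₂_pow, ← map_pow, ← h0, ← h1, ← h2, ← h3, nrm₂]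
  ring

theorem sq_emod_four (x : ℤ) : x ^ 2 % 4 = x % 2 := by
  rcases Int.even_or_odd' x with ⟨y, rfl | rfl⟩ <;> ring_nf <;> omega

/-- Polarizing the norm against 1, i, j, ij bounds the denominators by 2, 2, 6, 6. The factor 3 then
disappears by a congruence modulo 3, and integrality of the norm leaves a congruence modulo 4. -/
theorem exists_halves {O : Subring A₂} (hO : IsOrder O) (hΓ : cliffordOrder ![-1, -3] ≤ O)
    {x : A₂} (hx : x ∈ O) : ∃ a b c d : ℤ, ψ x = ⟨a / 2, b / 2, c / 2, d / 2⟩ ∧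
      (a % 2 + b % 2 + 3 * (c % 2) + 3 * (d % 2)) % 4 = 0 := by
  have g0 := cliffordOrder_le_iff.1 hΓ 0
  have g1 := cliffordOrder_le_iff.1 hΓ 1
  obtain ⟨n, hn⟩ := nrm₂_of_isOrder hO hx
  obtain ⟨n0, h0⟩ := nrm₂_of_isOrder hO (O.add_mem hx O.one_mem)
  obtain ⟨n1, h1⟩ := nrm₂_of_isOrder hO (O.add_mem hx g0)
  obtain ⟨n2, h2⟩ := nrm₂_of_isOrder hO (O.add_mem hx g1)
  obtain ⟨n3, h3⟩ := nrm₂_of_isOrder hO (O.add_mem hx (O.mul_mem g0 g1))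
  rw [map_add, map_one] at h0
  rw [map_add, ψ_gen_zero] at h1
  rw [map_add, ψ_gen_one] at h2
  rw [map_add, map_mul, ψ_gen_zero, ψ_gen_one] at h3
  simp [nrm₂] at hn h0 h1 h2 h3
  generalize ψ x = q at *
  have k0 : 2 * q.re = ((n0 - n - 1 : ℤ) : ℚ) := by push_cast; linarith
  have k1 : 2 * q.imI = ((n1 - n - 1 : ℤ) : ℚ) := by push_cast; linarith
  have k2 : 6 * q.imJ = ((n2 - n - 3 : ℤ) : ℚ) := by push_cast; linarith
  have k3 : 6 * q.imK = ((n3 - n - 3 : ℤ) : ℚ) := by push_cast; linarith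
  generalize n0 - n - 1 = a at k0
  generalize n1 - n - 1 = b at k1
  generalize n2 - n - 3 = C at k2
  generalize n3 - n - 3 = D at k3
  have hsum : 3 * a ^ 2 + 3 * b ^ 2 + C ^ 2 + D ^ 2 = 12 * n := by
    have : 3 * (a : ℚ) ^ 2 + 3 * (b : ℚ) ^ 2 + (C : ℚ) ^ 2 + (D : ℚ) ^ 2 = 12 * n := by
      rw [← k0, ← k1, ← k2, ← k3, ← hn]; ring
    exact_mod_cast this
  have sq3 : ∀ x : ℤ, x ^ 2 % 3 = 0 ∧ x % 3 = 0 ∨ x ^ 2 % 3 = 1 := fun x => by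
    have : x % 3 = 0 ∨ x % 3 = 1 ∨ x % 3 = 2 := by omega
    rcases this with h | h | h <;> simp [pow_two, Int.mul_emod, h]
  -- The sum of squares identity gives C² + D² ≡ 0 modulo 3, and -1 is not a square modulo 3, so 3
  -- divides both C and D.
  have hC : ∃ c, C = 3 * c := by
    have := sq3 C; have := sq3 D
    exact ⟨C / 3, by omega⟩
  have hD : ∃ d, D = 3 * d := by
    have := sq3 C; have := sq3 D
    exact ⟨D / 3, by omega⟩
  obtain ⟨c, rfl⟩ := hC
  obtain ⟨d, rfl⟩ := hD
  push_cast at k2 k3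
  refine ⟨a, b, c, d, ?_, ?_⟩
  · ext
    · change q.re = a / 2; linarith
    · change q.imI = b / 2; linarith
    · change q.imJ = c / 2; linarith
    · change q.imK = d / 2; linarith
  · have := sq_emod_four a
    have := sq_emod_four b
    have := sq_emod_four c
    have := sq_emod_four d
    have : a ^ 2 + b ^ 2 + 3 * c ^ 2 + 3 * d ^ 2 = 4 * n := by linarith
    omega

/-- The congruence says that, modulo 2, the pairs {a, b} and {c, d} agree as multisets. Failing to
match in the given order, they match crosswise and have distinct entries. -/
theorem parity_of_not {a b c d : ℤ} (h : (a % 2 + b % 2 + 3 * (c % 2) + 3 * (d % 2)) % 4 = 0)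
    (hn : ¬ (2 ∣ a - c ∧ 2 ∣ b - d)) : a % 2 = d % 2 ∧ b % 2 = c % 2 ∧ a % 2 ≠ b % 2 := by
  rcases Int.emod_two_eq_zero_or_one a with ha | ha <;>
  rcases Int.emod_two_eq_zero_or_one b with hb | hb <;>
  rcases Int.emod_two_eq_zero_or_one c with hc | hc <;>
  rcases Int.emod_two_eq_zero_or_one d with hd | hd <;> rw [ha, hb, hc, hd] at h <;> omega

theorem parity_of_not' {a b c d : ℤ} (h : (a % 2 + b % 2 + 3 * (c % 2) + 3 * (d % 2)) % 4 = 0)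
    (hn : ¬ (2 ∣ a - d ∧ 2 ∣ b - c)) : a % 2 = c % 2 ∧ b % 2 = d % 2 ∧ a % 2 ≠ b % 2 :=
  parity_of_not (by omega) hn

theorem parity_add {a b c d e f g h : ℤ} (x1 : a % 2 = d % 2) (x2 : b % 2 = c % 2)
    (x3 : a % 2 ≠ b % 2) (y1 : e % 2 = g % 2) (y2 : f % 2 = h % 2) (y3 : e % 2 ≠ f % 2) :
    ((a + e) % 2 + (b + f) % 2 + 3 * ((c + g) % 2) + 3 * ((d + h) % 2)) % 4 ≠ 0 := by
  have z1 : (b + f) % 2 = (a + e) % 2 := by omega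
  have z2 : (d + h) % 2 = 1 - (a + e) % 2 := by omega
  have z3 : (c + g) % 2 = 1 - (a + e) % 2 := by omega
  rw [z1, z2, z3]
  clear z1 z2 z3
  rcases Int.emod_two_eq_zero_or_one (a + e) with h | h <;> rw [h] <;> decide

/-- If x lies outside E₁ and y outside E₂, their parity patterns are known, and `parity_add` shows
that x + y violates the congruence modulo 4, so they cannot lie in the same order. -/
theorem le_E₁_or_le_E₂ {O : Subring A₂} (hO : IsOrder O) (hΓ : cliffordOrder ![-1, -3] ≤ O) :
    O ≤ E₁ ∨ O ≤ E₂ := by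
  by_contra hcon
  push Not at hcon
  obtain ⟨h1, h2⟩ := hcon
  obtain ⟨x, hx, hx1⟩ := SetLike.not_le_iff_exists.1 h1
  obtain ⟨y, hy, hy2⟩ := SetLike.not_le_iff_exists.1 h2
  obtain ⟨a, b, c, d, hψ, hm⟩ := exists_halves hO hΓ hx
  obtain ⟨e, f, g, h, hψ', hm'⟩ := exists_halves hO hΓ hy
  obtain ⟨a', b', c', d', hψ'', hm''⟩ := exists_halves hO hΓ (O.add_mem hx hy)
  rw [map_add, hψ, hψ', QuaternionAlgebra.ext_iff] at hψ''
  obtain ⟨h1, h2, h3, h4⟩ := hψ''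
  simp only [QuaternionAlgebra.re_add, QuaternionAlgebra.imI_add, QuaternionAlgebra.imJ_add,
    QuaternionAlgebra.imK_add] at h1 h2 h3 h4
  have h1' : a' = a + e := by
    have : (a' : ℚ) = a + e := by linarith
    exact_mod_cast this
  have h2' : b' = b + f := by
    have : (b' : ℚ) = b + f := by linarith
    exact_mod_cast this
  have h3' : c' = c + g := by
    have : (c' : ℚ) = c + g := by linarith
    exact_mod_cast this
  have h4' : d' = d + h := by
    have : (d' : ℚ) = d + h := by linarith
    exact_mod_cast this
  subst h1' h2' h3' h4'
  have n1 : ¬ (2 ∣ a - c ∧ 2 ∣ b - d) := by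
    rintro ⟨⟨s, hs⟩, ⟨t, ht⟩⟩
    refine hx1 (mem_E₁.2 ⟨s, t, c, d, ?_⟩)
    have hs' : (a : ℚ) - c = 2 * s := by exact_mod_cast hs
    have ht' : (b : ℚ) - d = 2 * t := by exact_mod_cast ht
    rw [hψ]
    ext <;> simp <;> linarith
  have n2 : ¬ (2 ∣ e - h ∧ 2 ∣ f - g) := by
    rintro ⟨⟨s, hs⟩, ⟨t, ht⟩⟩
    refine hy2 (mem_E₂.2 ⟨s, t, g, h, ?_⟩)
    have hs' : (e : ℚ) - h = 2 * s := by exact_mod_cast hs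
    have ht' : (f : ℚ) - g = 2 * t := by exact_mod_cast ht
    rw [hψ']
    ext <;> simp <;> linarith
  obtain ⟨x1, x2, x3⟩ := parity_of_not hm n1
  obtain ⟨y1, y2, y3⟩ := parity_of_not' hm' n2
  exact parity_add x1 x2 x3 y1 y2 y3 hm''

theorem not_E₁_le_E₂ : ¬ E₁ ≤ E₂ := by
  intro h
  have h1 : vec₂ (1 / 2) 0 (1 / 2) ∈ E₁ := mem_E₁.2 ⟨0, 0, 1, 0, by rw [ψ_vec₂]; simp⟩
  obtain ⟨a, b, c, d, h2⟩ := mem_E₂.1 (h h1)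
  rw [ψ_vec₂, QuaternionAlgebra.ext_iff] at h2
  obtain ⟨h3, -, -, h4⟩ := h2
  simp only at h3 h4
  have : (2 * a : ℚ) = 1 := by linarith
  have : 2 * a = 1 := by exact_mod_cast this
  omega

theorem not_E₂_le_E₁ : ¬ E₂ ≤ E₁ := by
  intro h
  have h1 : vec₂ 0 (1 / 2) (1 / 2) ∈ E₂ := mem_E₂.2 ⟨0, 0, 1, 0, by rw [ψ_vec₂]; simp⟩
  obtain ⟨a, b, c, d, h2⟩ := mem_E₁.1 (h h1)
  rw [ψ_vec₂, QuaternionAlgebra.ext_iff] at h2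
  obtain ⟨-, h3, -, h4⟩ := h2
  simp only at h3 h4
  have : (2 * b : ℚ) = 1 := by linarith
  have : 2 * b = 1 := by exact_mod_cast this
  omega

theorem maxOrders_two : maxOrders ![-1, -3] = {E₁, E₂} := by
  refine maxOrders_eq ?_ ?_ ?_
  · rintro O (rfl | rfl)
    · exact ⟨isOrder_E₁, cliffordOrder_le_E₁⟩
    · exact ⟨isOrder_conjOrder _ isOrder_E₁, cliffordOrder_le_E₂⟩
  · intro O hO hΓ
    rcases le_E₁_or_le_E₂ hO hΓ with h | h
    exacts [⟨E₁, Or.inl rfl, h⟩, ⟨E₂, Or.inr rfl, h⟩]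
  · rintro O (rfl | rfl) O' (rfl | rfl) h
    exacts [rfl, absurd h not_E₁_le_E₂, absurd h not_E₂_le_E₁, rfl]

theorem isStarStable_E₁ : IsStarStable E₁ := fun x hx => by
  obtain ⟨a, b, c, d, h⟩ := mem_E₁.1 hx
  refine mem_E₁.2 ⟨a, b + d, c, -d, ?_⟩
  rw [ψ_rev, h]
  ext <;> simp <;> ring

theorem isStarStable_E₂ : IsStarStable E₂ := fun x hx => by
  obtain ⟨a, b, c, d, h⟩ := mem_E₂.1 hx
  refine mem_E₂.2 ⟨a + d, b, c, -d, ?_⟩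
  rw [ψ_rev, h]
  ext <;> simp <;> ring

/-- The three coordinate bounds give a remainder of norm at most 1/4 + 1/4 + 3/16 = 11/16 < 1. -/
theorem isRightCliffordEuclidean_two {O : Subring A₂} (hO : IsOrder O)
    (hcov : ∀ x y z : ℚ, ∃ x' y' z' : ℚ, vec₂ x' y' z' ∈ O ∧
      |x - x'| ≤ 1 / 2 ∧ |y - y'| ≤ 1 / 2 ∧ |z - z'| ≤ 1 / 4) :
    IsRightCliffordEuclidean O := by
  refine isRightCliffordEuclidean_of_covering (fun x _ q hq => ?_) (fun x hx q hq => ?_) ?_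
  · rw [ψ_mul_bar] at hq
    rw [← algebraMap_alg_injective hq]
    refine ⟨by rw [nrm₂]; positivity, fun h0 => ψ_injective ?_⟩
    rw [nrm₂] at h0
    have s0 := sq_nonneg (ψ x).re
    have s1 := sq_nonneg (ψ x).imI
    have s2 := sq_nonneg (ψ x).imJ
    have s3 := sq_nonneg (ψ x).imK
    have z0 : (ψ x).re = 0 := pow_eq_zero_iff two_ne_zero |>.1 (by linarith)
    have z1 : (ψ x).imI = 0 := pow_eq_zero_iff two_ne_zero |>.1 (by linarith)
    have z2 : (ψ x).imJ = 0 := pow_eq_zero_iff two_ne_zero |>.1 (by linarith)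
    have z3 : (ψ x).imK = 0 := pow_eq_zero_iff two_ne_zero |>.1 (by linarith)
    rw [map_zero]
    ext
    exacts [z0, z1, z2, z3]
  · rw [ψ_mul_bar] at hq
    rw [← algebraMap_alg_injective hq]
    exact nrm₂_of_isOrder hO hx.1
  · intro w hw
    obtain ⟨x', y', z', hv, h1, h2, h3⟩ := hcov (ψ w).re (ψ w).imI (ψ w).imJ
    refine ⟨_, ⟨hv, vec₂_mem _ _ _⟩, _, ?_, ψ_mul_bar _⟩
    rw [eq_vec₂_of_rev (rev_of_mem_vec hw), map_sub, ψ_vec₂, ψ_vec₂, nrm₂]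
    simp only [QuaternionAlgebra.re_sub, QuaternionAlgebra.imI_sub, QuaternionAlgebra.imJ_sub,
      QuaternionAlgebra.imK_sub]
    have s1 := sq_le_sq' (abs_le.1 h1).1 (abs_le.1 h1).2
    have s2 := sq_le_sq' (abs_le.1 h2).1 (abs_le.1 h2).2
    have s3 := sq_le_sq' (abs_le.1 h3).1 (abs_le.1 h3).2
    linarith

theorem exists_near_half (z : ℚ) : |z - (round (2 * z) : ℚ) / 2| ≤ 1 / 4 := by
  have := abs_sub_round (2 * z)
  rw [abs_le] at this ⊢
  constructor <;> linarith

/-- For the Clifford vectors of E₁ the coordinate of γ₂ is a half integer congruent to the scalar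
coordinate modulo ℤ. So z is rounded first, to a multiple of 1/2, and x is then rounded within the
resulting coset of ℤ. In E₂ the coordinate y plays the role of x. -/
theorem isRightCliffordEuclidean_E₁ : IsRightCliffordEuclidean E₁ := by
  refine isRightCliffordEuclidean_two isOrder_E₁ fun x y z =>
    ⟨(round (2 * z) : ℚ) / 2 + round (x - (round (2 * z) : ℚ) / 2), round y,
      (round (2 * z) : ℚ) / 2, mem_E₁.2
        ⟨round (x - (round (2 * z) : ℚ) / 2), round y, round (2 * z), 0, ?_⟩, ?_, abs_sub_round y,
      exists_near_half z⟩
  · rw [ψ_vec₂]; simp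
  · rw [← sub_sub]; exact abs_sub_round _

theorem isRightCliffordEuclidean_E₂ : IsRightCliffordEuclidean E₂ := by
  refine isRightCliffordEuclidean_two (isOrder_conjOrder _ isOrder_E₁) fun x y z =>
    ⟨round x, (round (2 * z) : ℚ) / 2 + round (y - (round (2 * z) : ℚ) / 2),
      (round (2 * z) : ℚ) / 2, mem_E₂.2
        ⟨round x, round (y - (round (2 * z) : ℚ) / 2), round (2 * z), 0, ?_⟩, abs_sub_round x, ?_,
      exists_near_half z⟩
  · rw [ψ_vec₂]; simp
  · rw [← sub_sub]; exact abs_sub_round _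

/-- The part of the theorem on `(-1, -3 / ℚ)`. -/
theorem unit_three : ∃ O₁ O₂ : Subring (Alg ![-1, -3]),
      maxOrders ![-1, -3] = {O₁, O₂} ∧ O₁ ≠ O₂ ∧
      conjClasses (maxOrders ![-1, -3]) = {{O₁, O₂}} ∧
      (1 / 2 : ℚ) • (1 + gen ![-1, -3] 1) ∈ O₁ ∧
      (1 / 2 : ℚ) • (1 + gen ![-1, -3] 0 * gen ![-1, -3] 1) ∈ O₂ ∧
      ∀ O ∈ maxOrders ![-1, -3],
        IsStarStable O ∧ IsRightCliffordEuclidean O ∧ IsLeftCliffordEuclidean O := by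
  refine ⟨E₁, E₂, maxOrders_two, fun h => not_E₁_le_E₂ h.le, ?_, ?_, ?_, ?_⟩
  · rw [maxOrders_two]
    refine conjClasses_eq_singleton (Or.inl rfl) ?_
    rintro O (rfl | rfl)
    exacts [.refl _, cliffordConj_conjOrder (mem_cliffordMonoid_two _) _]
  · refine mem_E₁.2 ⟨0, 0, 1, 0, ?_⟩
    rw [map_smul, map_add, map_one, ψ_gen_one]
    ext <;> simp
  · refine mem_E₂.2 ⟨0, 0, 0, 1, ?_⟩
    rw [map_smul, map_add, map_one, map_mul, ψ_gen_zero, ψ_gen_one]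
    ext <;> simp
  · rw [maxOrders_two]
    have key : ∀ O : Subring A₂, IsStarStable O → IsRightCliffordEuclidean O →
        IsStarStable O ∧ IsRightCliffordEuclidean O ∧ IsLeftCliffordEuclidean O := fun O h h' =>
      ⟨h, h', (isLeftCliffordEuclidean_iff h fun _ _ => mem_cliffordMonoid_two _).2 h'⟩
    rintro O (rfl | rfl)
    exacts [key _ isStarStable_E₁ isRightCliffordEuclidean_E₁,
      key _ isStarStable_E₂ isRightCliffordEuclidean_E₂]

end Ternary

/-! ### Integrality in ℚ(√3) -/

section SquareRootThree

open Quaternion QuadraticAlgebra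

/-- The field `ℚ(√3)`. -/
abbrev F₃ : Type := QuadraticAlgebra ℚ 3 0

/-- The element of `ℚ(√3)` is in `ℤ[√3]`. -/
def IsInt₃ (z : F₃) : Prop := IsInt z.re ∧ IsInt z.im

theorem IsInt₃.add {z w : F₃} (hz : IsInt₃ z) (hw : IsInt₃ w) : IsInt₃ (z + w) :=
  ⟨hz.1.add hw.1, hz.2.add hw.2⟩

theorem IsInt₃.sub {z w : F₃} (hz : IsInt₃ z) (hw : IsInt₃ w) : IsInt₃ (z - w) :=
  ⟨hz.1.sub hw.1, hz.2.sub hw.2⟩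

theorem IsInt₃.mul {z w : F₃} (hz : IsInt₃ z) (hw : IsInt₃ w) : IsInt₃ (z * w) := by
  have h3 : IsInt (3 : ℚ) := ⟨3, by norm_num⟩
  constructor
  · rw [QuadraticAlgebra.re_mul]
    exact (hz.1.mul hw.1).add ((h3.mul hz.2).mul hw.2)
  · rw [QuadraticAlgebra.im_mul, zero_mul, zero_mul, add_zero]
    exact (hz.1.mul hw.2).add (hz.2.mul hw.1)

/-- The norm of `ℚ(√3)` over `ℚ` is integral on elements whose powers have bounded
denominators. -/
theorem isInt_norm_of_pow {z : F₃} {D : ℤ} (hD : D ≠ 0) (h : ∀ k : ℕ, IsInt₃ ((D : ℚ) • z ^ k)) :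
    IsInt (z.re ^ 2 - 3 * z.im ^ 2) := by
  refine isInt_of_pow (D := D * D) (mul_ne_zero hD hD) fun k => ?_
  obtain ⟨⟨x, hx⟩, ⟨y, hy⟩⟩ := h k
  refine ⟨x ^ 2 - 3 * y ^ 2, ?_⟩
  push_cast
  rw [← hx, ← hy]
  have : (z.re ^ 2 - 3 * z.im ^ 2) = norm z := by rw [norm_def]; ring
  rw [this, ← map_pow, norm_def]
  simp
  ring

/-- The square of 3u is an integer, so the powers of 3u have bounded denominators and 3u is an
integer w; then w² = 3(3u²) is divisible by 3, hence so is w. -/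
theorem isInt_of_three_mul_sq {u : ℚ} (h : IsInt (3 * u ^ 2)) : IsInt u := by
  obtain ⟨m, hm⟩ := h
  have h1 : IsInt (3 * u) := by
    refine isInt_of_pow (D := u.den) (by simp) fun k => ?_
    have h3 : (3 * u) ^ 2 = ((3 * m : ℤ) : ℚ) := by push_cast; rw [← hm]; ring
    have h4 : ((u.den : ℤ) : ℚ) * u = u.num := by push_cast; exact Rat.den_mul_eq_num u
    rcases Nat.even_or_odd' k with ⟨j, rfl | rfl⟩
    · rw [pow_mul, h3]
      exact ⟨u.den * (3 * m) ^ j, by push_cast; ring⟩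
    · rw [pow_succ, pow_mul, h3]
      exact ⟨3 * u.num * (3 * m) ^ j, by push_cast at h4 ⊢; rw [← h4]; ring⟩
  obtain ⟨w, hw⟩ := h1
  have h2 : w ^ 2 = 3 * m := by
    have : (w : ℚ) ^ 2 = 3 * m := by rw [← hw, ← hm]; ring
    exact_mod_cast this
  obtain ⟨v, rfl⟩ : (3 : ℤ) ∣ w := Int.prime_three.dvd_of_dvd_pow ⟨m, h2⟩
  exact ⟨v, by push_cast at hw; linarith⟩

/-- The norms of z and z + 1 are integral, so the trace t is too. With u twice the √3-coordinate, t²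
- 3u² = 4n, and modulo 4 this forces t and u to be even. In other words ℤ[√3] is integrally closed,
as 3 is not 1 modulo 4. -/
theorem isInt₃_of_pow {z : F₃} {D : ℤ} (hD : D ≠ 0) (h : ∀ k : ℕ, IsInt₃ ((D : ℚ) • z ^ k)) :
    IsInt₃ z := by
  obtain ⟨n, hn⟩ := isInt_norm_of_pow hD h
  -- Expanding one factor z + 1 at a time shows that the same D serves for the powers of z + 1.
  have h1 : ∀ k j : ℕ, IsInt₃ ((D : ℚ) • ((z + 1) ^ k * z ^ j)) := by
    intro k
    induction k with
    | zero => intro j; simpa using h j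
    | succ k ih =>
      intro j
      have : (z + 1) ^ (k + 1) * z ^ j = (z + 1) ^ k * z ^ (j + 1) + (z + 1) ^ k * z ^ j := by ring
      rw [this, smul_add]
      exact (ih _).add (ih _)
  obtain ⟨n', hn'⟩ := isInt_norm_of_pow (z := z + 1) hD fun k => by simpa using h1 k 0
  simp only [QuadraticAlgebra.re_add, QuadraticAlgebra.im_add, QuadraticAlgebra.re_one,
    QuadraticAlgebra.im_one] at hn'
  obtain ⟨t, ht⟩ : ∃ t : ℤ, 2 * z.re = t := ⟨n' - n - 1, by push_cast; rw [← hn, ← hn']; ring⟩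
  obtain ⟨u, hu⟩ : IsInt (2 * z.im) := isInt_of_three_mul_sq
    ⟨t ^ 2 - 4 * n, by push_cast; rw [← hn, ← ht]; ring⟩
  have h2 : t ^ 2 - 3 * u ^ 2 = 4 * n := by
    have : (t : ℚ) ^ 2 - 3 * u ^ 2 = 4 * n := by rw [← hn, ← ht, ← hu]; ring
    exact_mod_cast this
  have ht2 := sq_emod_four t
  have hu2 := sq_emod_four u
  constructor
  · obtain ⟨s, rfl⟩ : (2 : ℤ) ∣ t := by omega
    exact ⟨s, by push_cast at ht; linarith⟩
  · obtain ⟨s, rfl⟩ : (2 : ℤ) ∣ u := by omega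
    exact ⟨s, by push_cast at hu; linarith⟩

end SquareRootThree

/-! ### The algebra (-1,-1,-3/ℚ) as quaternions over ℚ(√3), and two of its orders -/

section Quaternary

open Quaternion QuadraticAlgebra

/-- The Clifford algebra `(-1, -1, -3 / ℚ)`. -/
abbrev B₃ : Type := Alg ![-1, -1, -3]

theorem algebraMap_eq_mk (r : ℚ) : algebraMap ℚ ℍ[F₃,-1,-1] r = ⟨⟨r, 0⟩, 0, 0, 0⟩ := rfl

/-- The Clifford algebra `(-1, -1, -3 / ℚ)` as the Hamilton quaternions over `ℚ(√3)`. -/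
noncomputable def χ : B₃ →ₐ[ℚ] ℍ[F₃,-1,-1] :=
  CliffordAlgebra.lift _ ⟨
    { toFun := fun u => ⟨0, ⟨u 0, 0⟩, ⟨u 1, 0⟩, ⟨0, u 2⟩⟩
      map_add' := fun u v => by ext <;> simp
      map_smul' := fun r u => by ext <;> simp }, fun u => by
    rw [algebraMap_eq_mk]
    ext <;> simp [QuadraticMap.weightedSumSquares_apply, Fin.sum_univ_three] <;> ring⟩

theorem χ_ι (u : Fin 3 → ℚ) :
    χ (CliffordAlgebra.ι (form ![-1, -1, -3]) u) = ⟨0, ⟨u 0, 0⟩, ⟨u 1, 0⟩, ⟨0, u 2⟩⟩ := by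
  rw [χ, CliffordAlgebra.lift_ι_apply]
  rfl

theorem χ_gen_zero : χ (gen _ 0) = ⟨0, 1, 0, 0⟩ := by
  rw [gen, χ_ι]; ext <;> simp

theorem χ_gen_one : χ (gen _ 1) = ⟨0, 0, 1, 0⟩ := by
  rw [gen, χ_ι]; ext <;> simp

theorem χ_gen_two : χ (gen _ 2) = ⟨0, 0, 0, ⟨0, 1⟩⟩ := by
  rw [gen, χ_ι]; ext <;> simp

theorem χ_injective : Function.Injective χ := by
  refine injective_of_surjective (m := 3) ?_ χ fun q =>
    -- The central element -γ₁γ₂γ₃ maps to √3; multiplied by 1 and by the products of γ₁, γ₂ it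
    -- produces the √3-parts.
    ⟨q.re.re • 1 + q.imI.re • gen _ 0 + q.imJ.re • gen _ 1 + q.imK.re • (gen _ 0 * gen _ 1)
      + q.imK.im • gen _ 2 + q.re.im • (-(gen _ 0 * gen _ 1) * gen _ 2)
      + q.imI.im • (gen _ 1 * gen _ 2) + q.imJ.im • (-gen _ 0 * gen _ 2), ?_⟩
  · rw [← Module.finrank_mul_finrank ℚ F₃, QuaternionAlgebra.finrank_eq_four]
    rw [QuadraticAlgebra.finrank_eq_two]; norm_num
  · simp only [map_add, map_smul, map_mul, map_one, map_neg, χ_gen_zero, χ_gen_one, χ_gen_two]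
    ext <;> simp

theorem χ_bar (x : B₃) : χ (bar x) = star (χ x) := by
  induction x using CliffordAlgebra.induction with
  | algebraMap r =>
    rw [bar_algebraMap, AlgHom.commutes, algebraMap_eq_mk]; ext <;> simp
  | ι u => rw [bar_ι, map_neg, χ_ι]; ext <;> simp
  | mul x y hx hy => rw [bar_mul, map_mul, map_mul, hx, hy, star_mul]
  | add x y hx hy => rw [bar_add, map_add, map_add, hx, hy, star_add]

/-- The norm form of the quaternions over `ℚ(√3)`. -/
def nrm₃ (q : ℍ[F₃,-1,-1]) : F₃ := q.re ^ 2 + q.imI ^ 2 + q.imJ ^ 2 + q.imK ^ 2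

theorem nrm₃_mul (p q : ℍ[F₃,-1,-1]) : nrm₃ (p * q) = nrm₃ p * nrm₃ q := by
  simp only [nrm₃, QuaternionAlgebra.re_mul, QuaternionAlgebra.imI_mul,
    QuaternionAlgebra.imJ_mul, QuaternionAlgebra.imK_mul]
  ring

theorem nrm₃_one : nrm₃ 1 = 1 := by simp [nrm₃]

theorem nrm₃_pow (q : ℍ[F₃,-1,-1]) (k : ℕ) : nrm₃ (q ^ k) = nrm₃ q ^ k := by
  induction k with
  | zero => simp [nrm₃_one]
  | succ k ih => rw [pow_succ, nrm₃_mul, ih, pow_succ]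

/-- The quaternion over `ℚ(√3)` with the given half integral coordinates. -/
def mk₃ (a b c d e f g h : ℤ) : ℍ[F₃,-1,-1] :=
  ⟨⟨a / 2, b / 2⟩, ⟨c / 2, d / 2⟩, ⟨e / 2, f / 2⟩, ⟨g / 2, h / 2⟩⟩

theorem mk₃_inj {a b c d e f g h a' b' c' d' e' f' g' h' : ℤ}
    (H : mk₃ a b c d e f g h = mk₃ a' b' c' d' e' f' g' h') :
    a = a' ∧ b = b' ∧ c = c' ∧ d = d' ∧ e = e' ∧ f = f' ∧ g = g' ∧ h = h' := by
  simpa [mk₃, and_assoc] using H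

theorem mk₃_add (a b c d e f g h a' b' c' d' e' f' g' h' : ℤ) :
    mk₃ a b c d e f g h + mk₃ a' b' c' d' e' f' g' h' =
      mk₃ (a + a') (b + b') (c + c') (d + d') (e + e') (f + f') (g + g') (h + h') := by
  ext <;> simp [mk₃] <;> ring

theorem mk₃_neg (a b c d e f g h : ℤ) :
    -mk₃ a b c d e f g h = mk₃ (-a) (-b) (-c) (-d) (-e) (-f) (-g) (-h) := by
  ext <;> simp [mk₃] <;> ring

/-- The product of two half integral quaternions has denominator 4, so its numerators over 2 are
given by eight integral equations. This turns closure of an order under multiplication into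
polynomial identities. -/
theorem mk₃_mul {a b c d e f g h a' b' c' d' e' f' g' h' A B C D E F G H : ℤ}
    (hA : a * a' + 3 * (b * b') - (c * c' + 3 * (d * d')) - (e * e' + 3 * (f * f'))
      - (g * g' + 3 * (h * h')) = 2 * A)
    (hB : a * b' + b * a' - (c * d' + d * c') - (e * f' + f * e') - (g * h' + h * g') = 2 * B)
    (hC : a * c' + 3 * (b * d') + (c * a' + 3 * (d * b')) + (e * g' + 3 * (f * h'))
      - (g * e' + 3 * (h * f')) = 2 * C)
    (hD : a * d' + b * c' + (c * b' + d * a') + (e * h' + f * g') - (g * f' + h * e') = 2 * D)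
    (hE : a * e' + 3 * (b * f') - (c * g' + 3 * (d * h')) + (e * a' + 3 * (f * b'))
      + (g * c' + 3 * (h * d')) = 2 * E)
    (hF : a * f' + b * e' - (c * h' + d * g') + (e * b' + f * a') + (g * d' + h * c') = 2 * F)
    (hG : a * g' + 3 * (b * h') + (c * e' + 3 * (d * f')) - (e * c' + 3 * (f * d'))
      + (g * a' + 3 * (h * b')) = 2 * G)
    (hH : a * h' + b * g' + (c * f' + d * e') - (e * d' + f * c') + (g * b' + h * a') = 2 * H) :
    mk₃ a b c d e f g h * mk₃ a' b' c' d' e' f' g' h' = mk₃ A B C D E F G H := by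
  qify at hA hB hC hD hE hF hG hH
  ext <;> simp [mk₃] <;> linarith

/-- The order of the quaternions over `ℚ(√3)` that is generated over the Lipschitz quaternions by
`(1 + √3 i) / 2`. -/
def gaussOrder : Subring ℍ[F₃,-1,-1] where
  carrier := {x | ∃ a c e g p q r s : ℤ,
    x = mk₃ a (c + 2 * q) c (a + 2 * p) e (g + 2 * s) g (e + 2 * r)}
  mul_mem' := by
    rintro _ _ ⟨a, c, e, g, p, q, r, s, rfl⟩ ⟨a', c', e', g', p', q', r', s', rfl⟩
    -- The first four witnesses are the rational numerators of the product; the last four are half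
    -- the differences between its √3-numerators and the rational numerators they are congruent to.
    refine ⟨
      -a * a' - 3 * a * p' - 3 * a' * p + c * c' + 3 * c * q' + 3 * c' * q - 2 * e * e' -
        3 * e * r' - 3 * e' * r - 2 * g * g' - 3 * g * s' - 3 * g' * s - 6 * p * p' + 6 *
        q * q' - 6 * r * r' - 6 * s * s',
      2 * a * c' + 3 * a * q' + 2 * a' * c + 3 * a' * q + 3 * c * p' + 3 * c' * p - e * g'
        - 3 * e * s' + e' * g + 3 * e' * s + 3 * g * r' - 3 * g' * r + 6 * p * q' + 6 * p'
        * q - 6 * r * s' + 6 * r' * s,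
      -a * e' - 3 * a * r' + 2 * a' * e + 3 * a' * r + c * g' + 3 * c * s' + 2 * c' * g +
        3 * c' * s + 3 * e * p' - 3 * e' * p + 3 * g * q' + 3 * g' * q - 6 * p * r' + 6 *
        p' * r + 6 * q * s' + 6 * q' * s,
      2 * a * g' + 3 * a * s' - a' * g - 3 * a' * s + 2 * c * e' + 3 * c * r' + c' * e + 3
        * c' * r + 3 * e * q' + 3 * e' * q - 3 * g * p' + 3 * g' * p + 6 * p * s' - 6 * p'
        * s + 6 * q * r' + 6 * q' * r,
      a * a' + 2 * a * p' + 2 * a' * p - c * q' - c' * q + e * e' + 2 * e * r' + e' * r +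
        g * g' + g * s' + 2 * g' * s + 3 * p * p' - 3 * q * q' + 3 * r * r' + 3 * s * s',
      -a * c' - a * q' - a' * c - a' * q - 2 * c * p' - 2 * c' * p + e * s' - e' * g - 2 *
        e' * s - 2 * g * r' + g' * r - 3 * p * q' - 3 * p' * q + 3 * r * s' - 3 * r' * s,
      a * e' + 2 * a * r' - a' * e - a' * r - c * s' - c' * g - 2 * c' * s - 2 * e * p' +
        2 * e' * p - g * q' - g' * q + 3 * p * r' - 3 * p' * r - 3 * q * s' - 3 * q' * s,
      -a * g' - a * s' + a' * g + 2 * a' * s - c * e' - 2 * c * r' - c' * r - e * q' - e'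
        * q + 2 * g * p' - 2 * g' * p - 3 * p * s' + 3 * p' * s - 3 * q * r' - 3 * q' * r, ?_⟩
    refine mk₃_mul ?_ ?_ ?_ ?_ ?_ ?_ ?_ ?_ <;> ring
  one_mem' := ⟨2, 0, 0, 0, -1, 0, 0, 0, by ext <;> simp [mk₃]⟩
  add_mem' := by
    rintro _ _ ⟨a, c, e, g, p, q, r, s, rfl⟩ ⟨a', c', e', g', p', q', r', s', rfl⟩
    exact ⟨a + a', c + c', e + e', g + g', p + p', q + q', r + r', s + s', by
      rw [mk₃_add]; congr 1 <;> ring⟩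
  zero_mem' := ⟨0, 0, 0, 0, 0, 0, 0, 0, by ext <;> simp [mk₃]⟩
  neg_mem' := by
    rintro _ ⟨a, c, e, g, p, q, r, s, rfl⟩
    exact ⟨-a, -c, -e, -g, -p, -q, -r, -s, by rw [mk₃_neg]; congr 1 <;> ring⟩

/-- The order of the quaternions over `ℚ(√3)` that contains the Hurwitz quaternions and
`(1 + √3) (1 + i) / 2`. -/
def hurwitzOrder₃ : Subring ℍ[F₃,-1,-1] where
  carrier := {x | ∃ a c e m n p q r : ℤ,
    x = mk₃ a (a + n) c (c + n + 2 * p) e (e + n + 2 * q) (a + c + e + 2 * m)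
      (a + c + e + 2 * m + n + 2 * r)}
  mul_mem' := by
    rintro _ _ ⟨a, c, e, m, n, p, q, r, rfl⟩ ⟨a', c', e', m', n', p', q', r', rfl⟩
    -- The witnesses are solved from the product's numerators: a, c, e are read off, n is the
    -- difference of the two real numerators, and m, p, q, r are the halves left over in the
    -- remaining congruences.
    refine ⟨
      -2 * a * c' - 2 * a * e' - 4 * a * m' - 3 * a * r' - 2 * a' * c - 2 * a' * e - 4 *
        a' * m - 3 * a' * r - 4 * c * c' - 2 * c * e' - 4 * c * m' - 3 * c * n' - 3 * c *
        p' - 3 * c * r' - 2 * c' * e - 4 * c' * m - 3 * c' * n - 3 * c' * p - 3 * c' * r -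
        4 * e * e' - 4 * e * m' - 3 * e * n' - 3 * e * q' - 3 * e * r' - 4 * e' * m - 3 *
        e' * n - 3 * e' * q - 3 * e' * r - 8 * m * m' - 3 * m * n' - 6 * m * r' - 3 * m' *
        n - 6 * m' * r - 3 * n * n' - 3 * n * p' - 3 * n * q' - 3 * n * r' - 3 * n' * p -
        3 * n' * q - 3 * n' * r - 6 * p * p' - 6 * q * q' - 6 * r * r',
      2 * a * c' - 2 * a * e' + 3 * a * p' - 3 * a * q' + 2 * a' * c + 2 * a' * e + 3 * a'
        * n + 3 * a' * p + 3 * a' * q - 2 * c * e' - 3 * c * q' + 2 * c' * e + 3 * c' * n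
        + 3 * c' * q + 4 * e * m' - 3 * e * q' + 3 * e * r' - 4 * e' * m + 3 * e' * q - 3
        * e' * r - 3 * m * n' - 6 * m * q' + 3 * m' * n + 6 * m' * q + 3 * n * n' + 3 * n
        * p' - 3 * n * q' + 3 * n * r' + 3 * n' * p + 3 * n' * q - 3 * n' * r + 6 * q * r'
        - 6 * q' * r,
      2 * a * c' + 2 * a * e' + 3 * a * n' + 3 * a * p' + 3 * a * q' - 2 * a' * c + 2 * a'
        * e - 3 * a' * p + 3 * a' * q - 2 * c * e' - 4 * c * m' + 3 * c * p' - 3 * c * r'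
        + 2 * c' * e + 4 * c' * m - 3 * c' * p + 3 * c' * r + 3 * e * n' + 3 * e * p' - 3
        * e' * p + 3 * m * n' + 6 * m * p' - 3 * m' * n - 6 * m' * p + 3 * n * n' + 3 * n
        * p' + 3 * n * q' - 3 * n * r' - 3 * n' * p + 3 * n' * q + 3 * n' * r - 6 * p * r'
        + 6 * p' * r,
      2 * a * a' + 2 * a * e' + 4 * a * m' - 3 * a * p' + 3 * a * r' + 2 * a' * c + 4 * a'
        * m - 3 * a' * q + 3 * a' * r + 2 * c * c' + 4 * c * e' + 4 * c * m' + 3 * c * n'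
        + 3 * c * q' + 3 * c * r' - 2 * c' * e + 3 * c' * p - 3 * c' * q + 2 * e * e' - 3
        * e * p' + 3 * e * q' + 4 * e' * m + 3 * e' * n + 3 * e' * p + 3 * e' * r + 4 * m
        * m' + 3 * m * n' - 3 * m * p' + 3 * m * q' + 3 * m * r' + 3 * m' * n + 3 * m' * p
        - 3 * m' * q + 3 * m' * r - 3 * n * p' + 3 * n * q' + 3 * n * r' + 3 * n' * p - 3
        * n' * q + 3 * n' * r + 3 * p * p' + 3 * p * q' + 3 * p * r' - 3 * p' * q - 3 * p'
        * r + 3 * q * q' - 3 * q * r' + 3 * q' * r + 3 * r * r',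
      a * c' + a * e' + 2 * a * m' + 2 * a * r' + a' * c + a' * e + 2 * a' * m + 2 * a' *
        r + 2 * c * c' + c * e' + 2 * c * m' + 2 * c * n' + 2 * c * p' + 2 * c * r' + c' *
        e + 2 * c' * m + 2 * c' * n + 2 * c' * p + 2 * c' * r + 2 * e * e' + 2 * e * m' +
        2 * e * n' + 2 * e * q' + 2 * e * r' + 2 * e' * m + 2 * e' * n + 2 * e' * q + 2 *
        e' * r + 4 * m * m' + 2 * m * n' + 4 * m * r' + 2 * m' * n + 4 * m' * r + 3 * n *
        n' + 3 * n * p' + 3 * n * q' + 3 * n * r' + 3 * n' * p + 3 * n' * q + 3 * n' * r +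
        6 * p * p' + 6 * q * q' + 6 * r * r',
      -a * c' - a * m' - a * p' + a * q' - a * r' - a' * c - a' * e - a' * m - a' * n - a'
        * p - a' * q - a' * r - c * c' - c * m' - c * n' - c * p' + c * q' - c * r' - c' *
        e - c' * m - 2 * c' * n - c' * p - c' * q - c' * r - e * e' - 2 * e * m' - e * n'
        - 2 * e * r' - e' * n - 2 * e' * q - 2 * m * m' + 2 * m * q' - 2 * m * r' - 2 * m'
        * n - 2 * m' * q - 2 * m' * r - 3 * n * n' - 3 * n * p' - 3 * n * r' - 3 * n' * p
        - 3 * n' * q - 3 * p * p' - 3 * q * q' - 3 * q * r' + 3 * q' * r - 3 * r * r',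
      -a * c' - a * e' - a * m' - a * n' - a * p' - a * q' - a * r' - a' * e - a' * m + a'
        * p - a' * q - a' * r - c * c' - c * n' - 2 * c * p' - c' * e - 2 * c' * m - c' *
        n - 2 * c' * r - e * e' - e * m' - 2 * e * n' - e * p' - e * q' - e * r' - e' * m
        - e' * n + e' * p - e' * q - e' * r - 2 * m * m' - 2 * m * n' - 2 * m * p' - 2 * m
        * r' + 2 * m' * p - 2 * m' * r - 3 * n * n' - 3 * n * p' - 3 * n * q' - 3 * n' * q
        - 3 * n' * r - 3 * p * p' + 3 * p * r' - 3 * p' * r - 3 * q * q' - 3 * r * r',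
      -a * a' - a * c' - a * e' - 2 * a * m' - a * n' - 2 * a * r' - a' * c - a' * e - 2 *
        a' * m - a' * n - 2 * a' * r - c * c' - c * e' - c * m' - 2 * c * n' - c * p' - c
        * q' - c * r' - c' * m - c' * n - c' * p + c' * q - c' * r - e * e' - e * m' - e *
        n' + e * p' - e * q' - e * r' - e' * m - 2 * e' * n - e' * p - e' * q - e' * r - 2
        * m * m' - 2 * m * n' - 2 * m * r' - 2 * m' * n - 2 * m' * r - 3 * n * n' - 3 * n
        * q' - 3 * n * r' - 3 * n' * p - 3 * n' * r - 3 * p * p' - 3 * p * q' + 3 * p' * q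
        - 3 * q * q' - 3 * r * r', ?_⟩
    refine mk₃_mul ?_ ?_ ?_ ?_ ?_ ?_ ?_ ?_ <;> ring
  one_mem' := ⟨2, 0, 0, -1, -2, 1, 1, 1, by ext <;> simp [mk₃]⟩
  add_mem' := by
    rintro _ _ ⟨a, c, e, m, n, p, q, r, rfl⟩ ⟨a', c', e', m', n', p', q', r', rfl⟩
    exact ⟨a + a', c + c', e + e', m + m', n + n', p + p', q + q', r + r', by
      rw [mk₃_add]; congr 1 <;> ring⟩
  zero_mem' := ⟨0, 0, 0, 0, 0, 0, 0, 0, by ext <;> simp [mk₃]⟩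
  neg_mem' := by
    rintro _ ⟨a, c, e, m, n, p, q, r, rfl⟩
    exact ⟨-a, -c, -e, -m, -n, -p, -q, -r, by rw [mk₃_neg]; congr 1 <;> ring⟩

theorem intCast_eq_of_dvd {x y : ℤ} : (x : ZMod 2) = y ↔ ∃ p, x = y + 2 * p := by
  rw [eq_comm, ZMod.intCast_eq_intCast_iff_dvd_sub]
  exact exists_congr fun p => by push_cast; constructor <;> intro h <;> linarith

theorem mem_gaussOrder {a b c d e f g h : ℤ} : mk₃ a b c d e f g h ∈ gaussOrder ↔
    (d : ZMod 2) = a ∧ (b : ZMod 2) = c ∧ (h : ZMod 2) = e ∧ (f : ZMod 2) = g := by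
  simp only [intCast_eq_of_dvd]
  constructor
  · rintro ⟨a', c', e', g', p, q, r, s, H⟩
    obtain ⟨rfl, rfl, rfl, rfl, rfl, rfl, rfl, rfl⟩ := mk₃_inj H
    exact ⟨⟨p, rfl⟩, ⟨q, rfl⟩, ⟨r, rfl⟩, ⟨s, rfl⟩⟩
  · rintro ⟨⟨p, rfl⟩, ⟨q, rfl⟩, ⟨r, rfl⟩, ⟨s, rfl⟩⟩
    exact ⟨_, _, _, _, _, _, _, _, rfl⟩

theorem mem_hurwitzOrder₃ {a b c d e f g h : ℤ} : mk₃ a b c d e f g h ∈ hurwitzOrder₃ ↔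
    (g : ZMod 2) = (a + c + e : ℤ) ∧ (d : ZMod 2) = (c + (b - a) : ℤ) ∧
      (f : ZMod 2) = (e + (b - a) : ℤ) ∧ (h : ZMod 2) = (g + (b - a) : ℤ) := by
  simp only [intCast_eq_of_dvd]
  constructor
  · rintro ⟨a', c', e', m, n, p, q, r, H⟩
    obtain ⟨rfl, rfl, rfl, rfl, rfl, rfl, rfl, rfl⟩ := mk₃_inj H
    exact ⟨⟨m, rfl⟩, ⟨p, by ring⟩, ⟨q, by ring⟩, ⟨r, by ring⟩⟩
  · rintro ⟨⟨m, rfl⟩, ⟨p, rfl⟩, ⟨q, rfl⟩, ⟨r, rfl⟩⟩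
    refine ⟨a, c, e, m, b - a, p, q, r, ?_⟩
    congr 1
    ring

/-- The coordinates of a quaternion over `ℚ(√3)`. -/
def coord₃ : Fin 8 → ℍ[F₃,-1,-1] →ₗ[ℚ] ℚ :=
  ![⟨⟨fun q => q.re.re, fun _ _ => rfl⟩, fun _ _ => rfl⟩,
    ⟨⟨fun q => q.re.im, fun _ _ => rfl⟩, fun _ _ => rfl⟩,
    ⟨⟨fun q => q.imI.re, fun _ _ => rfl⟩, fun _ _ => rfl⟩,
    ⟨⟨fun q => q.imI.im, fun _ _ => rfl⟩, fun _ _ => rfl⟩,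
    ⟨⟨fun q => q.imJ.re, fun _ _ => rfl⟩, fun _ _ => rfl⟩,
    ⟨⟨fun q => q.imJ.im, fun _ _ => rfl⟩, fun _ _ => rfl⟩,
    ⟨⟨fun q => q.imK.re, fun _ _ => rfl⟩, fun _ _ => rfl⟩,
    ⟨⟨fun q => q.imK.im, fun _ _ => rfl⟩, fun _ _ => rfl⟩]

theorem isOrder_of_half {O : Subring B₃} (hΓ : cliffordOrder ![-1, -1, -3] ≤ O)
    (hO : ∀ x ∈ O, ∃ a b c d e f g h : ℤ, χ x = mk₃ a b c d e f g h) : IsOrder O := by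
  refine isOrder_of_fg (fg_of_den (fun i => (coord₃ i).comp χ.toLinearMap) (fun x hx => ?_)
    two_ne_zero (fun x hx => ?_)) hΓ
  · refine χ_injective ?_
    rw [map_zero]
    ext
    exacts [hx 0, hx 1, hx 2, hx 3, hx 4, hx 5, hx 6, hx 7]
  · obtain ⟨a, b, c, d, e, f, g, h, H⟩ := hO x hx
    have key : ∀ (q : ℚ) (z : ℤ), q = z / 2 → IsInt ((2 : ℤ) * q) := fun q z hq =>
      ⟨z, by rw [hq]; push_cast; ring⟩
    intro i
    refine key _ (![a, b, c, d, e, f, g, h] i) ?_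
    change coord₃ i (χ x) = _
    rw [H]
    fin_cases i <;> rfl

/-- The norm takes values in ℚ(√3), is multiplicative and is quadratic in the coordinates, so its
powers have D² as a common denominator. -/
theorem nrm₃_of_isOrder {O : Subring B₃} (hO : IsOrder O) {x : B₃} (hx : x ∈ O) :
    IsInt₃ (nrm₃ (χ x)) := by
  obtain ⟨D, hD, h⟩ := exists_den_family hO.1 (fun i => (coord₃ i).comp χ.toLinearMap)
  refine isInt₃_of_pow (D := D * D) (mul_ne_zero hD hD) fun k => ?_
  have h' := h (x ^ k) (O.pow_mem hx k)
  rw [← nrm₃_pow, ← map_pow]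
  generalize x ^ k = y at h'
  have key : ∀ z : F₃, IsInt (D * z.re) → IsInt (D * z.im) → IsInt₃ (((D * D : ℤ) : ℚ) • z ^ 2) := by
    intro z h1 h2
    have h3 : IsInt₃ ((D : ℚ) • z) := ⟨h1, h2⟩
    convert h3.mul h3 using 1
    rw [smul_mul_smul_comm, pow_two, Int.cast_mul]
  simp only [nrm₃, smul_add]
  exact (((key _ (h' 0) (h' 1)).add (key _ (h' 2) (h' 3))).add (key _ (h' 4) (h' 5))).add
    (key _ (h' 6) (h' 7))

end Quaternary

/-! ### Maximal orders and conjugacy classes in (-1,-1,-3/ℚ) -/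

section Quaternary

open Quaternion QuadraticAlgebra

/-- Polarizing the norm against 1, i, j, ij gives twice the coordinates, which therefore lie in
ℤ[√3]. -/
theorem exists_half₃ {O : Subring B₃} (hO : IsOrder O) (hΓ : cliffordOrder ![-1, -1, -3] ≤ O)
    {x : B₃} (hx : x ∈ O) : ∃ a b c d e f g h : ℤ, χ x = mk₃ a b c d e f g h := by
  have g0 := cliffordOrder_le_iff.1 hΓ 0
  have g1 := cliffordOrder_le_iff.1 hΓ 1
  have key : ∀ y ∈ O, IsInt₃ (nrm₃ (χ x + χ y) - nrm₃ (χ x) - nrm₃ (χ y)) := fun y hy => by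
    rw [← map_add]
    exact ((nrm₃_of_isOrder hO (O.add_mem hx hy)).sub (nrm₃_of_isOrder hO hx)).sub
      (nrm₃_of_isOrder hO hy)
  have h0 := key _ O.one_mem
  have h1 := key _ g0
  have h2 := key _ g1
  have h3 := key _ (O.mul_mem g0 g1)
  rw [map_one] at h0
  rw [χ_gen_zero] at h1
  rw [χ_gen_one] at h2
  rw [map_mul, χ_gen_zero, χ_gen_one] at h3
  generalize χ x = q at *
  have e0 : nrm₃ (q + 1) - nrm₃ q - nrm₃ 1 = 2 * q.re := by simp [nrm₃]; ring
  have e1 : nrm₃ (q + ⟨0, 1, 0, 0⟩) - nrm₃ q - nrm₃ ⟨0, 1, 0, 0⟩ = 2 * q.imI := by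
    simp [nrm₃]; ring
  have e2 : nrm₃ (q + ⟨0, 0, 1, 0⟩) - nrm₃ q - nrm₃ ⟨0, 0, 1, 0⟩ = 2 * q.imJ := by
    simp [nrm₃]; ring
  have e3 : nrm₃ (q + ⟨0, 1, 0, 0⟩ * ⟨0, 0, 1, 0⟩) - nrm₃ q - nrm₃ (⟨0, 1, 0, 0⟩ * ⟨0, 0, 1, 0⟩)
      = 2 * q.imK := by
    simp [nrm₃]; ring
  rw [e0] at h0
  rw [e1] at h1
  rw [e2] at h2
  rw [e3] at h3
  obtain ⟨⟨a, ha⟩, ⟨b, hb⟩⟩ := h0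
  obtain ⟨⟨c, hc⟩, ⟨d, hd⟩⟩ := h1
  obtain ⟨⟨e, he⟩, ⟨f, hf⟩⟩ := h2
  obtain ⟨⟨g, hg⟩, ⟨h, hh⟩⟩ := h3
  refine ⟨a, b, c, d, e, f, g, h, ?_⟩
  simp at ha hb hc hd he hf hg hh
  ext <;> simp only [mk₃] <;> linarith

theorem nrm₃_mk₃ (a b c d e f g h : ℤ) : nrm₃ (mk₃ a b c d e f g h) =
    ⟨((a ^ 2 + c ^ 2 + e ^ 2 + g ^ 2 + 3 * (b ^ 2 + d ^ 2 + f ^ 2 + h ^ 2) : ℤ) : ℚ) / 4,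
      ((a * b + c * d + e * f + g * h : ℤ) : ℚ) / 2⟩ := by
  ext <;> simp [nrm₃, mk₃, pow_two] <;> ring

theorem parity_of_isOrder {O : Subring B₃} (hO : IsOrder O) {x : B₃} (hx : x ∈ O)
    {a b c d e f g h : ℤ} (H : χ x = mk₃ a b c d e f g h) :
    (a ^ 2 + c ^ 2 + e ^ 2 + g ^ 2 + 3 * (b ^ 2 + d ^ 2 + f ^ 2 + h ^ 2)) % 4 = 0 ∧
      ((a * b + c * d + e * f + g * h : ℤ) : ZMod 2) = 0 := by
  have h1 := nrm₃_of_isOrder hO hx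
  rw [H, nrm₃_mk₃] at h1
  obtain ⟨⟨m, hm⟩, ⟨n, hn⟩⟩ := h1
  simp only at hm hn
  rw [div_eq_iff (by norm_num)] at hm hn
  norm_cast at hm hn
  refine ⟨by rw [hm]; exact Int.mul_emod_left _ _, ?_⟩
  rw [hn]
  push_cast
  exact (mul_eq_zero_of_right _ (by decide))

/-- This is the rational part of the polarized norm. The coefficient 3 of the √3-parts becomes 1
modulo 2. -/
theorem polar_parity {O : Subring B₃} (hO : IsOrder O) {x y : B₃} (hx : x ∈ O) (hy : y ∈ O)
    {a b c d e f g h a' b' c' d' e' f' g' h' : ℤ} (H : χ x = mk₃ a b c d e f g h)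
    (H' : χ y = mk₃ a' b' c' d' e' f' g' h') :
    (a * a' + b * b' + c * c' + d * d' + e * e' + f * f' + g * g' + h * h' : ZMod 2) = 0 := by
  have h1 := (parity_of_isOrder hO hx H).1
  have h2 := (parity_of_isOrder hO hy H').1
  have h3 := (parity_of_isOrder hO (O.add_mem hx hy) (by rw [map_add, H, H', mk₃_add])).1
  have h4 : ∃ m : ℤ, a * a' + b * b' + c * c' + d * d' + e * e' + f * f' + g * g' + h * h' =
      2 * m := by
    obtain ⟨m1, h1⟩ := Int.dvd_of_emod_eq_zero h1
    obtain ⟨m2, h2⟩ := Int.dvd_of_emod_eq_zero h2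
    obtain ⟨m3, h3⟩ := Int.dvd_of_emod_eq_zero h3
    exact ⟨m3 - m1 - m2 - (b * b' + d * d' + f * f' + h * h'), by linarith⟩
  obtain ⟨m, hm⟩ := h4
  have h5 := congrArg (Int.cast : ℤ → ZMod 2) hm
  push_cast at h5
  rw [h5]
  exact (mul_eq_zero_of_left (by decide) _)

/-- The possible residues of the numerators of an integral norm: either the pattern of `GH`, or a
pattern of `GI`, `GJ` or `GK` whose rational part has odd weight. -/
theorem parity_classes : ∀ a b c d e f g h : ZMod 2,
    (a.val + c.val + e.val + g.val + 3 * (b.val + d.val + f.val + h.val)) % 4 = 0 →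
    a * b + c * d + e * f + g * h = 0 →
    (g = a + c + e ∧ d = c + (b - a) ∧ f = e + (b - a) ∧ h = g + (b - a)) ∨
      a + c + e + g = 1 ∧ (d = a ∧ b = c ∧ h = e ∧ f = g ∨ f = a ∧ b = e ∧ h = c ∧ d = g ∨
        h = a ∧ b = g ∧ d = e ∧ f = c) := by
  decide

/-- The equations say that a product vanishes in the group algebra over 𝔽₂ of the Klein four-group.
An element of augmentation 1 has square 1 there, so it is a unit and the other factor is 0. -/
theorem convolution_injective : ∀ a b c d w x y z : ZMod 2, a + b + c + d = 1 →
    a * w + b * x + c * y + d * z = 0 → a * x + b * w + c * z + d * y = 0 →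
    a * y + b * z + c * w + d * x = 0 → a * z + b * y + c * x + d * w = 0 →
    w = 0 ∧ x = 0 ∧ y = 0 ∧ z = 0 := by
  decide

theorem parity_classes_of_isOrder {O : Subring B₃} (hO : IsOrder O) {x : B₃} (hx : x ∈ O)
    {a b c d e f g h : ℤ} (H : χ x = mk₃ a b c d e f g h) :
    ((g : ZMod 2) = a + c + e ∧ (d : ZMod 2) = c + (b - a) ∧ (f : ZMod 2) = e + (b - a) ∧
      (h : ZMod 2) = g + (b - a)) ∨
      (a + c + e + g : ZMod 2) = 1 ∧ ((d : ZMod 2) = a ∧ (b : ZMod 2) = c ∧ (h : ZMod 2) = e ∧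
        (f : ZMod 2) = g ∨ (f : ZMod 2) = a ∧ (b : ZMod 2) = e ∧ (h : ZMod 2) = c ∧
        (d : ZMod 2) = g ∨ (h : ZMod 2) = a ∧ (b : ZMod 2) = g ∧ (d : ZMod 2) = e ∧
        (f : ZMod 2) = c) := by
  obtain ⟨h1, h2⟩ := parity_of_isOrder hO hx H
  refine parity_classes _ _ _ _ _ _ _ _ ?_ (by exact_mod_cast h2)
  have key : ∀ z : ℤ, (((z : ZMod 2).val : ℕ) : ℤ) = z % 2 := fun z => by
    rw [ZMod.val_intCast]; rfl
  zify
  simp only [key]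
  have := sq_emod_four a
  have := sq_emod_four b
  have := sq_emod_four c
  have := sq_emod_four d
  have := sq_emod_four e
  have := sq_emod_four f
  have := sq_emod_four g
  have := sq_emod_four h
  omega

/-- The element x is paired with y, iy, jy and ijy. Signs vanish modulo 2, so the four pairings are
the coefficients of a convolution over the Klein four-group. -/
theorem polar_parities {O : Subring B₃} (hO : IsOrder O) (hΓ : cliffordOrder ![-1, -1, -3] ≤ O)
    {x y : B₃} (hx : x ∈ O) (hy : y ∈ O)
    {a b c d e f g h a' b' c' d' e' f' g' h' : ℤ} (H : χ x = mk₃ a b c d e f g h)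
    (H' : χ y = mk₃ a' b' c' d' e' f' g' h') :
    (a * a' + b * b' + c * c' + d * d' + e * e' + f * f' + g * g' + h * h' : ZMod 2) = 0 ∧
    (a * c' + b * d' + c * a' + d * b' + e * g' + f * h' + g * e' + h * f' : ZMod 2) = 0 ∧
    (a * e' + b * f' + c * g' + d * h' + e * a' + f * b' + g * c' + h * d' : ZMod 2) = 0 ∧
    (a * g' + b * h' + c * e' + d * f' + e * c' + f * d' + g * a' + h * b' : ZMod 2) = 0 := by
  have g0 := cliffordOrder_le_iff.1 hΓ 0
  have g1 := cliffordOrder_le_iff.1 hΓ 1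
  have h1 : χ (gen _ 0 * y) = mk₃ (-c') (-d') a' b' (-g') (-h') e' f' := by
    rw [map_mul, H', χ_gen_zero]
    ext <;> simp [mk₃] <;> ring
  have h2 : χ (gen _ 1 * y) = mk₃ (-e') (-f') g' h' a' b' (-c') (-d') := by
    rw [map_mul, H', χ_gen_one]
    ext <;> simp [mk₃] <;> ring
  have h3 : χ (gen _ 0 * gen _ 1 * y) = mk₃ (-g') (-h') (-e') (-f') c' d' a' b' := by
    rw [map_mul, map_mul, H', χ_gen_zero, χ_gen_one]
    ext <;> simp [mk₃] <;> ring
  have p1 := polar_parity hO hx (O.mul_mem g0 hy) H h1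
  have p2 := polar_parity hO hx (O.mul_mem g1 hy) H h2
  have p3 := polar_parity hO hx (O.mul_mem (O.mul_mem g0 g1) hy) H h3
  simp only [Int.cast_neg, CharTwo.neg_eq] at p1 p2 p3
  exact ⟨polar_parity hO hx hy H H', p1, p2, p3⟩

theorem add_eq_zero_two : ∀ {x y : ZMod 2}, x + y = 0 → y = x := by decide

theorem exists_unit₃_I : ∃ u : B₃ˣ, (u : B₃) = 1 + gen _ 1 :=
  exists_unit_of_mul_bar (q := 2) (χ_injective (by
    rw [map_mul, χ_bar, map_add, map_one, χ_gen_one, AlgHom.commutes, algebraMap_eq_mk]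
    ext <;> simp
    norm_num)) (by norm_num)

theorem exists_unit₃_J : ∃ u : B₃ˣ, (u : B₃) = 1 + gen _ 0 * gen _ 1 :=
  exists_unit_of_mul_bar (q := 2) (χ_injective (by
    rw [map_mul, χ_bar, map_add, map_one, map_mul, χ_gen_zero, χ_gen_one, AlgHom.commutes,
      algebraMap_eq_mk]
    ext <;> simp
    norm_num)) (by norm_num)

/-- The unit `1 + γ₂` of `(-1, -1, -3 / ℚ)`. -/
noncomputable def uK : B₃ˣ := exists_unit₃_I.choose

theorem val_uK : (uK : B₃) = 1 + gen _ 1 := exists_unit₃_I.choose_spec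

/-- The unit `1 + γ₁ γ₂` of `(-1, -1, -3 / ℚ)`. -/
noncomputable def uJ : B₃ˣ := exists_unit₃_J.choose

theorem val_uJ : (uJ : B₃) = 1 + gen _ 0 * gen _ 1 := exists_unit₃_J.choose_spec

theorem uK_mem : (uK : B₃) ∈ cliffordMonoid ![-1, -1, -3] := by
  rw [val_uK]
  exact mem_cliffordMonoid_of_mem_vec (add_mem one_mem_vec (gen_mem_vec 1))

theorem uJ_mem : (uJ : B₃) ∈ cliffordMonoid ![-1, -1, -3] := by
  have : (uJ : B₃) = gen _ 0 * (gen _ 1 - gen _ 0) := by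
    refine χ_injective ?_
    rw [val_uJ, map_add, map_mul, map_mul, map_sub, map_one, χ_gen_zero, χ_gen_one]
    ext <;> simp
  rw [this]
  exact cliffordMonoid_mul (mem_cliffordMonoid_of_mem_vec (gen_mem_vec 0))
    (mem_cliffordMonoid_of_mem_vec (sub_mem (gen_mem_vec 1) (gen_mem_vec 0)))

theorem χ_conj_uK (x : B₃) : χ (uK * x * (↑uK⁻¹ : B₃)) =
    ⟨(χ x).re, (χ x).imK, (χ x).imJ, -(χ x).imI⟩ := by
  have h1 : (↑uK⁻¹ : B₃) = (1 / 2 : ℚ) • (1 - gen _ 1) := by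
    refine Units.inv_eq_of_mul_eq_one_right (χ_injective ?_)
    rw [val_uK, map_mul, map_smul, map_add, map_sub, χ_gen_one, map_one]
    ext <;> simp
    norm_num
  rw [h1, val_uK, map_mul, map_mul, map_smul, map_add, map_sub, χ_gen_one, map_one]
  ext <;> simp <;> ring

theorem χ_conj_uJ (x : B₃) : χ (uJ * x * (↑uJ⁻¹ : B₃)) =
    ⟨(χ x).re, -(χ x).imJ, (χ x).imI, (χ x).imK⟩ := by
  have h1 : (↑uJ⁻¹ : B₃) = (1 / 2 : ℚ) • (1 - gen _ 0 * gen _ 1) := by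
    refine Units.inv_eq_of_mul_eq_one_right (χ_injective ?_)
    rw [val_uJ, map_mul, map_smul, map_add, map_sub, map_mul, χ_gen_zero, χ_gen_one, map_one]
    ext <;> simp
    norm_num
  rw [h1, val_uJ, map_mul, map_mul, map_smul, map_add, map_sub, map_mul, χ_gen_zero, χ_gen_one,
    map_one]
  ext <;> simp <;> ring

/-- The maximal order of `(-1, -1, -3 / ℚ)` that contains `(1 + γ₂ γ₃) / 2`. -/
noncomputable def GI : Subring B₃ := gaussOrder.comap (χ : B₃ →+* ℍ[F₃,-1,-1])

/-- The maximal order of `(-1, -1, -3 / ℚ)` that contains `(1 + γ₁ γ₃) / 2`. -/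
noncomputable def GJ : Subring B₃ := conjOrder uJ GI

/-- The maximal order of `(-1, -1, -3 / ℚ)` that contains `(1 + γ₃) / 2`. -/
noncomputable def GK : Subring B₃ := conjOrder uK GI

/-- The maximal order of `(-1, -1, -3 / ℚ)` that contains `(1 + γ₁ + γ₂ + γ₁ γ₂) / 2` and
is a free module over `ℤ[√3]`. -/
noncomputable def GH : Subring B₃ := hurwitzOrder₃.comap (χ : B₃ →+* ℍ[F₃,-1,-1])

theorem mem_GI {x : B₃} {a b c d e f g h : ℤ} (H : χ x = mk₃ a b c d e f g h) :
    x ∈ GI ↔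
    (d : ZMod 2) = a ∧ (b : ZMod 2) = c ∧ (h : ZMod 2) = e ∧ (f : ZMod 2) = g := by
  rw [← mem_gaussOrder, ← H]
  rfl

theorem mem_GJ {x : B₃} {a b c d e f g h : ℤ} (H : χ x = mk₃ a b c d e f g h) :
    x ∈ GJ ↔
    (f : ZMod 2) = a ∧ (b : ZMod 2) = e ∧ (h : ZMod 2) = c ∧ (d : ZMod 2) = g := by
  have h1 : χ (uJ * x * (↑uJ⁻¹ : B₃)) = mk₃ a b (-e) (-f) c d g h := by
    rw [χ_conj_uJ, H]
    ext <;> simp [mk₃] <;> ring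
  rw [GJ, mem_conjOrder, mem_GI h1, Int.cast_neg, Int.cast_neg, CharTwo.neg_eq, CharTwo.neg_eq]

theorem mem_GK {x : B₃} {a b c d e f g h : ℤ} (H : χ x = mk₃ a b c d e f g h) :
    x ∈ GK ↔
    (h : ZMod 2) = a ∧ (b : ZMod 2) = g ∧ (d : ZMod 2) = e ∧ (f : ZMod 2) = c := by
  have h1 : χ (uK * x * (↑uK⁻¹ : B₃)) = mk₃ a b g h e f (-c) (-d) := by
    rw [χ_conj_uK, H]
    ext <;> simp [mk₃] <;> ring
  rw [GK, mem_conjOrder, mem_GI h1, Int.cast_neg, Int.cast_neg, CharTwo.neg_eq, CharTwo.neg_eq]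

theorem mem_GH {x : B₃} {a b c d e f g h : ℤ} (H : χ x = mk₃ a b c d e f g h) :
    x ∈ GH ↔ (g : ZMod 2) = a + c + e ∧ (d : ZMod 2) = c + (b - a) ∧
    (f : ZMod 2) = e + (b - a) ∧ (h : ZMod 2) = g + (b - a) := by
  have := mem_hurwitzOrder₃ (a := a) (b := b) (c := c) (d := d) (e := e) (f := f) (g := g) (h := h)
  push_cast at this
  rw [← this, ← H]
  rfl

/-- An x outside `GH` has a `GI`, `GJ` or `GK` pattern with rational part of odd weight. Under that
pattern the pairings of x with any y combine to the convolution of this rational part with the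
defects of y from the same pattern. The rational part is a unit, so the defects vanish and y lies in
the same order. -/
theorem le_cases {O : Subring B₃} (hO : IsOrder O) (hΓ : cliffordOrder ![-1, -1, -3] ≤ O) :
    O ≤ GI ∨ O ≤ GJ ∨ O ≤ GK ∨ O ≤ GH := by
  by_cases hH : O ≤ GH
  · exact .inr (.inr (.inr hH))
  obtain ⟨x, hx, hx'⟩ := SetLike.not_le_iff_exists.1 hH
  obtain ⟨a, b, c, d, e, f, g, h, H⟩ := exists_half₃ hO hΓ hx
  rw [mem_GH H] at hx'
  obtain ⟨h1, h2⟩ := (parity_classes_of_isOrder hO hx H).resolve_left hx'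
  rcases h2 with ⟨rd, rb, rh, rf⟩ | ⟨rf, rb, rh, rd⟩ | ⟨rh, rb, rd, rf⟩
  · left
    intro y hy
    obtain ⟨a', b', c', d', e', f', g', h', H'⟩ := exists_half₃ hO hΓ hy
    obtain ⟨p0, p1, p2, p3⟩ := polar_parities hO hΓ hx hy H H'
    rw [rd, rb, rh, rf] at p0 p1 p2 p3
    obtain ⟨q0, q1, q2, q3⟩ := convolution_injective a c e g (a' + d') (c' + b') (e' + h')
      (g' + f') h1 (by rw [← p0]; ring) (by rw [← p1]; ring) (by rw [← p2]; ring)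
      (by rw [← p3]; ring)
    exact (mem_GI H').2 ⟨add_eq_zero_two q0, add_eq_zero_two q1, add_eq_zero_two q2,
      add_eq_zero_two q3⟩
  · right; left
    intro y hy
    obtain ⟨a', b', c', d', e', f', g', h', H'⟩ := exists_half₃ hO hΓ hy
    obtain ⟨p0, p1, p2, p3⟩ := polar_parities hO hΓ hx hy H H'
    rw [rd, rb, rh, rf] at p0 p1 p2 p3
    obtain ⟨q0, q1, q2, q3⟩ := convolution_injective a c e g (a' + f') (c' + h') (e' + b')
      (g' + d') h1 (by rw [← p0]; ring) (by rw [← p1]; ring) (by rw [← p2]; ring)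
      (by rw [← p3]; ring)
    exact (mem_GJ H').2 ⟨add_eq_zero_two q0, add_eq_zero_two q2, add_eq_zero_two q1,
      add_eq_zero_two q3⟩
  · right; right; left
    intro y hy
    obtain ⟨a', b', c', d', e', f', g', h', H'⟩ := exists_half₃ hO hΓ hy
    obtain ⟨p0, p1, p2, p3⟩ := polar_parities hO hΓ hx hy H H'
    rw [rd, rb, rh, rf] at p0 p1 p2 p3
    obtain ⟨q0, q1, q2, q3⟩ := convolution_injective a c e g (a' + h') (c' + f') (e' + d')
      (g' + b') h1 (by rw [← p0]; ring) (by rw [← p1]; ring) (by rw [← p2]; ring)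
      (by rw [← p3]; ring)
    exact (mem_GK H').2 ⟨add_eq_zero_two q0, add_eq_zero_two q3, add_eq_zero_two q2,
      add_eq_zero_two q1⟩

theorem cliffordOrder_le_of_mk₃ {O : Subring B₃} (h0 : ∀ x, χ x = mk₃ 0 0 2 0 0 0 0 0 → x ∈ O)
    (h1 : ∀ x, χ x = mk₃ 0 0 0 0 2 0 0 0 → x ∈ O) (h2 : ∀ x, χ x = mk₃ 0 0 0 0 0 0 0 2 → x ∈ O) :
    cliffordOrder ![-1, -1, -3] ≤ O := by
  rw [cliffordOrder_le_iff]
  intro j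
  fin_cases j
  · exact h0 _ (by rw [Fin.zero_eta, χ_gen_zero]; ext <;> simp [mk₃])
  · exact h1 _ (by rw [Fin.mk_one, χ_gen_one]; ext <;> simp [mk₃])
  · exact h2 _ (by change χ (gen _ 2) = _; rw [χ_gen_two]; ext <;> simp [mk₃])

theorem cliffordOrder_le_GI : cliffordOrder ![-1, -1, -3] ≤ GI :=
  cliffordOrder_le_of_mk₃ (fun _ h => (mem_GI h).2 (by decide)) (fun _ h => (mem_GI h).2 (by decide))
    (fun _ h => (mem_GI h).2 (by decide))

theorem cliffordOrder_le_GJ : cliffordOrder ![-1, -1, -3] ≤ GJ :=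
  cliffordOrder_le_of_mk₃ (fun _ h => (mem_GJ h).2 (by decide)) (fun _ h => (mem_GJ h).2 (by decide))
    (fun _ h => (mem_GJ h).2 (by decide))

theorem cliffordOrder_le_GK : cliffordOrder ![-1, -1, -3] ≤ GK :=
  cliffordOrder_le_of_mk₃ (fun _ h => (mem_GK h).2 (by decide)) (fun _ h => (mem_GK h).2 (by decide))
    (fun _ h => (mem_GK h).2 (by decide))

theorem cliffordOrder_le_GH : cliffordOrder ![-1, -1, -3] ≤ GH :=
  cliffordOrder_le_of_mk₃ (fun _ h => (mem_GH h).2 (by decide)) (fun _ h => (mem_GH h).2 (by decide))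
    (fun _ h => (mem_GH h).2 (by decide))

/-- Elements that separate the four maximal orders. -/
theorem exists_separating : ∃ x y z w : B₃, χ x = mk₃ 1 0 0 1 0 0 0 0 ∧
    χ y = mk₃ 1 0 0 0 0 1 0 0 ∧ χ z = mk₃ 1 0 0 0 0 0 0 1 ∧ χ w = mk₃ 1 0 1 0 1 0 1 0 := by
  refine ⟨(1 / 2 : ℚ) • (1 + gen _ 1 * gen _ 2), (1 / 2 : ℚ) • (1 - gen _ 0 * gen _ 2),
    (1 / 2 : ℚ) • (1 + gen _ 2), (1 / 2 : ℚ) • (1 + gen _ 0 + gen _ 1 + gen _ 0 * gen _ 1),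
    ?_, ?_, ?_, ?_⟩ <;>
  simp only [map_smul, map_add, map_sub, map_mul, map_one, χ_gen_zero, χ_gen_one, χ_gen_two] <;>
  ext <;> simp [mk₃]

theorem isOrder_GI : IsOrder GI :=
  isOrder_of_half cliffordOrder_le_GI fun _ ⟨_, _, _, _, _, _, _, _, h⟩ =>
    ⟨_, _, _, _, _, _, _, _, h⟩

theorem isOrder_GH : IsOrder GH :=
  isOrder_of_half cliffordOrder_le_GH fun _ ⟨_, _, _, _, _, _, _, _, h⟩ =>
    ⟨_, _, _, _, _, _, _, _, h⟩

theorem maxOrders_unit_unit_three : maxOrders ![-1, -1, -3] = {GI, GJ, GK} ∪ {GH} := by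
  refine maxOrders_eq ?_ ?_ ?_
  · rintro O ((rfl | rfl | rfl) | rfl)
    exacts [⟨isOrder_GI, cliffordOrder_le_GI⟩,
      ⟨isOrder_conjOrder _ isOrder_GI, cliffordOrder_le_GJ⟩,
      ⟨isOrder_conjOrder _ isOrder_GI, cliffordOrder_le_GK⟩, ⟨isOrder_GH, cliffordOrder_le_GH⟩]
  · intro O hO hΓ
    rcases le_cases hO hΓ with h | h | h | h
    exacts [⟨GI, .inl (.inl rfl), h⟩, ⟨GJ, .inl (.inr (.inl rfl)), h⟩,
      ⟨GK, .inl (.inr (.inr rfl)), h⟩, ⟨GH, .inr rfl, h⟩]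
  · obtain ⟨x, y, z, w, hx, hy, hz, hw⟩ := exists_separating
    have x1 : x ∈ GI := (mem_GI hx).2 (by decide)
    have x2 : x ∉ GJ := fun h => absurd ((mem_GJ hx).1 h) (by decide)
    have x3 : x ∉ GK := fun h => absurd ((mem_GK hx).1 h) (by decide)
    have x4 : x ∉ GH := fun h => absurd ((mem_GH hx).1 h) (by decide)
    have y1 : y ∉ GI := fun h => absurd ((mem_GI hy).1 h) (by decide)
    have y2 : y ∈ GJ := (mem_GJ hy).2 (by decide)
    have y3 : y ∉ GK := fun h => absurd ((mem_GK hy).1 h) (by decide)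
    have y4 : y ∉ GH := fun h => absurd ((mem_GH hy).1 h) (by decide)
    have z1 : z ∉ GI := fun h => absurd ((mem_GI hz).1 h) (by decide)
    have z2 : z ∉ GJ := fun h => absurd ((mem_GJ hz).1 h) (by decide)
    have z3 : z ∈ GK := (mem_GK hz).2 (by decide)
    have z4 : z ∉ GH := fun h => absurd ((mem_GH hz).1 h) (by decide)
    have w1 : w ∉ GI := fun h => absurd ((mem_GI hw).1 h) (by decide)
    have w2 : w ∉ GJ := fun h => absurd ((mem_GJ hw).1 h) (by decide)
    have w3 : w ∉ GK := fun h => absurd ((mem_GK hw).1 h) (by decide)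
    have w4 : w ∈ GH := (mem_GH hw).2 (by decide)
    rintro O ((rfl | rfl | rfl) | rfl) O' ((rfl | rfl | rfl) | rfl) h
    exacts [rfl, absurd (h x1) x2, absurd (h x1) x3, absurd (h x1) x4, absurd (h y2) y1, rfl,
      absurd (h y2) y3, absurd (h y2) y4, absurd (h z3) z1, absurd (h z3) z2, rfl,
      absurd (h z3) z4, absurd (h w4) w1, absurd (h w4) w2, absurd (h w4) w3, rfl]

theorem re_mul_comm₃ (p q : ℍ[F₃,-1,-1]) : (p * q).re = (q * p).re := by
  simp only [QuaternionAlgebra.re_mul]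
  ring

/-- An element of norm `1` and reduced trace `√3` is not in the order with a `ℤ[√3]`-basis. -/
theorem not_mem_GH {w : B₃} (hre : (χ w).re = ⟨0, 1 / 2⟩) (hn : nrm₃ (χ w) = 1) : w ∉ GH := by
  intro hw
  obtain ⟨a, b, c, d, e, f, g, h, H⟩ : ∃ a b c d e f g h : ℤ, χ w = mk₃ a b c d e f g h := by
    obtain ⟨a, c, e, m, n, p, q, r, H⟩ := hw
    exact ⟨_, _, _, _, _, _, _, _, H⟩
  have h1 := ((mem_GH H).1 hw).1
  rw [H] at hre
  rw [H, nrm₃_mk₃] at hn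
  have ha := congrArg QuadraticAlgebra.re hre
  have hb := congrArg QuadraticAlgebra.im hre
  have hs := congrArg QuadraticAlgebra.re hn
  simp only [mk₃, QuadraticAlgebra.re_one] at ha hb hs
  obtain rfl : a = 0 := by simpa using ha
  obtain rfl : b = 1 := by
    have : (b : ℚ) = 1 := by linarith
    exact_mod_cast this
  rw [div_eq_iff (by norm_num)] at hs
  norm_cast at hs
  have s2 := sq_nonneg c
  have s3 := sq_nonneg e
  have s4 := sq_nonneg g
  have s5 := sq_nonneg d
  have s6 := sq_nonneg f
  have s7 := sq_nonneg h
  -- Now c² + e² + g² + 3(1 + d² + f² + h²) = 4 with nonnegative squares, so d, f, h contribute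
  -- nothing. In `GH`, however, g ≡ c + e modulo 2, which makes the sum on the left even.
  have h2 : c ^ 2 + e ^ 2 + g ^ 2 = 1 := by omega
  have h3 : (c ^ 2 + e ^ 2 + g ^ 2 : ZMod 2) = 1 := by exact_mod_cast congrArg (Int.cast : ℤ → ZMod 2) h2
  rw [h1] at h3
  revert h3
  generalize (c : ZMod 2) = c'
  generalize (e : ZMod 2) = e'
  revert c' e'
  decide

/-- Conjugation preserves the reduced trace and norm. `GI` contains the twelfth root of unity (√3 +
i)/2, of trace √3 and norm 1, and `GH` has no such element. -/
theorem not_cliffordConj₃ : ¬ CliffordConj GI GH := by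
  intro h
  obtain ⟨u, -, hu⟩ := cliffordConj_iff.1 h
  let z : B₃ := (1 / 2 : ℚ) • (gen _ 0 - gen _ 0 * gen _ 1 * gen _ 2)
  have hz : χ z = mk₃ 0 1 1 0 0 0 0 0 := by
    simp only [z, map_smul, map_sub, map_mul, χ_gen_zero, χ_gen_one, χ_gen_two]
    ext <;> simp [mk₃]
  have hz' : z ∈ GI := (mem_GI hz).2 (by decide)
  refine not_mem_GH ?_ ?_ ((hu (↑u⁻¹ * z * ↑u)).2 ?_)
  · rw [mul_assoc, map_mul, re_mul_comm₃, ← map_mul, mul_assoc, Units.mul_inv, mul_one, hz]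
    ext <;> simp [mk₃]
  · rw [mul_assoc, map_mul, nrm₃_mul, mul_comm, ← nrm₃_mul, ← map_mul, mul_assoc, Units.mul_inv,
      mul_one, hz, nrm₃_mk₃]
    ext <;> norm_num
  · simpa [mul_assoc] using hz'

/-- The part of the theorem on `(-1, -1, -3 / ℚ)`. -/
theorem unit_unit_three : (conjClasses (maxOrders ![-1, -1, -3])).ncard = 2 := by
  rw [maxOrders_unit_unit_three]
  refine ncard_conjClasses_eq_two (Or.inl rfl) rfl ?_ ?_ not_cliffordConj₃
  · rintro O (rfl | rfl | rfl)
    exacts [.refl _, cliffordConj_conjOrder uJ_mem _, cliffordConj_conjOrder uK_mem _]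
  · rintro O rfl
    exact .refl _

end Quaternary

/-! ### The algebra (-1,-1,-1,-1/ℚ) as M₂(ℍ), and the conjugates of M₂(Hurwitz) -/

section Quinary

open Quaternion

/-- The `2 × 2` matrices over the Hamilton quaternions. -/
abbrev M₂ : Type := Matrix (Fin 2) (Fin 2) ℍ[ℚ]

theorem mat_ext {X Y : M₂} (h0 : X 0 0 = Y 0 0) (h1 : X 0 1 = Y 0 1) (h2 : X 1 0 = Y 1 0)
    (h3 : X 1 1 = Y 1 1) : X = Y := by
  ext1 i j
  fin_cases i <;> fin_cases j
  exacts [h0, h1, h2, h3]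

/-- The Clifford algebra `(-1, -1, -1, -1 / ℚ)`. -/
abbrev A₄ : Type := Alg ![-1, -1, -1, -1]

/-- The matrix of a Clifford vector of `(-1, -1, -1, -1 / ℚ)`. -/
def vmat (v w x y z : ℚ) : M₂ := !![quat v w x y, quat 0 0 0 z; quat 0 0 0 z, quat v w x (-y)]

/-- The Clifford algebra `(-1, -1, -1, -1 / ℚ)` as a matrix algebra. -/
noncomputable def ρ : A₄ →ₐ[ℚ] M₂ :=
  CliffordAlgebra.lift _ ⟨
    { toFun := fun u => vmat 0 (u 0) (u 1) (u 2) (u 3)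
      map_add' := fun u v => by
        apply mat_ext <;> apply Quaternion.ext <;> simp [vmat] <;> ring
      map_smul' := fun r u => by
        apply mat_ext <;> apply Quaternion.ext <;> simp [vmat] }, fun u => by
    apply mat_ext <;> apply Quaternion.ext <;>
    simp [vmat, Matrix.algebraMap_matrix_apply,
      QuadraticMap.weightedSumSquares_apply, Fin.sum_univ_four] <;> ring⟩

theorem ρ_ι (u : Fin 4 → ℚ) :
    ρ (CliffordAlgebra.ι (form ![-1, -1, -1, -1]) u) = vmat 0 (u 0) (u 1) (u 2) (u 3) := by
  rw [ρ, CliffordAlgebra.lift_ι_apply]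
  rfl

/-- The Clifford vector with the given coordinates. -/
noncomputable def pv (c : Fin 5 → ℚ) : A₄ := ∑ j, c j • frame _ j

theorem pv_eq (c : Fin 5 → ℚ) : pv c = algebraMap ℚ _ (c 0) +
    CliffordAlgebra.ι (form ![-1, -1, -1, -1]) ![c 1, c 2, c 3, c 4] := by
  rw [ι_eq_sum, pv, Fin.sum_univ_succ, Algebra.algebraMap_eq_smul_one]
  congr 1

theorem pv_mem (c : Fin 5 → ℚ) : pv c ∈ vec ![-1, -1, -1, -1] := mem_vec_iff_frame.2 ⟨c, rfl⟩

theorem ρ_pv (c : Fin 5 → ℚ) : ρ (pv c) = vmat (c 0) (c 1) (c 2) (c 3) (c 4) := by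
  rw [pv_eq, map_add, ρ_ι, AlgHom.commutes]
  apply mat_ext <;> apply Quaternion.ext <;>
  simp [vmat, Matrix.algebraMap_matrix_apply]

theorem gen_eq_pv (j : Fin 4) : gen _ j = pv (Pi.single j.succ 1) := by
  rw [pv, Finset.sum_eq_single j.succ]
  · simp [frame]
  · intro b _ hb; simp [hb]
  · simp

theorem one_eq_pv : (1 : A₄) = pv (Pi.single 0 1) := by
  rw [pv, Finset.sum_eq_single 0]
  · simp [frame]
  · intro b _ hb; simp [hb]
  · simp

theorem ρ_gen (j : Fin 4) : ρ (gen _ j) =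
    vmat 0 (![1, 0, 0, 0] j) (![0, 1, 0, 0] j) (![0, 0, 1, 0] j) (![0, 0, 0, 1] j) := by
  rw [gen_eq_pv, ρ_pv]
  fin_cases j <;> rfl

theorem bar_pv (c : Fin 5 → ℚ) : bar (pv c) = pv ![c 0, -c 1, -c 2, -c 3, -c 4] := by
  rw [pv_eq, pv_eq, bar_add, bar_algebraMap, bar_ι, ← map_neg]
  congr 2
  ext j
  fin_cases j <;> rfl

theorem scalar_mat (r : ℚ) : algebraMap ℚ M₂ r = !![quat r 0 0 0, 0; 0, quat r 0 0 0] := by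
  apply mat_ext <;> apply Quaternion.ext <;>
  simp [Matrix.algebraMap_matrix_apply]

/-- A preimage of the scalar matrix of a quaternion. -/
noncomputable def diagPre (q : ℍ[ℚ]) : A₄ :=
  q.re • 1 + q.imI • gen _ 0 + q.imJ • gen _ 1 + q.imK • (gen _ 0 * gen _ 1)

theorem ρ_diagPre (q : ℍ[ℚ]) : ρ (diagPre q) = !![q, 0; 0, q] := by
  simp only [diagPre, map_add, map_smul, map_mul, map_one, ρ_gen]
  apply mat_ext <;> apply Quaternion.ext <;> simp [vmat]

theorem ρ_sign : ρ (-(gen _ 0 * gen _ 1 * gen _ 2)) = !![1, 0; 0, -1] := by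
  simp only [map_mul, map_neg, ρ_gen]
  apply mat_ext <;> apply Quaternion.ext <;> simp [vmat]

theorem ρ_swap : ρ (-(gen _ 0 * gen _ 1 * gen _ 3)) = !![0, 1; 1, 0] := by
  simp only [map_mul, map_neg, ρ_gen]
  apply mat_ext <;> apply Quaternion.ext <;> simp [vmat]

theorem ρ_surjective : Function.Surjective ρ := fun X => by
  refine ⟨diagPre ((1 / 2 : ℚ) • (X 0 0 + X 1 1)) +
    diagPre ((1 / 2 : ℚ) • (X 0 0 - X 1 1)) * (-(gen _ 0 * gen _ 1 * gen _ 2)) +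
    diagPre ((1 / 2 : ℚ) • (X 0 1 + X 1 0)) * (-(gen _ 0 * gen _ 1 * gen _ 3)) +
    diagPre ((1 / 2 : ℚ) • (X 0 1 - X 1 0)) * (-(gen _ 0 * gen _ 1 * gen _ 2)) *
      (-(gen _ 0 * gen _ 1 * gen _ 3)), ?_⟩
  simp only [map_add, map_mul _ (diagPre _), map_mul _ (diagPre _ * _), ρ_diagPre, ρ_sign, ρ_swap]
  apply mat_ext <;> simp <;>
  apply Quaternion.ext <;> simp <;> ring

theorem ρ_injective : Function.Injective ρ := by
  refine injective_of_surjective (m := 4) ?_ ρ ρ_surjective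
  rw [Module.finrank_matrix, Quaternion.finrank_eq_four]
  norm_num

theorem pv_mul_bar (c : Fin 5 → ℚ) : pv c * bar (pv c) = algebraMap ℚ _ (∑ j, c j ^ 2) := by
  refine ρ_injective ?_
  rw [bar_pv, map_mul, ρ_pv, ρ_pv, AlgHom.commutes, scalar_mat, Fin.sum_univ_five]
  apply mat_ext <;> apply Quaternion.ext <;>
  simp [vmat, Matrix.mul_apply, Fin.sum_univ_two] <;> ring

/-- The coordinates of the Clifford vectors that conjugate one maximal order to the others. -/
def twist : Fin 5 → Fin 5 → ℚ :=
  ![![1, 0, 0, 0, 1], ![0, 1, 0, 0, -1], ![0, 0, 1, 0, -1], ![0, 0, 0, 1, -1], ![1, 0, 0, 0, 0]]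

theorem exists_twist_unit (t : Fin 5) : ∃ u : A₄ˣ, (u : A₄) = pv (twist t) := by
  refine exists_unit_of_mul_bar (pv_mul_bar _) ?_
  rw [Fin.sum_univ_five]
  fin_cases t <;> simp [twist]

/-- The Clifford vectors that conjugate one maximal order to the others. -/
noncomputable def tw (t : Fin 5) : A₄ˣ := (exists_twist_unit t).choose

theorem val_tw (t : Fin 5) : (tw t : A₄) = pv (twist t) := (exists_twist_unit t).choose_spec

theorem tw_mem (t : Fin 5) : (tw t : A₄) ∈ cliffordMonoid ![-1, -1, -1, -1] := by
  rw [val_tw]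
  exact mem_cliffordMonoid_of_mem_vec (pv_mem _)

theorem ρ_conj_tw {t : Fin 5} {x : A₄} {X : M₂}
    (h : ρ (pv (twist t)) * ρ x = X * ρ (pv (twist t))) : ρ (tw t * x * (↑(tw t)⁻¹ : A₄)) = X := by
  rw [map_mul, map_mul, val_tw, h, mul_assoc, ← val_tw, ← map_mul, Units.mul_inv, map_one, mul_one]

/-- The maximal order of the matrices over the Hurwitz quaternions. -/
noncomputable def matOrder : Subring A₄ where
  carrier := {x | ∀ i j, ρ x i j ∈ hurwitz}
  mul_mem' := fun {x y} hx hy i j => by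
    rw [map_mul, Matrix.mul_apply]
    exact sum_mem fun k _ => mul_mem (hx i k) (hy k j)
  one_mem' := fun i j => by
    rw [map_one, Matrix.one_apply]
    split_ifs
    exacts [one_mem _, zero_mem _]
  add_mem' := fun {x y} hx hy i j => by
    rw [map_add]; exact add_mem (hx i j) (hy i j)
  zero_mem' := fun i j => by rw [map_zero]; exact zero_mem _
  neg_mem' := fun {x} hx i j => by rw [map_neg]; exact neg_mem (hx i j)

theorem mem_matOrder {x : A₄} : x ∈ matOrder ↔
    (ρ x 0 0 ∈ hurwitz ∧ ρ x 0 1 ∈ hurwitz) ∧ ρ x 1 0 ∈ hurwitz ∧ ρ x 1 1 ∈ hurwitz := by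
  change (∀ i j, ρ x i j ∈ hurwitz) ↔ _
  simp only [Fin.forall_fin_two]

/-- The maximal order that belongs to the code with the support off `t`. -/
noncomputable def codeOrder (t : Fin 5) : Subring A₄ := conjOrder (tw t) matOrder

theorem quat_mem_hurwitz {w x y z : ℚ} : quat w x y z ∈ hurwitz ↔ ∃ a b c d : ℤ,
    w = a / 2 ∧ x = b / 2 ∧ y = c / 2 ∧ z = d / 2 ∧ (b : ZMod 2) = a ∧ (c : ZMod 2) = a ∧
      (d : ZMod 2) = a := by
  simp only [intCast_eq_of_dvd]
  rw [mem_hurwitz]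
  constructor
  · rintro ⟨t, a, b, c, h⟩
    rw [Quaternion.ext_iff] at h
    obtain ⟨h0, h1, h2, h3⟩ := h
    simp only [re_quat, imI_quat, imJ_quat, imK_quat] at h0 h1 h2 h3
    exact ⟨t, t + 2 * a, t + 2 * b, t + 2 * c, h0, by push_cast; linarith, by push_cast; linarith,
      by push_cast; linarith, ⟨a, rfl⟩, ⟨b, rfl⟩, ⟨c, rfl⟩⟩
  · rintro ⟨a, _, _, _, rfl, rfl, rfl, rfl, ⟨p, rfl⟩, ⟨q, rfl⟩, ⟨r, rfl⟩⟩
    refine ⟨a, p, q, r, ?_⟩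
    apply Quaternion.ext <;> simp <;> ring

end Quinary

/-! ### Clifford vectors of the code orders -/

section Quinary

open Quaternion

/-- The matrix of a conjugated Clifford vector. -/
def conjMat (t : Fin 5) (c : Fin 5 → ℚ) : M₂ :=
  ![!![quat (c 0) 0 0 0, quat (c 3) (-c 2) (c 1) (c 4);
      quat (-c 3) (-c 2) (c 1) (c 4), quat (c 0) 0 0 0],
    vmat (c 0) (-c 4) (-c 2) (-c 3) (-c 1), vmat (c 0) (-c 1) (-c 4) (-c 3) (-c 2),
    vmat (c 0) (-c 1) (-c 2) (-c 4) (-c 3), vmat (c 0) (c 1) (c 2) (c 3) (c 4)] t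

-- For t = 1, 2, 3 conjugation by γ_t - γ₄ acts on the generators as minus the reflection that swaps
-- γ_t and γ₄, so the result is again the matrix of a Clifford vector, with coordinate t in the last
-- place. For t = 0 conjugation by 1 + γ₄ sends γ₁, γ₂, γ₃ to bivectors, whence the separate shape
-- of the matrix.
set_option maxHeartbeats 2000000 in
theorem ρ_conj_pv (t : Fin 5) (c : Fin 5 → ℚ) :
    ρ (tw t * pv c * (↑(tw t)⁻¹ : A₄)) = conjMat t c := by
  refine ρ_conj_tw ?_
  rw [ρ_pv, ρ_pv]
  fin_cases t <;> apply mat_ext <;> apply Quaternion.ext <;>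
  simp [vmat, conjMat, twist, Matrix.mul_apply, Fin.sum_univ_two] <;> ring

/-- The diagonal entries tie four coordinates to a common parity of half integers. The last
coordinate sits alone off the diagonal, next to zeros, and so must be an integer. -/
theorem vmat_mem {v w x y z : ℚ} (X : M₂) (hX : X = vmat v w x y z) :
    ((X 0 0 ∈ hurwitz ∧ X 0 1 ∈ hurwitz) ∧ X 1 0 ∈ hurwitz ∧ X 1 1 ∈ hurwitz) ↔
    ∃ a b c d e : ℤ, v = a / 2 ∧ w = b / 2 ∧ x = c / 2 ∧ y = d / 2 ∧ z = e ∧ (b : ZMod 2) = a ∧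
      (c : ZMod 2) = a ∧ (d : ZMod 2) = a := by
  subst hX
  simp only [vmat, Matrix.cons_val', Matrix.cons_val_zero, Matrix.cons_val_one, Matrix.of_apply,
    Matrix.cons_val_fin_one, quat_mem_hurwitz]
  constructor
  · rintro ⟨⟨⟨a, b, c, d, h0, h1, h2, h3, h4, h5, h6⟩, ⟨a', -, -, e, h0', -, -, h3', -, -, h6'⟩⟩, -⟩
    obtain rfl : a' = 0 := by
      have : (a' : ℚ) = 0 := by linarith
      exact_mod_cast this
    rw [intCast_eq_of_dvd] at h6'
    obtain ⟨e, rfl⟩ := h6'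
    exact ⟨a, b, c, d, e, h0, h1, h2, h3, by rw [h3']; push_cast; ring, h4, h5, h6⟩
  · rintro ⟨a, b, c, d, e, h0, h1, h2, h3, h4, h5, h6, h7⟩
    have h2e : ((2 * e : ℤ) : ZMod 2) = (0 : ℤ) := intCast_eq_of_dvd.2 ⟨e, by ring⟩
    have hz : ∃ a b c d : ℤ, (0 : ℚ) = a / 2 ∧ (0 : ℚ) = b / 2 ∧ (0 : ℚ) = c / 2 ∧ z = d / 2 ∧
        (b : ZMod 2) = a ∧ (c : ZMod 2) = a ∧ (d : ZMod 2) = a :=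
      ⟨0, 0, 0, 2 * e, by simp, by simp, by simp, by rw [h4]; push_cast; ring, rfl, rfl, h2e⟩
    exact ⟨⟨⟨a, b, c, d, h0, h1, h2, h3, h5, h6, h7⟩, hz⟩, hz,
      ⟨a, b, c, -d, h0, h1, h2, by rw [h3]; push_cast; ring, h5, h6, by
        rw [Int.cast_neg, CharTwo.neg_eq, h7]⟩⟩

theorem vmat_zero_mem (c : Fin 5 → ℚ) (X : M₂) (hX : X = conjMat 0 c) :
    ((X 0 0 ∈ hurwitz ∧ X 0 1 ∈ hurwitz) ∧ X 1 0 ∈ hurwitz ∧ X 1 1 ∈ hurwitz) ↔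
    ∃ a b c' d e : ℤ, c 1 = a / 2 ∧ c 2 = b / 2 ∧ c 3 = c' / 2 ∧ c 4 = d / 2 ∧ c 0 = e ∧
      (b : ZMod 2) = a ∧ (c' : ZMod 2) = a ∧ (d : ZMod 2) = a := by
  subst hX
  simp only [conjMat, Matrix.cons_val', Matrix.cons_val_zero, Matrix.cons_val_one, Matrix.of_apply,
    Matrix.cons_val_fin_one, quat_mem_hurwitz]
  constructor
  · rintro ⟨⟨⟨e, b', -, -, h0, h1, -, -, h4, -, -⟩, ⟨c', b, a, d, h0', h1', h2', h3', h4', h5', h6'⟩⟩, -⟩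
    obtain rfl : b' = 0 := by
      have : (b' : ℚ) = 0 := by linarith
      exact_mod_cast this
    rw [eq_comm, intCast_eq_of_dvd] at h4
    obtain ⟨e, rfl⟩ := h4
    exact ⟨a, -b, c', d, e, h2', by push_cast; linarith, h0', h3', by rw [h0]; push_cast; ring,
      by rw [Int.cast_neg, CharTwo.neg_eq, h4', h5'], h5'.symm, by rw [h6', h5']⟩
  · rintro ⟨a, b, c', d, e, h0, h1, h2, h3, h4, h5, h6, h7⟩
    have h2e : ((0 : ℤ) : ZMod 2) = (2 * e : ℤ) := (intCast_eq_of_dvd.2 ⟨e, by ring⟩).symm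
    have hz : ∃ a b c' d : ℤ, c 0 = a / 2 ∧ (0 : ℚ) = b / 2 ∧ (0 : ℚ) = c' / 2 ∧ (0 : ℚ) = d / 2 ∧
        (b : ZMod 2) = a ∧ (c' : ZMod 2) = a ∧ (d : ZMod 2) = a :=
      ⟨2 * e, 0, 0, 0, by rw [h4]; push_cast; ring, by simp, by simp, by simp, h2e, h2e, h2e⟩
    exact ⟨⟨hz, ⟨c', -b, a, d, h2, by rw [h1]; push_cast; ring, h0, h3, by
      rw [Int.cast_neg, CharTwo.neg_eq, h5, h6], h6.symm, by rw [h6, h7]⟩⟩,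
      ⟨-c', -b, a, d, by rw [h2]; push_cast; ring, by rw [h1]; push_cast; ring, h0, h3, by
      rw [Int.cast_neg, Int.cast_neg, CharTwo.neg_eq, CharTwo.neg_eq, h5, h6], by
      rw [Int.cast_neg, CharTwo.neg_eq, h6], by rw [Int.cast_neg, CharTwo.neg_eq, h6, h7]⟩, hz⟩

/-- The binary word of length `5` and weight `4` that vanishes at `t`. -/
def word (t : Fin 5) : Fin 5 → ZMod 2 := fun j => if j = t then 0 else 1

/-- Conjugation by the twist moves coordinate t to the place where it must be integral; the other
four coordinates are half integers of the same parity r. -/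
theorem pv_mem_codeOrder {t : Fin 5} {c : Fin 5 → ℚ} : pv c ∈ codeOrder t ↔
    ∃ n : Fin 5 → ℤ, (∀ j, c j = n j / 2) ∧ ∃ r : ZMod 2, ∀ j, (n j : ZMod 2) = r * word t j := by
  rw [codeOrder, mem_conjOrder, mem_matOrder]
  have h := ρ_conj_pv t c
  have h2 : (2 : ZMod 2) = 0 := by decide
  fin_cases t
  · rw [vmat_zero_mem c _ h]
    constructor
    · rintro ⟨a, b, c', d, e, h0, h1, h2, h3, h4, h5, h6, h7⟩
      refine ⟨![2 * e, a, b, c', d], fun j => ?_, a, fun j => ?_⟩ <;> fin_cases j <;>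
      simp [*, word]
    · rintro ⟨n, hn, r, hr⟩
      simp [word, Fin.forall_fin_succ] at hr
      obtain ⟨e, he⟩ := (ZMod.intCast_zmod_eq_zero_iff_dvd (n 0) 2).1 hr.1
      exact ⟨n 1, n 2, n 3, n 4, e, hn 1, hn 2, hn 3, hn 4, by simp [hn, he], by simp [*], by
        simp [*], by simp [*]⟩
  · rw [vmat_mem _ h]
    constructor
    · rintro ⟨a, b, c', d, e, h0, h1, h2, h3, h4, h5, h6, h7⟩
      refine ⟨![a, -(2 * e), -c', -d, -b], fun j => ?_, a, fun j => ?_⟩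
      · fin_cases j <;> simp <;> linarith
      · fin_cases j <;> simp [word, CharTwo.neg_eq, *]
    · rintro ⟨n, hn, r, hr⟩
      simp [word, Fin.forall_fin_succ] at hr
      obtain ⟨e, he⟩ := (ZMod.intCast_zmod_eq_zero_iff_dvd (n 1) 2).1 (by simp [hr])
      refine ⟨n 0, -n 4, -n 2, -n 3, -e, ?_, ?_, ?_, ?_, ?_, ?_, ?_, ?_⟩
      · simp [hn]
      · simp [hn]; try ring
      · simp [hn]; try ring
      · simp [hn]; try ring
      · simp [hn, he]
      all_goals simp [CharTwo.neg_eq, hr]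
  · rw [vmat_mem _ h]
    constructor
    · rintro ⟨a, b, c', d, e, h0, h1, h2, h3, h4, h5, h6, h7⟩
      refine ⟨![a, -b, -(2 * e), -d, -c'], fun j => ?_, a, fun j => ?_⟩
      · fin_cases j <;> simp <;> linarith
      · fin_cases j <;> simp [word, CharTwo.neg_eq, *]
    · rintro ⟨n, hn, r, hr⟩
      simp [word, Fin.forall_fin_succ] at hr
      obtain ⟨e, he⟩ := (ZMod.intCast_zmod_eq_zero_iff_dvd (n 2) 2).1 (by simp [hr])
      refine ⟨n 0, -n 1, -n 4, -n 3, -e, ?_, ?_, ?_, ?_, ?_, ?_, ?_, ?_⟩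
      · simp [hn]
      · simp [hn]; try ring
      · simp [hn]; try ring
      · simp [hn]; try ring
      · simp [hn, he]
      all_goals simp [CharTwo.neg_eq, hr]
  · rw [vmat_mem _ h]
    constructor
    · rintro ⟨a, b, c', d, e, h0, h1, h2, h3, h4, h5, h6, h7⟩
      refine ⟨![a, -b, -c', -(2 * e), -d], fun j => ?_, a, fun j => ?_⟩
      · fin_cases j <;> simp <;> linarith
      · fin_cases j <;> simp [word, CharTwo.neg_eq, *]
    · rintro ⟨n, hn, r, hr⟩
      simp [word, Fin.forall_fin_succ] at hr
      obtain ⟨e, he⟩ := (ZMod.intCast_zmod_eq_zero_iff_dvd (n 3) 2).1 (by simp [hr])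
      refine ⟨n 0, -n 1, -n 2, -n 4, -e, ?_, ?_, ?_, ?_, ?_, ?_, ?_, ?_⟩
      · simp [hn]
      · simp [hn]; try ring
      · simp [hn]; try ring
      · simp [hn]; try ring
      · simp [hn, he]
      all_goals simp [CharTwo.neg_eq, hr]
  · rw [vmat_mem _ h]
    constructor
    · rintro ⟨a, b, c', d, e, h0, h1, h2, h3, h4, h5, h6, h7⟩
      refine ⟨![a, b, c', d, 2 * e], fun j => ?_, a, fun j => ?_⟩
      · fin_cases j <;> simp <;> linarith
      · fin_cases j <;> simp [word, *]
    · rintro ⟨n, hn, r, hr⟩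
      simp [word, Fin.forall_fin_succ] at hr
      obtain ⟨e, he⟩ := (ZMod.intCast_zmod_eq_zero_iff_dvd (n 4) 2).1 (by simp [hr])
      refine ⟨n 0, n 1, n 2, n 3, e, ?_, ?_, ?_, ?_, ?_, ?_, ?_, ?_⟩
      · simp [hn]
      · simp [hn]; try ring
      · simp [hn]; try ring
      · simp [hn]; try ring
      · simp [hn, he]
      all_goals simp [hr]

end Quinary

/-! ### The ideal of Hurwitz quaternions of even norm -/

section HurwitzIdeals

open Quaternion

theorem mem_lipschitz_quat {q : ℍ[ℚ]} : q ∈ lipschitz ↔ ∃ a b c d : ℤ, q = quat a b c d := by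
  rw [mem_lipschitz]
  constructor
  · rintro ⟨⟨a, ha⟩, ⟨b, hb⟩, ⟨c, hc⟩, ⟨d, hd⟩⟩
    exact ⟨a, b, c, d, Quaternion.ext _ _ ha hb hc hd⟩
  · rintro ⟨a, b, c, d, rfl⟩
    exact ⟨⟨a, rfl⟩, ⟨b, rfl⟩, ⟨c, rfl⟩, ⟨d, rfl⟩⟩

/-- The Hurwitz quaternions of even norm. -/
def evenIdeal : AddSubgroup ℍ[ℚ] where
  carrier := {q | ∃ a b c d : ℤ, q = quat a b c (a + b + c + 2 * d)}
  add_mem' := by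
    rintro _ _ ⟨a, b, c, d, rfl⟩ ⟨a', b', c', d', rfl⟩
    refine ⟨a + a', b + b', c + c', d + d', ?_⟩
    apply Quaternion.ext <;> simp; ring
  zero_mem' := ⟨0, 0, 0, 0, by apply Quaternion.ext <;> simp⟩
  neg_mem' := by
    rintro _ ⟨a, b, c, d, rfl⟩
    refine ⟨-a, -b, -c, -d, ?_⟩
    apply Quaternion.ext <;> simp; ring

theorem evenIdeal_le {q : ℍ[ℚ]} (h : q ∈ evenIdeal) : q ∈ hurwitz := by
  obtain ⟨a, b, c, d, rfl⟩ := h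
  exact lipschitz_le_hurwitz (mem_lipschitz_quat.2 ⟨a, b, c, a + b + c + 2 * d, by push_cast; rfl⟩)

/-- A Hurwitz quaternion outside the Lipschitz ring has odd norm, because every x² + x is even; for
a Lipschitz quaternion the norm has the parity of the coordinate sum. -/
theorem mem_evenIdeal_iff_normSq {q : ℍ[ℚ]} (hq : q ∈ hurwitz) :
    q ∈ evenIdeal ↔ ∃ n : ℤ, normSq q = 2 * n := by
  constructor
  · rintro ⟨a, b, c, d, rfl⟩
    refine ⟨a ^ 2 + b ^ 2 + c ^ 2 + a * b + a * c + b * c + 2 * (a + b + c) * d + 2 * d ^ 2, ?_⟩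
    rw [normSq_def']
    simp
    ring
  · rintro ⟨n, hn⟩
    rcases mem_lipschitz_or hq with h | h
    · obtain ⟨a, b, c, d, rfl⟩ := mem_lipschitz_quat.1 h
      rw [normSq_def'] at hn
      simp only [re_quat, imI_quat, imJ_quat, imK_quat] at hn
      norm_cast at hn
      have e : ∃ m : ℤ, d = a + b + c + 2 * m := by
        have h1 : ((a ^ 2 + b ^ 2 + c ^ 2 + d ^ 2 : ℤ) : ZMod 2) = (2 * n : ℤ) := by rw [hn]
        rw [← intCast_eq_of_dvd]
        push_cast at h1 ⊢
        rw [show (2 : ZMod 2) = 0 from by decide, zero_mul] at h1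
        revert h1
        generalize (a : ZMod 2) = x
        generalize (b : ZMod 2) = y
        generalize (c : ZMod 2) = z
        generalize (d : ZMod 2) = w
        revert x y z w
        decide
      obtain ⟨m, rfl⟩ := e
      exact ⟨a, b, c, m, by push_cast; rfl⟩
    · exfalso
      obtain ⟨a, b, c, d, h1⟩ := mem_lipschitz_quat.1 h
      rw [sub_eq_iff_eq_add] at h1
      subst h1
      rw [normSq_def'] at hn
      simp [hω] at hn
      have h2 : a ^ 2 + a + (b ^ 2 + b) + (c ^ 2 + c) + (d ^ 2 + d) + 1 = 2 * n := by
        have : (a ^ 2 + a + (b ^ 2 + b) + (c ^ 2 + c) + (d ^ 2 + d) + 1 : ℚ) = 2 * n := by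
          rw [← hn]; ring
        exact_mod_cast this
      have h3 : ∀ x : ℤ, (x ^ 2 + x) % 2 = 0 := fun x => by
        rcases Int.emod_two_eq_zero_or_one x with h | h <;> simp [pow_two, Int.add_emod, Int.mul_emod, h]
      have := h3 a
      have := h3 b
      have := h3 c
      have := h3 d
      omega

theorem odd_normSq {q : ℍ[ℚ]} (hq : q ∈ hurwitz) (h : q ∉ evenIdeal) :
    ∃ n : ℤ, normSq q = 2 * n + 1 := by
  obtain ⟨n, hn⟩ := normSq_hurwitz hq
  rw [mem_evenIdeal_iff_normSq hq, hn] at h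
  rcases Int.even_or_odd' n with ⟨m, rfl | rfl⟩
  · exact absurd ⟨m, by push_cast; rfl⟩ h
  · exact ⟨m, by rw [hn]; push_cast; rfl⟩

/-- By multiplicativity of the norm the ideal is two-sided and completely prime. -/
theorem mul_mem_evenIdeal {p q : ℍ[ℚ]} (hp : p ∈ hurwitz) (hq : q ∈ hurwitz) :
    p * q ∈ evenIdeal ↔ p ∈ evenIdeal ∨ q ∈ evenIdeal := by
  constructor
  · intro h
    by_contra! hcon
    obtain ⟨m, hm⟩ := odd_normSq hp hcon.1
    obtain ⟨n, hn⟩ := odd_normSq hq hcon.2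
    obtain ⟨k, hk⟩ := (mem_evenIdeal_iff_normSq (mul_mem hp hq)).1 h
    rw [map_mul, hm, hn] at hk
    norm_cast at hk
    have : (2 * m + 1) * (2 * n + 1) = 2 * (2 * m * n + m + n) + 1 := by ring
    omega
  · rw [mem_evenIdeal_iff_normSq (mul_mem hp hq), map_mul, mem_evenIdeal_iff_normSq hp,
      mem_evenIdeal_iff_normSq hq]
    obtain ⟨m, hm⟩ := normSq_hurwitz hp
    obtain ⟨n, hn⟩ := normSq_hurwitz hq
    rintro (⟨k, hk⟩ | ⟨k, hk⟩)
    · exact ⟨k * n, by rw [hk, hn]; push_cast; ring⟩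
    · exact ⟨m * k, by rw [hk, hm]; push_cast; ring⟩

theorem two_smul_mem_evenIdeal {q : ℍ[ℚ]} (hq : q ∈ hurwitz) : (2 : ℚ) • q ∈ evenIdeal := by
  obtain ⟨n, hn⟩ := normSq_hurwitz hq
  rw [mem_evenIdeal_iff_normSq (by rw [two_smul]; exact add_mem hq hq), normSq_smul, hn]
  exact ⟨2 * n, by push_cast; ring⟩

/-- The Gaussian prime `1 + i`. -/
def hπ : ℍ[ℚ] := quat 1 1 0 0

theorem half_mul_mem_hurwitz {q : ℍ[ℚ]} (h : q ∈ evenIdeal) :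
    (1 / 2 : ℚ) • (star hπ * q) ∈ hurwitz ∧ (1 / 2 : ℚ) • (hπ * q) ∈ hurwitz := by
  obtain ⟨a, b, c, d, rfl⟩ := h
  constructor
  · refine mem_hurwitz.2 ⟨a + b, -a, c + d, d, ?_⟩
    apply Quaternion.ext <;> simp [hπ] <;> ring
  · refine mem_hurwitz.2 ⟨a - b, b, -a - d, b + c + d, ?_⟩
    apply Quaternion.ext <;> simp [hπ] <;> ring

theorem evenIdeal_eq {q : ℍ[ℚ]} (h : q ∈ evenIdeal) :
    (∃ p ∈ hurwitz, q = hπ * p) ∧ ∃ p ∈ hurwitz, q = star hπ * p := by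
  refine ⟨⟨_, (half_mul_mem_hurwitz h).1, ?_⟩, ⟨_, (half_mul_mem_hurwitz h).2, ?_⟩⟩
  all_goals
    rw [mul_smul_comm, ← mul_assoc, ← smul_mul_assoc]
    have : (1 / 2 : ℚ) • (hπ * star hπ) = 1 ∧ (1 / 2 : ℚ) • (star hπ * hπ) = 1 := by
      constructor <;> apply Quaternion.ext <;> simp [hπ] <;> norm_num
    simp only [this, one_mul]

end HurwitzIdeals

/-! ### Classification of the column lattices stable under the Clifford order -/

section Lattices

open Quaternion

/-- The pairs of Hurwitz quaternions. -/
def latFull : AddSubgroup (ℍ[ℚ] × ℍ[ℚ]) :=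
  hurwitz.toAddSubgroup.prod hurwitz.toAddSubgroup

theorem mem_latFull {v : ℍ[ℚ] × ℍ[ℚ]} : v ∈ latFull ↔ v.1 ∈ hurwitz ∧ v.2 ∈ hurwitz := Iff.rfl

/-- The pairs of Hurwitz quaternions that are congruent modulo the even ideal. -/
def latOdd : AddSubgroup (ℍ[ℚ] × ℍ[ℚ]) :=
  latFull ⊓ evenIdeal.comap (AddMonoidHom.snd _ _ - AddMonoidHom.fst _ _)

theorem mem_latOdd {v : ℍ[ℚ] × ℍ[ℚ]} :
    v ∈ latOdd ↔ v ∈ latFull ∧ v.2 - v.1 ∈ evenIdeal := Iff.rfl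

/-- The pairs of Hurwitz quaternions `(a, b)` with `b` congruent to `u * a` modulo `2`. -/
def latTwist (u : ℍ[ℚ]) : AddSubgroup (ℍ[ℚ] × ℍ[ℚ]) where
  carrier := {v | v ∈ latFull ∧ ∃ c ∈ hurwitz, v.2 = u * v.1 + (2 : ℚ) • c}
  add_mem' := by
    rintro v w ⟨hv, c, hc, h⟩ ⟨hw, d, hd, h'⟩
    exact ⟨add_mem hv hw, c + d, add_mem hc hd, by
      rw [Prod.snd_add, Prod.fst_add, h, h', mul_add, smul_add]; abel⟩
  zero_mem' := ⟨zero_mem _, 0, zero_mem _, by simp⟩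
  neg_mem' := by
    rintro v ⟨hv, c, hc, h⟩
    exact ⟨neg_mem hv, -c, neg_mem hc, by
      rw [Prod.snd_neg, Prod.fst_neg, h, mul_neg, smul_neg]; abel⟩

theorem mem_latTwist {u : ℍ[ℚ]} {v : ℍ[ℚ] × ℍ[ℚ]} :
    v ∈ latTwist u ↔ v ∈ latFull ∧ ∃ c ∈ hurwitz, v.2 = u * v.1 + (2 : ℚ) • c := Iff.rfl

variable {Λ : AddSubgroup (ℍ[ℚ] × ℍ[ℚ])}

theorem eq_latFull (hr : ∀ v ∈ Λ, ∀ q ∈ hurwitz, (v.1 * q, v.2 * q) ∈ Λ) (hΛ : Λ ≤ latFull)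
    (ht : ∀ v ∈ Λ, (v.2, v.1) ∈ Λ) (h1 : (0, 1) ∈ Λ) : Λ = latFull := by
  refine le_antisymm hΛ fun v hv => ?_
  have h2 := add_mem (hr _ (ht _ h1) _ hv.1) (hr _ h1 _ hv.2)
  convert h2 using 1
  ext1 <;> simp

theorem eq_latOdd (hr : ∀ v ∈ Λ, ∀ q ∈ hurwitz, (v.1 * q, v.2 * q) ∈ Λ) (hΛ : Λ ≤ latFull)
    (h1 : ((1 : ℍ[ℚ]), (1 : ℍ[ℚ])) ∈ Λ) (hJ : ∀ c, ((0 : ℍ[ℚ]), c) ∈ Λ ↔ c ∈ evenIdeal) :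
    Λ = latOdd := by
  ext v
  have key : v.1 ∈ hurwitz → (v ∈ Λ ↔ v.2 - v.1 ∈ evenIdeal) := fun h => by
    rw [← hJ]
    have h2 : v = (0, v.2 - v.1) + (1 * v.1, 1 * v.1) := by ext1 <;> simp
    conv_lhs => rw [h2]
    exact add_mem_cancel_right (hr _ h1 _ h)
  rw [mem_latOdd]
  exact ⟨fun h => ⟨hΛ h, (key (hΛ h).1).1 h⟩, fun h => (key h.1.1).2 h.2⟩

theorem eq_latTwist (hr : ∀ v ∈ Λ, ∀ q ∈ hurwitz, (v.1 * q, v.2 * q) ∈ Λ) (hΛ : Λ ≤ latFull)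
    {u : ℍ[ℚ]} (h1 : ((1 : ℍ[ℚ]), u) ∈ Λ)
    (hJ : ∀ c, ((0 : ℍ[ℚ]), c) ∈ Λ ↔ ∃ d ∈ hurwitz, c = (2 : ℚ) • d) : Λ = latTwist u := by
  ext v
  have key : v.1 ∈ hurwitz → (v ∈ Λ ↔ ∃ d ∈ hurwitz, v.2 = u * v.1 + (2 : ℚ) • d) := fun h => by
    have h2 : v = (0, v.2 - u * v.1) + (1 * v.1, u * v.1) := by ext1 <;> simp
    conv_lhs => rw [h2]
    rw [add_mem_cancel_right (hr _ h1 _ h), hJ]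
    simp only [sub_eq_iff_eq_add']
  rw [mem_latTwist]
  exact ⟨fun h => ⟨hΛ h, (key (hΛ h).1).1 h⟩, fun h => (key h.1.1).2 h.2⟩

/-- Up to adding the all-ones word, an odd word of length 4 has weight one. This is the relevant
equivalence, since 1 + i + j + k is twice a Hurwitz quaternion. -/
theorem one_word_classes : ∀ a b c d : ZMod 2, a + b + c + d = 1 →
    (b = a + 1 ∧ c = a + 1 ∧ d = a + 1) ∨ (b = a + 1 ∧ c = a ∧ d = a) ∨
      (b = a ∧ c = a + 1 ∧ d = a) ∨ (b = a ∧ c = a ∧ d = a + 1) := by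
  decide

/-- The solutions modulo `2` of the conditions on the slope of a lattice. -/
theorem slope_classes {b : ℍ[ℚ]} (hb : b ∈ hurwitz)
    (hi : ∃ d ∈ hurwitz, quat 0 1 0 0 * b - b * quat 0 1 0 0 = (2 : ℚ) • d)
    (hj : ∃ d ∈ hurwitz, 1 - b * b = (2 : ℚ) • d) :
    ∃ t : Fin 4, ∃ d ∈ hurwitz, b = ![quat 0 0 0 1, quat 0 0 1 0, quat 0 1 0 0, quat 1 0 0 0] t
      + (2 : ℚ) • d := by
  -- If b were congruent to (1+i+j+k)/2 modulo the Lipschitz ring, half the commutator of i and b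
  -- would have real part 0 but a half-odd j-coordinate.
  have hbL : b ∈ lipschitz := by
    obtain ⟨d, hd, h⟩ := hi
    rcases mem_lipschitz_or hb with h1 | h1
    · exact h1
    exfalso
    obtain ⟨x, y, z, w, h1⟩ := mem_lipschitz_quat.1 h1
    obtain ⟨a, b', c', d', h2⟩ := mem_hurwitz.1 hd
    rw [sub_eq_iff_eq_add] at h1
    subst h1 h2
    rw [Quaternion.ext_iff] at h
    obtain ⟨h3, -, h4, -⟩ := h
    simp [hω] at h3 h4
    subst h3
    have : (2 * (w + c') : ℚ) = -1 := by push_cast at h4; linarith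
    have : 2 * (w + c') = -1 := by exact_mod_cast this
    omega
  obtain ⟨x, y, z, w, rfl⟩ := mem_lipschitz_quat.1 hbL
  obtain ⟨d, hd, h⟩ := hj
  have hodd : ((x + y + z + w : ℤ) : ZMod 2) = 1 := by
    -- From b² = 2 Re(b) b - |b|² the element (1 - b²)/2 + Re(b) b is the scalar (1 + |b|²)/2. Being
    -- a Hurwitz quaternion it is an integer, so |b|² is odd.
    have h1 : d + x • quat x y z w = quat ((1 + (x ^ 2 + y ^ 2 + z ^ 2 + w ^ 2)) / 2) 0 0 0 := by
      have : d = (1 / 2 : ℚ) • (1 - quat x y z w * quat x y z w) := by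
        rw [h, smul_smul]; norm_num
      rw [this]
      apply Quaternion.ext <;> simp <;> ring
    have h2 : d + x • quat x y z w ∈ hurwitz := add_mem hd (zsmul_mem hb x)
    rw [h1, quat_mem_hurwitz] at h2
    obtain ⟨n, m, -, -, h3, h4, -, -, h5, -⟩ := h2
    obtain rfl : m = 0 := by
      have : (m : ℚ) = 0 := by linarith
      exact_mod_cast this
    rw [eq_comm, intCast_eq_of_dvd] at h5
    obtain ⟨k, rfl⟩ := h5
    have h6 : x ^ 2 + y ^ 2 + z ^ 2 + w ^ 2 = 2 * k - 1 := by
      have : (x ^ 2 + y ^ 2 + z ^ 2 + w ^ 2 : ℚ) = 2 * k - 1 := by push_cast at h3; linarith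
      exact_mod_cast this
    have h7 := congrArg (Int.cast : ℤ → ZMod 2) h6
    push_cast at h7 ⊢
    rw [show (2 : ZMod 2) = 0 from by decide, zero_mul] at h7
    revert h7
    generalize (x : ZMod 2) = x
    generalize (y : ZMod 2) = y
    generalize (z : ZMod 2) = z
    generalize (w : ZMod 2) = w
    revert x y z w
    decide
  have key : ∀ p q r s : ℤ, (y - q : ZMod 2) = (x - p : ℤ) → (z - r : ZMod 2) = (x - p : ℤ) →
      (w - s : ZMod 2) = (x - p : ℤ) →
      ∃ d ∈ hurwitz, quat x y z w = quat p q r s + (2 : ℚ) • d := fun p q r s h1 h2 h3 =>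
    ⟨quat ((x - p) / 2) ((y - q) / 2) ((z - r) / 2) ((w - s) / 2),
      quat_mem_hurwitz.2 ⟨x - p, y - q, z - r, w - s, by push_cast; rfl, by push_cast; rfl,
        by push_cast; rfl, by push_cast; rfl, by rw [← h1]; push_cast; rfl,
        by rw [← h2]; push_cast; rfl, by rw [← h3]; push_cast; rfl⟩, by
      apply Quaternion.ext <;> simp <;> ring⟩
  push_cast at hodd
  rcases one_word_classes _ _ _ _ hodd with ⟨h1, h2, h3⟩ | ⟨h1, h2, h3⟩ | ⟨h1, h2, h3⟩ | ⟨h1, h2, h3⟩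
  · refine ⟨3, ?_⟩
    have := key 1 0 0 0
    simp [h1, h2, h3] at this
    exact this (by generalize (x : ZMod 2) = x; revert x; decide)
  · refine ⟨2, ?_⟩
    have := key 0 1 0 0
    simp [h1, h2, h3] at this
    exact this
  · refine ⟨1, ?_⟩
    have := key 0 0 1 0
    simp [h1, h2, h3] at this
    exact this
  · refine ⟨0, ?_⟩
    have := key 0 0 0 1
    simp [h1, h2, h3] at this
    exact this

/-- The lattices that are stable under the image of the Clifford order. -/
theorem lattice_classes (hr : ∀ v ∈ Λ, ∀ q ∈ hurwitz, (v.1 * q, v.2 * q) ∈ Λ) (hΛ : Λ ≤ latFull)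
    (hs : ∀ v ∈ Λ, (v.1, -v.2) ∈ Λ) (ht : ∀ v ∈ Λ, (v.2, v.1) ∈ Λ)
    (hi : ∀ v ∈ Λ, (quat 0 1 0 0 * v.1, quat 0 1 0 0 * v.2) ∈ Λ) (h1 : ∃ b, (1, b) ∈ Λ) :
    Λ = latFull ∨ Λ = latOdd ∨ ∃ t : Fin 4,
      Λ = latTwist (![quat 0 0 0 1, quat 0 0 1 0, quat 0 1 0 0, quat 1 0 0 0] t) := by
  obtain ⟨b, hb⟩ := h1
  have hbh : b ∈ hurwitz := (hΛ hb).2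
  -- Adding (1, b) and (1, -b) gives (2, 0), and the swap gives (0, 2). The fibre J over 0 is thus a
  -- right ideal containing 2, which leaves J = H, (1+i)H or 2H, the three cases below.
  have h2 : ∀ c ∈ hurwitz, ((0 : ℍ[ℚ]), (2 : ℚ) • c) ∈ Λ := fun c hc => by
    have h := hr _ (ht _ (add_mem hb (hs _ hb))) c hc
    convert h using 1
    ext1
    · simp
    · simp [two_smul, add_mul]
  have hJr : ∀ c q, ((0 : ℍ[ℚ]), c) ∈ Λ → q ∈ hurwitz → ((0 : ℍ[ℚ]), c * q) ∈ Λ := fun c q hc hq => by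
    simpa using hr _ hc q hq
  -- A factor q of odd norm can be cancelled modulo 2: multiply by q̄ and subtract a multiple of 2p.
  have hodd : ∀ p q, ((0 : ℍ[ℚ]), p * q) ∈ Λ → p ∈ hurwitz → q ∈ hurwitz → q ∉ evenIdeal →
      ((0 : ℍ[ℚ]), p) ∈ Λ := fun p q hpq hp hq hqE => by
    obtain ⟨n, hn⟩ := odd_normSq hq hqE
    have h3 := sub_mem (hJr _ _ hpq (star_mem_hurwitz hq)) (h2 _ (zsmul_mem hp n))
    convert h3 using 1
    ext1
    · simp
    · rw [Prod.snd_sub, mul_assoc, self_mul_star, hn]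
      apply Quaternion.ext <;> simp <;> ring
  -- The swap of (1, b) minus (1, b)·b: the slope squares to 1 modulo J.
  have hbb : ((0 : ℍ[ℚ]), 1 - b * b) ∈ Λ := by
    have := sub_mem (ht _ hb) (hr _ hb b hbh)
    convert this using 1
    ext1 <;> simp
  by_cases hE : ∀ c, ((0 : ℍ[ℚ]), c) ∈ Λ → c ∈ evenIdeal
  swap
  · push Not at hE
    obtain ⟨c, hc, hcE⟩ := hE
    left
    exact eq_latFull hr hΛ ht (hodd 1 c (by rwa [one_mul]) (one_mem _) (hΛ hc).2 hcE)
  by_cases h2h : ∀ c, ((0 : ℍ[ℚ]), c) ∈ Λ → ∃ d ∈ hurwitz, c = (2 : ℚ) • d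
  · right; right
    have hib : ((0 : ℍ[ℚ]), quat 0 1 0 0 * b - b * quat 0 1 0 0) ∈ Λ := by
      have := sub_mem (hi _ hb) (hr _ hb (quat 0 1 0 0)
        (lipschitz_le_hurwitz (mem_lipschitz_quat.2 ⟨0, 1, 0, 0, by simp⟩)))
      convert this using 1
      ext1 <;> simp
    obtain ⟨t, d, hd, h⟩ := slope_classes hbh (h2h _ hib) (h2h _ hbb)
    refine ⟨t, eq_latTwist hr hΛ ?_ fun c => ⟨h2h c, ?_⟩⟩
    · have := sub_mem hb (h2 d hd)
      convert this using 1
      ext1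
      · simp
      · simp [h]
    · rintro ⟨d, hd, rfl⟩
      exact h2 d hd
  · right; left
    push Not at h2h
    obtain ⟨c, hc, hc2⟩ := h2h
    obtain ⟨q, hq, rfl⟩ := (evenIdeal_eq (hE c hc)).1
    have hπh : hπ ∈ hurwitz := lipschitz_le_hurwitz (mem_lipschitz_quat.2 ⟨1, 1, 0, 0, by simp [hπ]⟩)
    have hqE : q ∉ evenIdeal := fun h => by
      obtain ⟨p, hp, rfl⟩ := (evenIdeal_eq h).2
      refine hc2 p hp ?_
      have e : hπ * star hπ = (2 : ℚ) • quat 1 0 0 0 := by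
        apply Quaternion.ext <;> simp [hπ]
        norm_num
      have e1 : quat 1 0 0 0 = 1 := by apply Quaternion.ext <;> simp
      rw [← mul_assoc, e, e1, smul_mul_assoc, one_mul]
    have hπJ := hodd _ _ hc hπh hq hqE
    have hJ : ∀ c, ((0 : ℍ[ℚ]), c) ∈ Λ ↔ c ∈ evenIdeal := fun c => ⟨hE c, fun h => by
      obtain ⟨p, hp, rfl⟩ := (evenIdeal_eq h).1
      exact hJr _ _ hπJ hp⟩
    refine eq_latOdd hr hΛ ?_ hJ
    -- The ideal is completely prime and contains (1 - b)(1 + b); the two factors differ by 2b, so 1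
    -- - b lies in it in either case.
    have h3 : 1 - b ∈ evenIdeal := by
      have h4 := hE _ hbb
      have h5 : 1 - b * b = (1 - b) * (1 + b) := by noncomm_ring
      rw [h5, mul_mem_evenIdeal (sub_mem (one_mem _) hbh) (add_mem (one_mem _) hbh)] at h4
      rcases h4 with h4 | h4
      · exact h4
      · have := sub_mem h4 (two_smul_mem_evenIdeal hbh)
        convert this using 1
        rw [two_smul]; abel
    have := add_mem hb ((hJ _).2 h3)
    convert this using 1
    ext1 <;> simp

end Lattices

/-! ### Every order over the Clifford order stabilizes a normalized lattice -/

section Quinary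

open Quaternion

/-- The action of a matrix on a column of quaternions. -/
def act (X : M₂) (v : ℍ[ℚ] × ℍ[ℚ]) : ℍ[ℚ] × ℍ[ℚ] :=
  (X 0 0 * v.1 + X 0 1 * v.2, X 1 0 * v.1 + X 1 1 * v.2)

theorem act_mul (X Y : M₂) (v : ℍ[ℚ] × ℍ[ℚ]) : act (X * Y) v = act X (act Y v) := by
  ext1 <;> simp only [act, Matrix.mul_apply, Fin.sum_univ_two] <;> noncomm_ring

theorem act_add (X : M₂) (v w : ℍ[ℚ] × ℍ[ℚ]) : act X (v + w) = act X v + act X w := by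
  ext1 <;> simp only [act, Prod.fst_add, Prod.snd_add] <;> noncomm_ring

theorem act_neg (X : M₂) (v : ℍ[ℚ] × ℍ[ℚ]) : act X (-v) = -act X v := by
  ext1 <;> simp only [act, Prod.fst_neg, Prod.snd_neg] <;> noncomm_ring

theorem act_zero (X : M₂) : act X 0 = 0 := by
  ext1 <;> simp [act]

theorem one_act (v : ℍ[ℚ] × ℍ[ℚ]) : act 1 v = v := by
  ext1 <;> simp [act]

theorem add_act (X Y : M₂) (v : ℍ[ℚ] × ℍ[ℚ]) : act (X + Y) v = act X v + act Y v := by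
  ext1 <;> simp only [act, Prod.fst_add, Prod.snd_add, Matrix.add_apply] <;> noncomm_ring

theorem neg_act (X : M₂) (v : ℍ[ℚ] × ℍ[ℚ]) : act (-X) v = -act X v := by
  ext1 <;> simp only [act, Prod.fst_neg, Prod.snd_neg, Matrix.neg_apply] <;> noncomm_ring

theorem zero_act (v : ℍ[ℚ] × ℍ[ℚ]) : act 0 v = 0 := by
  ext1 <;> simp [act]

theorem smul_act (r : ℚ) (X : M₂) (v : ℍ[ℚ] × ℍ[ℚ]) : act (r • X) v = r • act X v := by
  ext1 <;> simp [act, smul_add]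

theorem act_mul_right (X : M₂) (v : ℍ[ℚ] × ℍ[ℚ]) (q : ℍ[ℚ]) :
    act X (v.1 * q, v.2 * q) = ((act X v).1 * q, (act X v).2 * q) := by
  ext1 <;> simp only [act] <;> noncomm_ring

/-- The elements of the Clifford algebra that stabilize a lattice. -/
noncomputable def stabilizer (Λ : AddSubgroup (ℍ[ℚ] × ℍ[ℚ])) : Subring A₄ where
  carrier := {x | ∀ v ∈ Λ, act (ρ x) v ∈ Λ}
  mul_mem' := fun {x y} hx hy v hv => by
    rw [map_mul, act_mul]; exact hx _ (hy v hv)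
  one_mem' := fun v hv => by rwa [map_one, one_act]
  add_mem' := fun {x y} hx hy v hv => by
    rw [map_add, add_act]; exact add_mem (hx v hv) (hy v hv)
  zero_mem' := fun v _ => by rw [map_zero, zero_act]; exact zero_mem _
  neg_mem' := fun {x} hx v hv => by rw [map_neg, neg_act]; exact neg_mem (hx v hv)

/-- Fractional right ideals of the Hurwitz order are principal. -/
theorem exists_generator {P : AddSubgroup ℍ[ℚ]} (hr : ∀ z ∈ P, ∀ q ∈ hurwitz, z * q ∈ P) {D : ℚ}
    (hD : D ≠ 0) (hP : ∀ z ∈ P, D • z ∈ hurwitz) (h1 : 1 ∈ P) :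
    ∃ g ∈ P, g ≠ 0 ∧ ∀ z ∈ P, g⁻¹ * z ∈ hurwitz := by
  classical
  have hn : ∀ z ∈ P, ∃ n : ℕ, normSq (D • z) = n := fun z hz => by
    obtain ⟨n, hn⟩ := normSq_hurwitz (hP z hz)
    have : 0 ≤ normSq (D • z) := normSq_nonneg
    rw [hn] at this
    lift n to ℕ using by exact_mod_cast this
    exact ⟨n, by rw [hn]; simp⟩
  have hex : ∃ n : ℕ, ∃ z ∈ P, z ≠ 0 ∧ normSq (D • z) = n := by
    obtain ⟨n, hn⟩ := hn 1 h1
    exact ⟨n, 1, h1, one_ne_zero, hn⟩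
  obtain ⟨g, hg, hg0, hgn⟩ := Nat.find_spec hex
  refine ⟨g, hg, hg0, fun z hz => ?_⟩
  -- Euclidean division: g has minimal norm among the nonzero elements, and the remainder z - g v is
  -- strictly shorter, hence zero.
  obtain ⟨v, hv, hlt⟩ := exists_hurwitz_near (g⁻¹ * z)
  have hw : z - g * v ∈ P := sub_mem hz (hr _ hg _ hv)
  suffices h0 : z - g * v = 0 by
    rw [sub_eq_zero.1 h0, ← mul_assoc, inv_mul_cancel₀ hg0, one_mul]
    exact hv
  by_contra h0
  obtain ⟨n, hwn⟩ := hn _ hw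
  have hmin : Nat.find hex ≤ n := Nat.find_min' hex ⟨_, hw, h0, hwn⟩
  have h2 : z - g * v = g * (g⁻¹ * z - v) := by
    rw [mul_sub, ← mul_assoc, mul_inv_cancel₀ hg0, one_mul]
  have h3 : normSq (D • (z - g * v)) < normSq (D • g) := by
    have hpos : 0 < normSq (D • g) := lt_of_le_of_ne normSq_nonneg
      (Ne.symm (normSq_ne_zero.2 (smul_ne_zero hD hg0)))
    rw [h2, ← smul_mul_assoc, map_mul]
    nlinarith
  rw [hwn, hgn] at h3
  have : n < Nat.find hex := by exact_mod_cast h3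
  omega

/-- The ring T = gHg⁻¹ is finitely generated and contains i and j, so T ⊆ H. Equality holds because
gωg⁻¹ in T has real part 1/2, hence differs from ω by a Lipschitz element, which also lies in T. -/
theorem conj_hurwitz {g : ℍ[ℚ]} (hg : g ≠ 0)
    (hi : g⁻¹ * quat 0 1 0 0 * g ∈ hurwitz) (hj : g⁻¹ * quat 0 0 1 0 * g ∈ hurwitz) (z : ℍ[ℚ]) :
    g⁻¹ * z * g ∈ hurwitz ↔ z ∈ hurwitz := by
  let T : Subring ℍ[ℚ] :=
    { carrier := {z | g⁻¹ * z * g ∈ hurwitz}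
      mul_mem' := fun {x y} hx hy => by
        have : g⁻¹ * (x * y) * g = (g⁻¹ * x * g) * (g⁻¹ * y * g) := by
          simp only [mul_assoc, mul_inv_cancel_left₀ hg]
        change g⁻¹ * (x * y) * g ∈ hurwitz
        rw [this]
        exact mul_mem hx hy
      one_mem' := by simp [hg, one_mem]
      add_mem' := fun {x y} hx hy => by
        change g⁻¹ * (x + y) * g ∈ hurwitz
        rw [mul_add, add_mul]; exact add_mem hx hy
      zero_mem' := by simp [zero_mem]
      neg_mem' := fun {x} hx => by
        change g⁻¹ * -x * g ∈ hurwitz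
        rw [mul_neg, neg_mul]; exact neg_mem hx }
  have hT : T.toAddSubgroup.FG := by
    have h1 : hurwitz.toAddSubgroup.FG := fg_of_den hcoord hcoord_injective two_ne_zero
      fun q hq => hcoord_of_mem_hurwitz hq
    have h2 := fg_map h1 ((AddMonoidHom.mulLeft g).comp (AddMonoidHom.mulRight g⁻¹))
    suffices h3 : T.toAddSubgroup =
        hurwitz.toAddSubgroup.map ((AddMonoidHom.mulLeft g).comp (AddMonoidHom.mulRight g⁻¹)) by
      rw [h3]; exact h2
    refine SetLike.ext fun z => ⟨fun hz => ?_, ?_⟩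
    · refine ⟨g⁻¹ * z * g, hz, ?_⟩
      simp [mul_assoc, hg]
    · rintro ⟨w, hw, rfl⟩
      change g⁻¹ * (g * (w * g⁻¹)) * g ∈ hurwitz
      simpa [mul_assoc, hg] using hw
  have hle : T ≤ hurwitz := le_hurwitz_of_fg hT (lipschitz_le_iff.2 ⟨hi, hj⟩)
  have hLT : lipschitz ≤ T := lipschitz_le_iff.2 ⟨hi, hj⟩
  have hwT : g * hω * g⁻¹ ∈ T := by
    change g⁻¹ * (g * hω * g⁻¹) * g ∈ hurwitz
    simpa [mul_assoc, hg] using hω_mem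
  have hωT : hω ∈ T := by
    rcases mem_lipschitz_or (hle hwT) with h | h
    · exfalso
      obtain ⟨a, b, c, d, h⟩ := mem_lipschitz_quat.1 h
      have hcomm : ∀ p q : ℍ[ℚ], (p * q).re = (q * p).re := fun p q => by simp; ring
      have h3 := congrArg QuaternionAlgebra.re h
      change (g * hω * g⁻¹).re = _ at h3
      rw [hcomm, ← mul_assoc, inv_mul_cancel₀ hg, one_mul] at h3
      change (1 / 2 : ℚ) = a at h3
      have : (2 * a : ℚ) = 1 := by rw [← h3]; norm_num
      have : 2 * a = 1 := by exact_mod_cast this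
      omega
    · have := T.sub_mem hwT (hLT h)
      simpa using this
  refine ⟨fun h => hle h, fun h => ?_⟩
  rcases mem_lipschitz_or h with h | h
  · exact hLT h
  · have := T.add_mem (hLT h) hωT
    rw [sub_add_cancel] at this
    exact this

theorem ρ_gen_zero_act (v : ℍ[ℚ] × ℍ[ℚ]) :
    act (ρ (gen _ 0)) v = (quat 0 1 0 0 * v.1, quat 0 1 0 0 * v.2) := by
  rw [ρ_gen]
  ext1 <;> apply Quaternion.ext <;> simp [act, vmat]

theorem ρ_gen_one_act (v : ℍ[ℚ] × ℍ[ℚ]) :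
    act (ρ (gen _ 1)) v = (quat 0 0 1 0 * v.1, quat 0 0 1 0 * v.2) := by
  rw [ρ_gen]
  ext1 <;> apply Quaternion.ext <;> simp [act, vmat]

theorem ρ_sign_act (v : ℍ[ℚ] × ℍ[ℚ]) :
    act (ρ (-(gen _ 0 * gen _ 1 * gen _ 2))) v = (v.1, -v.2) := by
  rw [ρ_sign]
  ext1 <;> simp [act]

theorem ρ_swap_act (v : ℍ[ℚ] × ℍ[ℚ]) :
    act (ρ (-(gen _ 0 * gen _ 1 * gen _ 3))) v = (v.2, v.1) := by
  rw [ρ_swap]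
  ext1 <;> simp [act]

theorem exists_den_ρ {O : Subring A₄} (hO : IsOrder O) :
    ∃ D : ℤ, D ≠ 0 ∧ ∀ x ∈ O, ∀ i j, (D : ℚ) • ρ x i j ∈ hurwitz := by
  obtain ⟨D, hD, h⟩ := exists_den_family hO.1 fun i : Fin 2 × Fin 2 × Fin 4 =>
    (hcoord i.2.2).comp ((Matrix.entryLinearMap ℚ ℍ[ℚ] i.1 i.2.1).comp ρ.toLinearMap)
  refine ⟨D, hD, fun x hx i j => lipschitz_le_hurwitz (mem_lipschitz_of_hcoord fun k => ?_)⟩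
  rw [map_smul]
  exact h x hx (i, j, k)

/-- An order that contains the Clifford order stabilizes a lattice. -/
theorem exists_lattice {O : Subring A₄} (hO : IsOrder O)
    (hΓ : cliffordOrder ![-1, -1, -1, -1] ≤ O) : ∃ Λ : AddSubgroup (ℍ[ℚ] × ℍ[ℚ]),
    (∀ v ∈ Λ, ∀ q ∈ hurwitz, (v.1 * q, v.2 * q) ∈ Λ) ∧ Λ ≤ latFull ∧ (∃ b, (1, b) ∈ Λ) ∧
      O ≤ stabilizer Λ := by
  have hg := cliffordOrder_le_iff.1 hΓ
  obtain ⟨D, hD, hden⟩ := exists_den_ρ hO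
  -- The lattice O·H² is stable under O on the left and H on the right, and has bounded denominators
  -- since O does.
  let Λ₀ : AddSubgroup (ℍ[ℚ] × ℍ[ℚ]) :=
    AddSubgroup.closure {w | ∃ x ∈ O, ∃ v ∈ latFull, w = act (ρ x) v}
  have hO₀ : ∀ x ∈ O, ∀ v ∈ Λ₀, act (ρ x) v ∈ Λ₀ := fun x hx v hv => by
    induction hv using AddSubgroup.closure_induction with
    | mem w hw =>
      obtain ⟨y, hy, v, hv, rfl⟩ := hw
      exact AddSubgroup.subset_closure ⟨x * y, O.mul_mem hx hy, v, hv, by rw [map_mul, act_mul]⟩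
    | zero => rw [act_zero]; exact zero_mem _
    | add v w _ _ h1 h2 => rw [act_add]; exact add_mem h1 h2
    | neg v _ h1 => rw [act_neg]; exact neg_mem h1
  have hr₀ : ∀ v ∈ Λ₀, ∀ q ∈ hurwitz, (v.1 * q, v.2 * q) ∈ Λ₀ := fun v hv q hq => by
    induction hv using AddSubgroup.closure_induction with
    | mem w hw =>
      obtain ⟨y, hy, v, hv, rfl⟩ := hw
      exact AddSubgroup.subset_closure ⟨y, hy, (v.1 * q, v.2 * q),
        ⟨hurwitz.mul_mem hv.1 hq, hurwitz.mul_mem hv.2 hq⟩, (act_mul_right _ _ _).symm⟩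
    | zero =>
      rw [Prod.fst_zero, Prod.snd_zero, zero_mul]
      exact zero_mem _
    | add v w _ _ h1 h2 => simpa [add_mul] using add_mem h1 h2
    | neg v _ h1 => simpa using neg_mem h1
  have hD₀ : ∀ v ∈ Λ₀, (D : ℚ) • v.1 ∈ hurwitz := fun v hv => by
    induction hv using AddSubgroup.closure_induction with
    | mem w hw =>
      obtain ⟨y, hy, v, hv, rfl⟩ := hw
      simp only [act, smul_add, ← smul_mul_assoc]
      exact add_mem (mul_mem (hden y hy 0 0) hv.1) (mul_mem (hden y hy 0 1) hv.2)
    | zero => simp [zero_mem]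
    | add v w _ _ h1 h2 => simpa [smul_add] using add_mem h1 h2
    | neg v _ h1 => simpa using neg_mem h1
  have hP : ∀ {z : ℍ[ℚ]}, z ∈ Λ₀.map (AddMonoidHom.fst _ _) ↔ ∃ b, (z, b) ∈ Λ₀ := fun {z} => by
    constructor
    · rintro ⟨⟨a, b⟩, h, rfl⟩; exact ⟨b, h⟩
    · rintro ⟨b, h⟩; exact ⟨_, h, rfl⟩
  obtain ⟨g, hgP, hg0, hgen⟩ := exists_generator (P := Λ₀.map (AddMonoidHom.fst _ _)) (D := D)
    (fun z hz q hq => by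
      obtain ⟨b, hb⟩ := hP.1 hz
      exact hP.2 ⟨_, hr₀ _ hb q hq⟩) (by exact_mod_cast hD)
    (fun z hz => by
      obtain ⟨b, hb⟩ := hP.1 hz
      exact hD₀ _ hb)
    (hP.2 ⟨0, AddSubgroup.subset_closure ⟨1, O.one_mem, (1, 0), ⟨hurwitz.one_mem, hurwitz.zero_mem⟩, by
      rw [map_one, one_act]⟩⟩)
  obtain ⟨b, hb⟩ := hP.1 hgP
  have hi : g⁻¹ * quat 0 1 0 0 * g ∈ hurwitz := by
    have := hO₀ _ (hg 0) _ hb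
    rw [ρ_gen_zero_act] at this
    rw [mul_assoc]
    exact hgen _ (hP.2 ⟨_, this⟩)
  have hj : g⁻¹ * quat 0 0 1 0 * g ∈ hurwitz := by
    have := hO₀ _ (hg 1) _ hb
    rw [ρ_gen_one_act] at this
    rw [mul_assoc]
    exact hgen _ (hP.2 ⟨_, this⟩)
  have hconj := conj_hurwitz hg0 hi hj
  -- The first entries of Λ₀ form a right ideal gH; multiplying on the right by g⁻¹ makes it contain
  -- 1. As O contains i and j, the element g normalizes H, so Λ₀g⁻¹ is again a right H-module with
  -- first entries in H.
  let Λ : AddSubgroup (ℍ[ℚ] × ℍ[ℚ]) :=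
    Λ₀.comap ((AddMonoidHom.mulRight g).prodMap (AddMonoidHom.mulRight g))
  have hΛ : ∀ v, v ∈ Λ ↔ (v.1 * g, v.2 * g) ∈ Λ₀ := fun v => Iff.rfl
  have hstab : O ≤ stabilizer Λ := fun x hx v hv => by
    rw [hΛ, ← act_mul_right]
    exact hO₀ x hx _ hv
  have hfst : ∀ v ∈ Λ, v.1 ∈ hurwitz := fun v hv => by
    rw [← hconj, mul_assoc]
    exact hgen _ (hP.2 ⟨_, hv⟩)
  refine ⟨Λ, fun v hv q hq => ?_, fun v hv => ⟨hfst v hv, ?_⟩, ⟨b * g⁻¹, ?_⟩, hstab⟩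
  · rw [hΛ]
    have := hr₀ _ hv _ ((hconj q).2 hq)
    simpa [mul_assoc, hg0] using this
  -- The element -γ₁γ₂γ₄ swaps the two entries, so the second entries are Hurwitz quaternions too.
  · have := hfst _ (hstab (O.neg_mem (O.mul_mem (O.mul_mem (hg 0) (hg 1)) (hg 3))) v hv)
    rwa [ρ_swap_act] at this
  · rw [hΛ]
    simpa [mul_assoc, hg0] using hb

theorem inv_tw (t : Fin 5) {c : ℚ} (hc : c ≠ 0) (hct : ∑ j, twist t j ^ 2 = c) :
    (↑(tw t)⁻¹ : A₄) = c⁻¹ • bar (pv (twist t)) := by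
  refine Units.inv_eq_of_mul_eq_one_right ?_
  rw [val_tw, mul_smul_comm, pv_mul_bar, hct, Algebra.algebraMap_eq_smul_one,
    smul_smul, inv_mul_cancel₀ hc, one_smul]

/-- The stabilizer of a lattice is a conjugate of the matrices over the Hurwitz order. -/
theorem stabilizer_le_codeOrder {Λ : AddSubgroup (ℍ[ℚ] × ℍ[ℚ])} (t : Fin 5) {c : ℚ} (hc : c ≠ 0)
    (hct : ∑ j, twist t j ^ 2 = c)
    (h : ∀ v ∈ Λ, ∃ w ∈ latFull, act (ρ (pv (twist t))) v = c • w)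
    (h0 : act (ρ (bar (pv (twist t)))) (1, 0) ∈ Λ)
    (h1 : act (ρ (bar (pv (twist t)))) (0, 1) ∈ Λ) : stabilizer Λ ≤ codeOrder t := fun x hx => by
  rw [codeOrder, mem_conjOrder, mem_matOrder]
  have hinv := inv_tw t hc hct
  -- With twist vector w and w⁻¹ = w̄/c, the conjugate wxw⁻¹ sends v to c⁻¹ · w(x(w̄v)): w̄v lies in
  -- Λ, x preserves Λ, and w maps Λ into c·H².
  have key : ∀ v, act (ρ (bar (pv (twist t)))) v ∈ Λ →
      act (ρ (tw t * x * (↑(tw t)⁻¹ : A₄))) v ∈ latFull := fun v hv => by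
    obtain ⟨w, hw, h2⟩ := h _ (hx _ hv)
    rw [val_tw, hinv, mul_smul_comm, map_smul, smul_act, map_mul, map_mul, act_mul, act_mul, h2,
      smul_smul, inv_mul_cancel₀ hc, one_smul]
    exact hw
  obtain ⟨k0, k1⟩ := key _ h0
  obtain ⟨k2, k3⟩ := key _ h1
  simp only [act, mul_one, mul_zero, add_zero, zero_add] at k0 k1 k2 k3
  exact ⟨⟨k0, k2⟩, k1, k3⟩

end Quinary

/-! ### The stabilizers of the six lattices, and the oddball order -/

section Quinary

open Quaternion

theorem quat_int_mem (a b c d : ℤ) : quat a b c d ∈ hurwitz :=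
  lipschitz_le_hurwitz (mem_lipschitz_quat.2 ⟨a, b, c, d, rfl⟩)

theorem quat_units_mem : quat 1 0 0 0 ∈ hurwitz ∧ quat 0 1 0 0 ∈ hurwitz ∧
    quat 0 0 1 0 ∈ hurwitz ∧ quat 0 0 0 1 ∈ hurwitz :=
  ⟨by simpa using quat_int_mem 1 0 0 0, by simpa using quat_int_mem 0 1 0 0,
    by simpa using quat_int_mem 0 0 1 0, by simpa using quat_int_mem 0 0 0 1⟩

theorem mem_latFull_of_mem {v : ℍ[ℚ] × ℍ[ℚ]} (h : v.1 ∈ hurwitz) (h' : v.2 ∈ hurwitz) :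
    v ∈ latFull := ⟨h, h'⟩

theorem mem_latTwist_of_eq {u : ℍ[ℚ]} {v : ℍ[ℚ] × ℍ[ℚ]} {p q c : ℍ[ℚ]} (hp : p ∈ hurwitz)
    (hq : q ∈ hurwitz) (hc : c ∈ hurwitz) (hv : v = (p, q)) (h : q = u * p + (2 : ℚ) • c) :
    v ∈ latTwist u := by
  subst hv
  exact ⟨⟨hp, hq⟩, c, hc, h⟩

/-- The vector 1 + γ₄ acts by (a, b) ↦ (a + kb, ka + b). On b = ka + 2c this is 2(kc, ka + c), as k²
= -1. The next three lemmas do the same with γ_t - γ₄ and the slopes j, i, 1. -/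
theorem stabilizer_latTwist_zero : stabilizer (latTwist (quat 0 0 0 1)) ≤ codeOrder 0 := by
  obtain ⟨h1, hi, hj, hk⟩ := quat_units_mem
  refine stabilizer_le_codeOrder 0 two_ne_zero ?_ ?_ ?_ ?_
  · simp [Fin.sum_univ_five, twist]; norm_num
  · rintro ⟨a, b⟩ ⟨⟨ha, hb⟩, c, hc, h⟩
    simp only at h
    subst h
    refine ⟨(quat 0 0 0 1 * c, quat 0 0 0 1 * a + c),
      mem_latFull_of_mem (mul_mem hk hc) (add_mem (mul_mem hk ha) hc), ?_⟩
    rw [ρ_pv]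
    ext1 <;> apply Quaternion.ext <;> simp [act, vmat, twist] <;> ring
  · rw [bar_pv, ρ_pv]
    refine mem_latTwist_of_eq h1 (neg_mem hk) (neg_mem hk) ?_ ?_
    · ext1 <;> apply Quaternion.ext <;> simp [act, vmat, twist]
    · apply Quaternion.ext <;> simp
      norm_num
  · rw [bar_pv, ρ_pv]
    refine mem_latTwist_of_eq (neg_mem hk) h1 hurwitz.zero_mem ?_ ?_
    · ext1 <;> apply Quaternion.ext <;> simp [act, vmat, twist]
    · apply Quaternion.ext <;> simp

theorem stabilizer_latTwist_one : stabilizer (latTwist (quat 0 0 1 0)) ≤ codeOrder 1 := by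
  obtain ⟨h1, hi, hj, hk⟩ := quat_units_mem
  refine stabilizer_le_codeOrder 1 two_ne_zero ?_ ?_ ?_ ?_
  · simp [Fin.sum_univ_five, twist]; norm_num
  · rintro ⟨a, b⟩ ⟨⟨ha, hb⟩, c, hc, h⟩
    simp only at h
    subst h
    refine ⟨(quat 0 1 0 0 * a - quat 0 0 0 1 * c, quat 0 1 0 0 * c),
      mem_latFull_of_mem (sub_mem (mul_mem hi ha) (mul_mem hk hc)) (mul_mem hi hc), ?_⟩
    rw [ρ_pv]
    ext1 <;> apply Quaternion.ext <;> simp [act, vmat, twist] <;> ring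
  · rw [bar_pv, ρ_pv]
    refine mem_latTwist_of_eq (neg_mem hi) hk hurwitz.zero_mem ?_ ?_
    · ext1 <;> apply Quaternion.ext <;> simp [act, vmat, twist]
    · apply Quaternion.ext <;> simp
  · rw [bar_pv, ρ_pv]
    refine mem_latTwist_of_eq hk (neg_mem hi) (neg_mem hi) ?_ ?_
    · ext1 <;> apply Quaternion.ext <;> simp [act, vmat, twist]
    · apply Quaternion.ext <;> simp
      norm_num

theorem stabilizer_latTwist_two : stabilizer (latTwist (quat 0 1 0 0)) ≤ codeOrder 2 := by
  obtain ⟨h1, hi, hj, hk⟩ := quat_units_mem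
  refine stabilizer_le_codeOrder 2 two_ne_zero ?_ ?_ ?_ ?_
  · simp [Fin.sum_univ_five, twist]; norm_num
  · rintro ⟨a, b⟩ ⟨⟨ha, hb⟩, c, hc, h⟩
    simp only at h
    subst h
    refine ⟨(-(quat 0 0 0 1 * c), quat 0 0 1 0 * c - quat 0 0 0 1 * a),
      mem_latFull_of_mem (neg_mem (mul_mem hk hc)) (sub_mem (mul_mem hj hc) (mul_mem hk ha)), ?_⟩
    rw [ρ_pv]
    ext1 <;> apply Quaternion.ext <;> simp [act, vmat, twist] <;> ring
  · rw [bar_pv, ρ_pv]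
    refine mem_latTwist_of_eq (neg_mem hj) hk hk ?_ ?_
    · ext1 <;> apply Quaternion.ext <;> simp [act, vmat, twist]
    · apply Quaternion.ext <;> simp
      norm_num
  · rw [bar_pv, ρ_pv]
    refine mem_latTwist_of_eq hk (neg_mem hj) hurwitz.zero_mem ?_ ?_
    · ext1 <;> apply Quaternion.ext <;> simp [act, vmat, twist]
    · apply Quaternion.ext <;> simp

theorem stabilizer_latTwist_three : stabilizer (latTwist (quat 1 0 0 0)) ≤ codeOrder 3 := by
  obtain ⟨h1, hi, hj, hk⟩ := quat_units_mem
  refine stabilizer_le_codeOrder 3 two_ne_zero ?_ ?_ ?_ ?_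
  · simp [Fin.sum_univ_five, twist]; norm_num
  · rintro ⟨a, b⟩ ⟨⟨ha, hb⟩, c, hc, h⟩
    simp only at h
    subst h
    refine ⟨(-(quat 0 0 0 1 * c), -(quat 0 0 0 1 * c) - quat 0 0 0 1 * a),
      mem_latFull_of_mem (neg_mem (mul_mem hk hc)) (sub_mem (neg_mem (mul_mem hk hc)) (mul_mem hk ha)), ?_⟩
    rw [ρ_pv]
    ext1 <;> apply Quaternion.ext <;> simp [act, vmat, twist] <;> ring
  · rw [bar_pv, ρ_pv]
    refine mem_latTwist_of_eq (neg_mem hk) hk hk ?_ ?_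
    · ext1 <;> apply Quaternion.ext <;> simp [act, vmat, twist]
    · apply Quaternion.ext <;> simp
      norm_num
  · rw [bar_pv, ρ_pv]
    refine mem_latTwist_of_eq hk hk hurwitz.zero_mem ?_ ?_
    · ext1 <;> apply Quaternion.ext <;> simp [act, vmat, twist]
    · apply Quaternion.ext <;> simp

theorem stabilizer_latFull : stabilizer latFull ≤ codeOrder 4 := by
  have h1 : pv (twist 4) = 1 := by
    rw [one_eq_pv]
    congr 1
    ext j
    fin_cases j <;> rfl
  refine stabilizer_le_codeOrder 4 one_ne_zero ?_ ?_ ?_ ?_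
  · simp [Fin.sum_univ_five, twist]
  · intro v hv
    exact ⟨v, hv, by rw [h1, map_one, one_act, one_smul]⟩
  · rw [h1, bar_one, map_one, one_act]
    exact mem_latFull_of_mem (one_mem _) (zero_mem _)
  · rw [h1, bar_one, map_one, one_act]
    exact mem_latFull_of_mem (zero_mem _) (one_mem _)

/-- The maximal order of the trivial code. -/
noncomputable def oddOrder : Subring A₄ := stabilizer latOdd

theorem le_codeOrder_or_le_oddOrder {O : Subring A₄} (hO : IsOrder O)
    (hΓ : cliffordOrder ![-1, -1, -1, -1] ≤ O) : (∃ t, O ≤ codeOrder t) ∨ O ≤ oddOrder := by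
  obtain ⟨Λ, hr, hΛ, h1, hst⟩ := exists_lattice hO hΓ
  have hg := cliffordOrder_le_iff.1 hΓ
  rcases lattice_classes hr hΛ
    (fun v hv => by
      rw [← ρ_sign_act]
      exact hst (O.neg_mem (O.mul_mem (O.mul_mem (hg 0) (hg 1)) (hg 2))) v hv)
    (fun v hv => by
      rw [← ρ_swap_act]
      exact hst (O.neg_mem (O.mul_mem (O.mul_mem (hg 0) (hg 1)) (hg 3))) v hv)
    (fun v hv => by
      rw [← ρ_gen_zero_act]
      exact hst (hg 0) v hv) h1 with rfl | rfl | ⟨t, rfl⟩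
  · exact .inl ⟨4, hst.trans stabilizer_latFull⟩
  · exact .inr hst
  · left
    fin_cases t
    exacts [⟨0, hst.trans stabilizer_latTwist_zero⟩, ⟨1, hst.trans stabilizer_latTwist_one⟩,
      ⟨2, hst.trans stabilizer_latTwist_two⟩, ⟨3, hst.trans stabilizer_latTwist_three⟩]

theorem cliffordOrder_le_codeOrder (t : Fin 5) : cliffordOrder ![-1, -1, -1, -1] ≤ codeOrder t := by
  rw [cliffordOrder_le_iff]
  intro j
  rw [gen_eq_pv, pv_mem_codeOrder]
  refine ⟨Pi.single j.succ 2, fun i => ?_, 0, fun i => ?_⟩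
  · by_cases h : i = j.succ
    · subst h; simp
    · simp [h]
  · by_cases h : i = j.succ
    · subst h; simp; decide
    · simp [h]

theorem act_gen_mem_latOdd (j : Fin 4) {v : ℍ[ℚ] × ℍ[ℚ]} (hv : v ∈ latOdd) :
    act (ρ (gen _ j)) v ∈ latOdd := by
  obtain ⟨-, hi, hj, hk⟩ := quat_units_mem
  obtain ⟨⟨ha, hb⟩, h⟩ := hv
  have e : ∀ u ∈ hurwitz, u * (v.2 - v.1) ∈ evenIdeal := fun u hu =>
    (mul_mem_evenIdeal hu (sub_mem hb ha)).2 (.inr h)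
  have hgen : ∀ p q : ℍ[ℚ], (p, q) = act (ρ (gen _ j)) v → p ∈ hurwitz → q ∈ hurwitz →
      q - p ∈ evenIdeal → act (ρ (gen _ j)) v ∈ latOdd := fun p q hpq hp hq he => by
    rw [← hpq]; exact ⟨⟨hp, hq⟩, he⟩
  fin_cases j
  · refine hgen (quat 0 1 0 0 * v.1) (quat 0 1 0 0 * v.2) ?_ (mul_mem hi ha) (mul_mem hi hb) ?_
    · exact (ρ_gen_zero_act v).symm
    · rw [← mul_sub]; exact e _ hi
  · refine hgen (quat 0 0 1 0 * v.1) (quat 0 0 1 0 * v.2) ?_ (mul_mem hj ha) (mul_mem hj hb) ?_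
    · exact (ρ_gen_one_act v).symm
    · rw [← mul_sub]; exact e _ hj
  · refine hgen (quat 0 0 0 1 * v.1) (-(quat 0 0 0 1 * v.2)) ?_ (mul_mem hk ha)
      (neg_mem (mul_mem hk hb)) ?_
    · rw [ρ_gen]
      ext1 <;> apply Quaternion.ext <;> simp [act, vmat]
    · have := neg_mem (add_mem (e _ hk) (two_smul_mem_evenIdeal (mul_mem hk ha)))
      convert this using 1
      rw [mul_sub, two_smul]; abel
  · refine hgen (quat 0 0 0 1 * v.2) (quat 0 0 0 1 * v.1) ?_ (mul_mem hk hb) (mul_mem hk ha) ?_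
    · rw [ρ_gen]
      ext1 <;> apply Quaternion.ext <;> simp [act, vmat]
    · have := neg_mem (e _ hk)
      convert this using 1
      rw [mul_sub]; abel

theorem cliffordOrder_le_oddOrder : cliffordOrder ![-1, -1, -1, -1] ≤ oddOrder :=
  cliffordOrder_le_iff.2 fun j _ hv => act_gen_mem_latOdd j hv

theorem isOrder_of_entries {O : Subring A₄} (hΓ : cliffordOrder ![-1, -1, -1, -1] ≤ O)
    (h : ∀ x ∈ O, ∀ i j, (2 : ℚ) • ρ x i j ∈ hurwitz) : IsOrder O := by
  refine isOrder_of_fg (fg_of_den (D := 4) (fun i : Fin 2 × Fin 2 × Fin 4 =>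
    (hcoord i.2.2).comp ((Matrix.entryLinearMap ℚ ℍ[ℚ] i.1 i.2.1).comp ρ.toLinearMap))
    (fun x hx => ρ_injective ?_) (by norm_num) fun x hx i => ?_) hΓ
  · rw [map_zero]
    ext1 i j
    exact hcoord_injective _ fun k => hx (i, j, k)
  · have h1 := hcoord_of_mem_hurwitz (h x hx i.1 i.2.1) i.2.2
    rw [map_smul, smul_eq_mul] at h1
    change IsInt (((4 : ℤ) : ℚ) * hcoord i.2.2 (ρ x i.1 i.2.1))
    convert h1 using 1
    push_cast; ring

/-- The lattice lies between 2H² and H², so twice any matrix that stabilizes it has Hurwitz entries.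
-/
theorem isOrder_oddOrder : IsOrder oddOrder := by
  refine isOrder_of_entries cliffordOrder_le_oddOrder fun x hx => ?_
  have two : (2 : ℚ) • (1 : ℍ[ℚ]) ∈ hurwitz := by
    rw [two_smul]; exact add_mem (one_mem _) (one_mem _)
  have h2 := two_smul_mem_evenIdeal (one_mem hurwitz)
  have h0 : ((2 : ℚ) • (1 : ℍ[ℚ]), (0 : ℍ[ℚ])) ∈ latOdd :=
    ⟨mem_latFull_of_mem two (zero_mem _), by simpa using neg_mem h2⟩
  have h1 : ((0 : ℍ[ℚ]), (2 : ℚ) • (1 : ℍ[ℚ])) ∈ latOdd :=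
    ⟨mem_latFull_of_mem (zero_mem _) two, by simpa using h2⟩
  obtain ⟨⟨k0, k1⟩, -⟩ := hx _ h0
  obtain ⟨⟨k2, k3⟩, -⟩ := hx _ h1
  simp only [act, mul_smul_comm, mul_one, mul_zero, add_zero, zero_add] at k0 k1 k2 k3
  simp only [Fin.forall_fin_two]
  exact ⟨⟨k0, k2⟩, k1, k3⟩

theorem isOrder_matOrder : IsOrder matOrder := by
  refine isOrder_of_entries ?_ fun x hx i j => ?_
  · have h1 : (↑(tw 4) : A₄) = 1 := by
      rw [val_tw, one_eq_pv]
      congr 1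
      ext j
      fin_cases j <;> rfl
    intro x hx
    have := cliffordOrder_le_codeOrder 4 hx
    rw [codeOrder, mem_conjOrder] at this
    rw [Units.val_eq_one] at h1
    simpa [h1] using this
  · rw [two_smul]
    exact add_mem (hx i j) (hx i j)

theorem isOrder_codeOrder (t : Fin 5) : IsOrder (codeOrder t) :=
  isOrder_conjOrder _ isOrder_matOrder

/-- A Clifford vector is in the order of the trivial code if and only if its coordinates are
integral. -/
theorem pv_mem_oddOrder {c : Fin 5 → ℚ} : pv c ∈ oddOrder ↔ ∃ n : Fin 5 → ℤ, ∀ j, c j = n j := by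
  constructor
  · intro h
    -- Two test columns suffice: (0, 1+i) makes the last coordinate integral, and (1, 1), whose
    -- image must have congruent entries, makes c 3 integral. The remaining three coordinates then
    -- have the same parity of numerators as the integer c 3 + c 4.
    have hπh : hπ ∈ evenIdeal := ⟨1, 1, 0, -1, by apply Quaternion.ext <;> simp [hπ]; norm_num⟩
    have h0 : ((0 : ℍ[ℚ]), hπ) ∈ latOdd := ⟨mem_latFull_of_mem (zero_mem _) (evenIdeal_le hπh), by simpa using hπh⟩
    have h1 : ((1 : ℍ[ℚ]), (1 : ℍ[ℚ])) ∈ latOdd :=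
      ⟨mem_latFull_of_mem (one_mem _) (one_mem _), by simp [zero_mem]⟩
    have k0 := (mem_latFull.1 (mem_latOdd.1 (h _ h0)).1).1
    obtain ⟨k1, x, y, z, w, k2⟩ := mem_latOdd.1 (h _ h1)
    replace k1 := (mem_latFull.1 k1).1
    rw [ρ_pv] at k0 k1 k2
    have e0 : (act (vmat (c 0) (c 1) (c 2) (c 3) (c 4)) (0, hπ)).1 = quat 0 0 (c 4) (c 4) := by
      apply Quaternion.ext <;> simp [act, vmat, hπ]
    have e1 : (act (vmat (c 0) (c 1) (c 2) (c 3) (c 4)) (1, 1)).1 =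
        quat (c 0) (c 1) (c 2) (c 3 + c 4) := by
      apply Quaternion.ext <;> simp [act, vmat]
    rw [e0, quat_mem_hurwitz] at k0
    obtain ⟨a, -, b, -, p0, -, p1, -, -, p2, -⟩ := k0
    obtain rfl : a = 0 := by
      have : (a : ℚ) = 0 := by linarith
      exact_mod_cast this
    rw [intCast_eq_of_dvd] at p2
    obtain ⟨d, rfl⟩ := p2
    have q4 : c 4 = d := by rw [p1]; push_cast; ring
    have k3 := congrArg QuaternionAlgebra.imK k2
    have q3 : ∃ s : ℤ, c 3 = s := by
      simp [act, vmat] at k3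
      have k4 := congrArg QuaternionAlgebra.re k2
      have k5 := congrArg QuaternionAlgebra.imI k2
      have k6 := congrArg QuaternionAlgebra.imJ k2
      simp [act, vmat] at k4 k5 k6
      exact ⟨-w, by push_cast; rw [← k4, ← k5, ← k6] at k3; linarith⟩
    obtain ⟨s, q3⟩ := q3
    rw [e1, quat_mem_hurwitz] at k1
    obtain ⟨x', y', z', w', r0, r1, r2, r3, r4, r5, r6⟩ := k1
    obtain rfl : w' = 2 * (s + d) := by
      have : (w' : ℚ) = 2 * (s + d) := by rw [q3, q4] at r3; linarith
      exact_mod_cast this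
    have h2 : (2 : ZMod 2) = 0 := by decide
    push_cast at r6
    rw [h2, zero_mul] at r6
    rw [← r6] at r4 r5
    have hev : ∀ n : ℤ, (n : ZMod 2) = 0 → ∃ m : ℤ, (n : ℚ) / 2 = m := fun n hn => by
      obtain ⟨m, rfl⟩ := (ZMod.intCast_zmod_eq_zero_iff_dvd n 2).1 hn
      exact ⟨m, by push_cast; ring⟩
    obtain ⟨x, hx⟩ := hev _ r6.symm
    obtain ⟨y, hy⟩ := hev _ r4
    obtain ⟨z, hz⟩ := hev _ r5
    refine ⟨![x, y, z, s, d], fun j => ?_⟩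
    fin_cases j
    exacts [r0.trans hx, r1.trans hy, r2.trans hz, q3, q4]
  · rintro ⟨n, hn⟩
    rw [pv]
    refine sum_mem fun j _ => ?_
    rw [hn, Int.cast_smul_eq_zsmul]
    refine zsmul_mem ?_ _
    cases j using Fin.cases with
    | zero => exact one_mem _
    | succ j => exact cliffordOrder_le_oddOrder (gen_mem_cliffordOrder j)

end Quinary

/-! ### Distinctness, maximality and conjugacy classes of the six orders -/

section Quinary

open Quaternion

theorem mem_vec_iff_pv {x : A₄} : x ∈ vec ![-1, -1, -1, -1] ↔ ∃ c, x = pv c := mem_vec_iff_frame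

/-- The code of length `5` that is spanned by the word of weight `4` that vanishes at `t`. -/
def wordCode (t : Fin 5) : Submodule (ZMod 2) (Fin 5 → ZMod 2) := Submodule.span _ {word t}

theorem intVec_codeOrder (t : Fin 5) : (intVec (codeOrder t) : Set A₄) =
    halfCodeLattice ![-1, -1, -1, -1] (wordCode t) := by
  ext x
  constructor
  · rintro ⟨hx, hv⟩
    obtain ⟨c, rfl⟩ := mem_vec_iff_pv.1 hv
    obtain ⟨n, hn, r, hr⟩ := pv_mem_codeOrder.1 hx
    refine ⟨n, Submodule.mem_span_singleton.2 ⟨r, ?_⟩, ?_⟩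
    · ext j
      rw [hr]; rfl
    · rw [pv]
      simp only [hn]
  · rintro ⟨n, hn, rfl⟩
    obtain ⟨r, hr⟩ := Submodule.mem_span_singleton.1 hn
    exact ⟨pv_mem_codeOrder.2 ⟨n, fun j => rfl, r, fun j => (congrFun hr j).symm⟩, pv_mem _⟩

theorem intVec_oddOrder : (intVec oddOrder : Set A₄) =
    halfCodeLattice ![-1, -1, -1, -1] ⊥ := by
  ext x
  constructor
  · rintro ⟨hx, hv⟩
    obtain ⟨c, rfl⟩ := mem_vec_iff_pv.1 hv
    obtain ⟨n, hn⟩ := pv_mem_oddOrder.1 hx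
    refine ⟨fun j => 2 * n j, (Submodule.mem_bot _).2 ?_, ?_⟩
    · ext j
      simp [show (2 : ZMod 2) = 0 from by decide]
    · rw [pv]
      simp only [hn]
      push_cast
      simp
  · rintro ⟨n, hn, rfl⟩
    rw [Submodule.mem_bot] at hn
    refine ⟨pv_mem_oddOrder.2 ?_, pv_mem _⟩
    choose m hm using fun j => (ZMod.intCast_zmod_eq_zero_iff_dvd (n j) 2).1 (congrFun hn j)
    exact ⟨m, fun j => by rw [hm]; push_cast; ring⟩

/-- Half the sum of the basis vectors apart from the one of index `t`. -/
noncomputable def glue (t : Fin 5) : A₄ := pv fun j => ((if j = t then 0 else 1 : ℤ) : ℚ) / 2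

theorem glue_mem (t : Fin 5) : glue t ∈ codeOrder t :=
  pv_mem_codeOrder.2 ⟨fun j => if j = t then 0 else 1, fun j => rfl, 1, fun j => by
    simp [word]⟩

/-- The coordinate of index t' equals 1/2, whereas in the code order of t' that coordinate is an
integer. -/
theorem glue_not_mem {t t' : Fin 5} (h : t ≠ t') : glue t ∉ codeOrder t' := fun hm => by
  obtain ⟨n, hn, r, hr⟩ := pv_mem_codeOrder.1 hm
  have h1 : n = fun j => if j = t then 0 else 1 := by
    ext j
    have := hn j
    have : (((if j = t then 0 else 1 : ℤ) : ℤ) : ℚ) = n j := by linarith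
    exact_mod_cast this.symm
  have h2 := hr t'
  rw [h1] at h2
  simp [word, h.symm] at h2

theorem glue_not_mem_oddOrder (t : Fin 5) : glue t ∉ oddOrder := fun hm => by
  obtain ⟨n, hn⟩ := pv_mem_oddOrder.1 hm
  obtain ⟨j, hj⟩ := exists_ne t
  have h1 := hn j
  rw [if_neg hj] at h1
  have : (2 * n j : ℚ) = 1 := by rw [← h1]; norm_num
  have : 2 * n j = 1 := by exact_mod_cast this
  omega

theorem codeOrder_injective : Function.Injective codeOrder := fun t t' h => by
  by_contra hne
  exact glue_not_mem hne (h ▸ glue_mem t)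

/-- A matrix that stabilizes the lattice of the trivial code but no lattice next to it. -/
def ellipticMat : M₂ := !![quat (-1 / 2) 0 0 (-1 / 2), quat (1 / 2) 0 0 (1 / 2);
  quat (-1 / 2) 1 0 (-1 / 2), quat (3 / 2) 0 0 (1 / 2)]

/-- On a column (a, b) with b - a even, the image has first entry (1+k)(b-a)/2, which is a Hurwitz
quaternion, and the difference of its entries is (1+i)a + (b-a), which is even. -/
theorem mem_oddOrder_of_ellipticMat {x : A₄} (hx : ρ x = ellipticMat) : x ∈ oddOrder := by
  rintro ⟨a, b⟩ ⟨hab, hD⟩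
  obtain ⟨ha, hb⟩ := mem_latFull.1 hab
  simp only at ha hb
  change b - a ∈ evenIdeal at hD
  have hP : quat (1 / 2) 0 0 (1 / 2) * (b - a) ∈ hurwitz := by
    obtain ⟨x, y, z, w, h⟩ := hD
    rw [h]
    refine mem_hurwitz.2 ⟨-y - z - 2 * w, y + w, y + z + w, x + y + z + 2 * w, ?_⟩
    apply Quaternion.ext <;> simp <;> ring
  have hπ1 : hπ ∈ evenIdeal := ⟨1, 1, 0, -1, by apply Quaternion.ext <;> simp [hπ]; norm_num⟩
  have hE : hπ * a ∈ evenIdeal := (mul_mem_evenIdeal (evenIdeal_le hπ1) ha).2 (.inl hπ1)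
  have e1 : (act (ρ x) (a, b)).1 = quat (1 / 2) 0 0 (1 / 2) * (b - a) := by
    rw [hx]
    apply Quaternion.ext <;> simp [act, ellipticMat] <;> ring
  have e2 : (act (ρ x) (a, b)).2 - (act (ρ x) (a, b)).1 = hπ * a + (b - a) := by
    rw [hx]
    apply Quaternion.ext <;> simp [act, ellipticMat, hπ] <;> ring
  have e3 : (act (ρ x) (a, b)).2 = hπ * a + (b - a) + quat (1 / 2) 0 0 (1 / 2) * (b - a) := by
    rw [← e1, ← e2]; abel
  have h2 : hπ * a + (b - a) ∈ evenIdeal := add_mem hE hD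
  refine mem_latOdd.2 ⟨mem_latFull_of_mem ?_ ?_, ?_⟩
  · rw [e1]; exact hP
  · rw [e3]; exact add_mem (evenIdeal_le h2) hP
  · rw [e2]; exact h2

theorem not_mem_hurwitz_of_sub {q : ℍ[ℚ]} {n : ℤ} (h : q.imI - q.re = n + 1 / 2 ∨
    q.imJ - q.re = n + 1 / 2) : q ∉ hurwitz := fun hq => by
  obtain ⟨-, ⟨a, ha⟩, ⟨b, hb⟩, -⟩ := mem_hurwitz_iff.1 hq
  have key : ∀ a : ℤ, (a : ℚ) ≠ n + 1 / 2 := fun a h => by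
    have : (2 * a : ℚ) = 2 * n + 1 := by rw [h]; ring
    have : 2 * a = 2 * n + 1 := by exact_mod_cast this
    omega
  rcases h with h | h
  · exact key a (by rw [← ha, h])
  · exact key b (by rw [← hb, h])

/-- After conjugation by each twist the upper left entry has two coordinates that differ by a
half-odd number. The Clifford vectors alone would not do here, since those of the oddball lie in
every code order. -/
theorem not_mem_codeOrder_of_ellipticMat {x : A₄} (hx : ρ x = ellipticMat) (t : Fin 5) :
    x ∉ codeOrder t := fun hm => by
  rw [codeOrder, mem_conjOrder] at hm
  have h0 := hm 0 0
  rw [map_mul, map_mul, val_tw, hx, ρ_pv] at h0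
  revert h0
  fin_cases t
  · rw [inv_tw _ (c := 2) two_ne_zero (by simp [Fin.sum_univ_five, twist]; norm_num), map_smul,
      bar_pv, ρ_pv]
    refine not_mem_hurwitz_of_sub (n := -1) (.inr ?_)
    simp [Matrix.mul_apply, Fin.sum_univ_two, vmat, twist, ellipticMat]
    norm_num
  · rw [inv_tw _ (c := 2) two_ne_zero (by simp [Fin.sum_univ_five, twist]; norm_num), map_smul,
      bar_pv, ρ_pv]
    refine not_mem_hurwitz_of_sub (n := -1) (.inl ?_)
    simp [Matrix.mul_apply, Fin.sum_univ_two, vmat, twist, ellipticMat]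
    norm_num
  · rw [inv_tw _ (c := 2) two_ne_zero (by simp [Fin.sum_univ_five, twist]; norm_num), map_smul,
      bar_pv, ρ_pv]
    refine not_mem_hurwitz_of_sub (n := 0) (.inl ?_)
    simp [Matrix.mul_apply, Fin.sum_univ_two, vmat, twist, ellipticMat]
    norm_num
  · rw [inv_tw _ (c := 2) two_ne_zero (by simp [Fin.sum_univ_five, twist]; norm_num), map_smul,
      bar_pv, ρ_pv]
    refine not_mem_hurwitz_of_sub (n := -1) (.inr ?_)
    simp [Matrix.mul_apply, Fin.sum_univ_two, vmat, twist, ellipticMat]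
    norm_num
  · rw [inv_tw _ (c := 1) one_ne_zero (by simp [Fin.sum_univ_five, twist]), map_smul,
      bar_pv, ρ_pv]
    refine not_mem_hurwitz_of_sub (n := 0) (.inl ?_)
    simp [Matrix.mul_apply, Fin.sum_univ_two, vmat, twist, ellipticMat]
    norm_num

theorem not_oddOrder_le_codeOrder (t : Fin 5) : ¬ oddOrder ≤ codeOrder t := fun h => by
  obtain ⟨x, hx⟩ := ρ_surjective ellipticMat
  exact not_mem_codeOrder_of_ellipticMat hx t (h (mem_oddOrder_of_ellipticMat hx))

theorem maxOrders_four : maxOrders ![-1, -1, -1, -1] = Set.range codeOrder ∪ {oddOrder} := by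
  refine maxOrders_eq ?_ ?_ ?_
  · rintro O (⟨t, rfl⟩ | rfl)
    exacts [⟨isOrder_codeOrder t, cliffordOrder_le_codeOrder t⟩,
      ⟨isOrder_oddOrder, cliffordOrder_le_oddOrder⟩]
  · intro O hO hΓ
    rcases le_codeOrder_or_le_oddOrder hO hΓ with ⟨t, h⟩ | h
    exacts [⟨_, .inl ⟨t, rfl⟩, h⟩, ⟨_, .inr rfl, h⟩]
  · rintro O (⟨t, rfl⟩ | rfl) O' (⟨t', rfl⟩ | rfl) h
    · by_contra hne
      exact glue_not_mem (fun e => hne (by rw [e])) (h (glue_mem t))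
    · exact absurd (h (glue_mem t)) (glue_not_mem_oddOrder t)
    · exact absurd h (not_oddOrder_le_codeOrder t')
    · rfl

/-- The product of the standard generators. -/
noncomputable def pseudoscalar : A₄ := gen _ 0 * gen _ 1 * gen _ 2 * gen _ 3

theorem ρ_pseudoscalar : ρ pseudoscalar = !![0, quat 0 0 0 (-1); quat 0 0 0 1, 0] := by
  simp only [pseudoscalar, map_mul, ρ_gen]
  apply mat_ext <;> apply Quaternion.ext <;> simp [vmat]

theorem pseudoscalar_mul_self : pseudoscalar * pseudoscalar = 1 := by
  refine ρ_injective ?_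
  rw [map_mul, ρ_pseudoscalar, map_one]
  apply mat_ext <;> apply Quaternion.ext <;> simp

/-- The product of the four generators squares to 1 and anticommutes with each generator, so
conjugation by it undoes the sign by which the two anti-automorphisms differ. -/
theorem pseudoscalar_conj_bar (x : A₄) : pseudoscalar * bar x * pseudoscalar = rev x := by
  induction x using CliffordAlgebra.induction with
  | algebraMap r =>
    rw [bar_algebraMap, rev_algebraMap, ← Algebra.commutes, mul_assoc, pseudoscalar_mul_self,
      mul_one]
  | ι u =>
    refine ρ_injective ?_
    rw [bar_ι, rev_ι, map_mul, map_mul, map_neg, ρ_pseudoscalar, ρ_ι]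
    apply mat_ext <;> apply Quaternion.ext <;> simp [vmat]
  | mul x y hx hy =>
    rw [bar_mul, rev_mul, ← hx, ← hy]
    have := pseudoscalar_mul_self
    calc pseudoscalar * (bar y * bar x) * pseudoscalar
        = pseudoscalar * bar y * 1 * bar x * pseudoscalar := by simp only [mul_one, mul_assoc]
      _ = pseudoscalar * bar y * pseudoscalar * (pseudoscalar * bar x * pseudoscalar) := by
        rw [← this]; simp only [mul_assoc]
  | add x y hx hy => rw [bar_add, rev_add, mul_add, add_mul, hx, hy]

theorem pv_add (c d : Fin 5 → ℚ) : pv (c + d) = pv c + pv d := by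
  simp only [pv, Pi.add_apply, add_smul, Finset.sum_add_distrib]

/-- The action of a Clifford unit on Clifford vectors, normalized to be an isometry. -/
theorem exists_isometry {u : A₄ˣ} (hu : (u : A₄) ∈ cliffordMonoid ![-1, -1, -1, -1])
    {O O' : Subring A₄} (hΓ : cliffordOrder ![-1, -1, -1, -1] ≤ O)
    (hΓ' : cliffordOrder ![-1, -1, -1, -1] ≤ O')
    (h : ∀ z, z ∈ O' ↔ (u : A₄) * z * (↑u⁻¹ : A₄) ∈ O) :
    ∃ f : A₄ →ₗ[ℚ] A₄, ∀ c, pv c ∈ O' → ∃ d, pv d ∈ O ∧ f (pv c) = pv d ∧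
      ∑ j, d j ^ 2 = ∑ j, c j ^ 2 := by
  obtain ⟨q, hq, h1, h2, h3⟩ := unit_mul_bar hu
  have hps : ∀ {S : Subring A₄}, cliffordOrder ![-1, -1, -1, -1] ≤ S → pseudoscalar ∈ S :=
    fun {S} hS => by
      have hg := cliffordOrder_le_iff.1 hS
      exact S.mul_mem (S.mul_mem (S.mul_mem (hg 0) (hg 1)) (hg 2)) (hg 3)
  refine ⟨q⁻¹ • (LinearMap.mulLeft ℚ (u : A₄) ∘ₗ LinearMap.mulRight ℚ (rev (u : A₄))),
    fun c hc => ?_⟩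
  have hf : (q⁻¹ • (LinearMap.mulLeft ℚ (u : A₄) ∘ₗ LinearMap.mulRight ℚ (rev (u : A₄)))) (pv c) =
      q⁻¹ • (u * pv c * rev (u : A₄)) := by
    simp [mul_assoc]
  rw [hf]
  -- With e the pseudoscalar, q⁻¹ u c u^* = u (c e) u⁻¹ e. Since e lies in both orders, the isometry
  -- maps the Clifford vectors of O' into O, although conjugation by u itself need not preserve
  -- vectors.
  have hw : q⁻¹ • (u * pv c * rev (u : A₄)) ∈ O := by
    have h4 := O.mul_mem ((h _).1 (O'.mul_mem hc (hps hΓ'))) (hps hΓ)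
    convert h4 using 1
    rw [← pseudoscalar_conj_bar, h3, mul_smul_comm, smul_mul_assoc, mul_smul_comm, smul_smul,
      inv_mul_cancel₀ hq, one_smul]
    simp only [mul_assoc]
  obtain ⟨d, hd⟩ := mem_vec_iff_pv.1 (Submodule.smul_mem _ q⁻¹ (hu.2 _ (pv_mem c)))
  refine ⟨d, hd ▸ hw, hd, ?_⟩
  have h5 := pv_mul_bar d
  have h6 : rev (u : A₄) * bar (rev (u : A₄)) = algebraMap ℚ _ q := by
    rw [← rev_bar, ← rev_mul, h2, rev_algebraMap]
  rw [← hd, bar_smul, bar_mul, bar_mul] at h5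
  have h7 : (q⁻¹ • (u * pv c * rev (u : A₄))) * (q⁻¹ • (bar (rev (u : A₄)) * (bar (pv c) *
      bar (u : A₄)))) = algebraMap ℚ _ (∑ j, c j ^ 2) := by
    have h8 : (u * pv c * rev (u : A₄)) * (bar (rev (u : A₄)) * (bar (pv c) * bar (u : A₄))) =
        u * (pv c * (rev (u : A₄) * bar (rev (u : A₄))) * bar (pv c)) * bar (u : A₄) := by
      simp only [mul_assoc]
    rw [smul_mul_smul_comm, h8, h6, ← Algebra.commutes, mul_assoc (algebraMap ℚ _ q), pv_mul_bar,
      ← map_mul, ← Algebra.commutes, mul_assoc, h1, ← map_mul, Algebra.smul_def, ← map_mul]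
    congr 1
    field_simp
  exact algebraMap_alg_injective (h5.symm.trans h7)

/-- In the code order the vectors (1+γ₁+γ₂+γ₃)/2 and 1 have inner product 1/2. The isometry would
carry them into ℤ⁵, where inner products are integers; polarization is applied to the norms of the
two vectors and of their sum. -/
theorem not_cliffordConj_four : ¬ CliffordConj oddOrder (codeOrder 4) := fun hcon => by
  obtain ⟨u, hu, h⟩ := cliffordConj_iff.1 hcon
  obtain ⟨f, hf⟩ := exists_isometry hu cliffordOrder_le_oddOrder (cliffordOrder_le_codeOrder 4) h
  have m1 : pv ![1 / 2, 1 / 2, 1 / 2, 1 / 2, 0] ∈ codeOrder 4 :=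
    pv_mem_codeOrder.2 ⟨![1, 1, 1, 1, 0], fun j => by fin_cases j <;> simp, 1, by
      simp [Fin.forall_fin_succ, word]⟩
  have m2 : pv ![1, 0, 0, 0, 0] ∈ codeOrder 4 :=
    pv_mem_codeOrder.2 ⟨![2, 0, 0, 0, 0], fun j => by fin_cases j <;> simp, 0, by
      simp [Fin.forall_fin_succ, word]; decide⟩
  have m3 := add_mem m1 m2
  rw [← pv_add] at m3
  obtain ⟨d1, i1, e1, n1⟩ := hf _ m1
  obtain ⟨d2, i2, e2, n2⟩ := hf _ m2
  obtain ⟨d3, i3, e3, n3⟩ := hf _ m3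
  have e4 : pv d3 = pv (d1 + d2) := by rw [pv_add, ← e1, ← e2, ← e3, pv_add, map_add]
  have n4 : ∑ j, d3 j ^ 2 = ∑ j, (d1 + d2) j ^ 2 := by
    refine algebraMap_alg_injective (a := ![-1, -1, -1, -1]) ?_
    rw [← pv_mul_bar, ← pv_mul_bar, e4]
  obtain ⟨x, hx⟩ := pv_mem_oddOrder.1 i1
  obtain ⟨y, hy⟩ := pv_mem_oddOrder.1 i2
  rw [n4] at n3
  simp [Fin.sum_univ_five, hx, hy] at n1 n2 n3
  have h5 : 2 * (x 0 * y 0 + x 1 * y 1 + x 2 * y 2 + x 3 * y 3 + x 4 * y 4 : ℚ) = 1 := by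
    norm_num at n1 n3
    linarith
  have h6 : 2 * (x 0 * y 0 + x 1 * y 1 + x 2 * y 2 + x 3 * y 3 + x 4 * y 4) = 1 := by
    exact_mod_cast h5
  omega

end Quinary

/-! ### The doubly even [5,1,4] codes, and the labelling of the orders by them -/

theorem word_injective : Function.Injective word := by decide

theorem exists_eq_word : ∀ w : Fin 5 → ZMod 2, w ≠ 0 → 4 ∣ hammingNorm w → ∃ t, w = word t := by
  decide

theorem hammingNorm_word : ∀ t, hammingNorm (word t) = 4 := by decide

theorem word_ne_zero : ∀ t, word t ≠ 0 := by decide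

theorem mem_wordCode {t : Fin 5} {w : Fin 5 → ZMod 2} : w ∈ wordCode t ↔ w = 0 ∨ w = word t := by
  rw [wordCode, Submodule.mem_span_singleton]
  constructor
  · rintro ⟨r, rfl⟩
    revert r
    intro r
    fin_cases r
    exacts [.inl (zero_smul _ _), .inr (one_smul _ _)]
  · rintro (rfl | rfl)
    exacts [⟨0, zero_smul _ _⟩, ⟨1, one_smul _ _⟩]

theorem wordCode_injective : Function.Injective wordCode := fun t t' h => by
  have h1 : word t ∈ wordCode t' := h ▸ mem_wordCode.2 (.inr rfl)
  exact word_injective ((mem_wordCode.1 h1).resolve_left (word_ne_zero t))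

theorem wordCode_mem (t : Fin 5) : wordCode t ∈ codes514 := by
  refine ⟨fun w hw => ?_, finrank_span_singleton (word_ne_zero t), ?_, ?_⟩
  · rcases mem_wordCode.1 hw with rfl | rfl
    · simp
    · rw [hammingNorm_word]
  · exact ⟨word t, mem_wordCode.2 (.inr rfl), 0, zero_mem _, word_ne_zero t, by
      rw [hammingDist_zero_right, hammingNorm_word]⟩
  · rintro e ⟨v, hv, w, hw, hne, rfl⟩
    rw [hammingDist_eq_hammingNorm, (mem_wordCode.1 (add_mem (neg_mem hv) hw)).resolve_left
      fun h => hne (neg_add_eq_zero.1 h), hammingNorm_word]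

/-- A one-dimensional binary code is spanned by its only nonzero word, which is doubly even of
length 5 and hence has weight 4. -/
theorem codes514_eq : codes514 = Set.range wordCode := by
  ext C
  constructor
  · rintro ⟨hC, hr, -⟩
    obtain ⟨w, hw, hspan⟩ := finrank_eq_one_iff'.1 hr
    obtain ⟨t, ht⟩ := exists_eq_word w.1 (fun h => hw (Subtype.ext h)) (hC _ w.2)
    refine ⟨t, le_antisymm ?_ fun v hv => ?_⟩
    · rw [wordCode, Submodule.span_singleton_le_iff_mem, ← ht]
      exact w.2
    · obtain ⟨r, h⟩ := hspan ⟨v, hv⟩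
      exact Submodule.mem_span_singleton.2 ⟨r, by rw [← ht]; exact congrArg Subtype.val h⟩
  · rintro ⟨t, rfl⟩
    exact wordCode_mem t

theorem ncard_codes514 : codes514.ncard = 5 := by
  rw [codes514_eq, ← Set.image_univ, Set.ncard_image_of_injective _ wordCode_injective,
    Set.ncard_univ, Nat.card_fin]

theorem four_units : codes514.ncard = 5 ∧
    ∃ (𝒪 : codes514 → Subring (Alg ![-1, -1, -1, -1])) (O₀ : Subring (Alg ![-1, -1, -1, -1])),
      (∀ C, (intVec (𝒪 C) : Set (Alg ![-1, -1, -1, -1])) =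
        halfCodeLattice ![-1, -1, -1, -1] C.1) ∧
      (intVec O₀ : Set (Alg ![-1, -1, -1, -1])) = halfCodeLattice ![-1, -1, -1, -1] ⊥ ∧
      maxOrders ![-1, -1, -1, -1] = Set.range 𝒪 ∪ {O₀} ∧
      Function.Injective 𝒪 ∧
      conjClasses (maxOrders ![-1, -1, -1, -1]) = {Set.range 𝒪, {O₀}} ∧
      (conjClasses (maxOrders ![-1, -1, -1, -1])).ncard = 2 := by
  let e : Fin 5 ≃ codes514 := (Equiv.ofInjective _ wordCode_injective).trans
    (Equiv.setCongr codes514_eq.symm)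
  have he : ∀ t, (e t).1 = wordCode t := fun t => rfl
  have hrange : Set.range (codeOrder ∘ e.symm) = Set.range codeOrder :=
    EquivLike.range_comp codeOrder e.symm
  have hmat : ∀ t, CliffordConj matOrder (codeOrder t) := fun t =>
    cliffordConj_conjOrder (tw_mem t) matOrder
  have hA : ∀ O ∈ Set.range codeOrder, CliffordConj (codeOrder 4) O := by
    rintro _ ⟨t, rfl⟩
    exact (hmat 4).symm.trans (hmat t)
  have hB : ∀ O ∈ ({oddOrder} : Set (Subring (Alg ![-1, -1, -1, -1]))),
      CliffordConj oddOrder O := by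
    rintro _ rfl
    exact CliffordConj.refl _
  have hAB : ¬ CliffordConj (codeOrder 4) oddOrder := fun h => not_cliffordConj_four h.symm
  refine ⟨ncard_codes514, codeOrder ∘ e.symm, oddOrder, fun C => ?_, intVec_oddOrder, ?_,
    codeOrder_injective.comp e.symm.injective, ?_, ?_⟩
  · rw [Function.comp_apply, intVec_codeOrder, ← he, Equiv.apply_symm_apply]
  · rw [hrange, maxOrders_four]
  · rw [hrange, maxOrders_four]
    exact conjClasses_eq_pair ⟨4, rfl⟩ rfl hA hB hAB
  · rw [maxOrders_four]
    exact ncard_conjClasses_eq_two ⟨4, rfl⟩ rfl hA hB hAB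

end RationalClifford

theorem mainTheorem10 :
    -- the algebra (-1, -1, -1 / ℚ)
    (∃ O₄ : Subring (RationalClifford.Alg ![-1, -1, -1]),
      RationalClifford.maxOrders ![-1, -1, -1] = {O₄} ∧
      RationalClifford.IsStarStable O₄ ∧
      RationalClifford.IsRightCliffordEuclidean O₄ ∧
      RationalClifford.IsLeftCliffordEuclidean O₄ ∧
      ∃ (b : Fin 4 → RationalClifford.Alg ![-1, -1, -1])
        (α : RationalClifford.Alg ![-1, -1, -1]) (τ : Equiv.Perm (Fin 4)),
        RationalClifford.IsD4Base O₄ b ∧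
        RationalClifford.IsCliffordUnit O₄ α ∧
        (∀ i j, CartanMatrix.D 4 (τ i) (τ j) = CartanMatrix.D 4 i j) ∧
        orderOf τ = 3 ∧
        ∀ i, α * b i * RationalClifford.rev α = b (τ i)) ∧
    (RationalClifford.IsOrder (RationalClifford.cliffordOrder ![-1, -1, -1]) ∧
      RationalClifford.IsStarStable (RationalClifford.cliffordOrder ![-1, -1, -1]) ∧
      ¬ RationalClifford.IsRightCliffordEuclidean
          (RationalClifford.cliffordOrder ![-1, -1, -1]) ∧
      ¬ RationalClifford.IsLeftCliffordEuclidean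
          (RationalClifford.cliffordOrder ![-1, -1, -1]) ∧
      ¬ RationalClifford.IsCuspidallyPrincipal
          (RationalClifford.cliffordOrder ![-1, -1, -1])) ∧
    -- the algebra (-1, -1, -1, -1 / ℚ)
    (RationalClifford.codes514.ncard = 5 ∧
      ∃ (𝒪 : RationalClifford.codes514 → Subring (RationalClifford.Alg ![-1, -1, -1, -1]))
        (O₀ : Subring (RationalClifford.Alg ![-1, -1, -1, -1])),
        (∀ C, (RationalClifford.intVec (𝒪 C) : Set (RationalClifford.Alg ![-1, -1, -1, -1])) =
          RationalClifford.halfCodeLattice ![-1, -1, -1, -1] C.1) ∧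
        (RationalClifford.intVec O₀ : Set (RationalClifford.Alg ![-1, -1, -1, -1])) =
          RationalClifford.halfCodeLattice ![-1, -1, -1, -1] ⊥ ∧
        RationalClifford.maxOrders ![-1, -1, -1, -1] = Set.range 𝒪 ∪ {O₀} ∧
        Function.Injective 𝒪 ∧
        RationalClifford.conjClasses (RationalClifford.maxOrders ![-1, -1, -1, -1]) =
          {Set.range 𝒪, {O₀}} ∧
        (RationalClifford.conjClasses (RationalClifford.maxOrders ![-1, -1, -1, -1])).ncard = 2) ∧
    -- the algebra (-1, -3 / ℚ)
    (∃ O₁ O₂ : Subring (RationalClifford.Alg ![-1, -3]),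
      RationalClifford.maxOrders ![-1, -3] = {O₁, O₂} ∧ O₁ ≠ O₂ ∧
      RationalClifford.conjClasses (RationalClifford.maxOrders ![-1, -3]) = {{O₁, O₂}} ∧
      (1 / 2 : ℚ) • (1 + RationalClifford.gen ![-1, -3] 1) ∈ O₁ ∧
      (1 / 2 : ℚ) • (1 + RationalClifford.gen ![-1, -3] 0 * RationalClifford.gen ![-1, -3] 1)
        ∈ O₂ ∧
      ∀ O ∈ RationalClifford.maxOrders ![-1, -3],
        RationalClifford.IsStarStable O ∧
        RationalClifford.IsRightCliffordEuclidean O ∧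
        RationalClifford.IsLeftCliffordEuclidean O) ∧
    -- the algebra (-1, -1, -3 / ℚ)
    (RationalClifford.conjClasses (RationalClifford.maxOrders ![-1, -1, -3])).ncard = 2 :=
  ⟨RationalClifford.three_units.1, RationalClifford.three_units.2, RationalClifford.four_units,
    RationalClifford.unit_three, RationalClifford.unit_unit_three⟩
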